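/- **Conventions.** Let $\mathcal L_A=\{+,\cdot,S,<,0\}$ and let $\mathcal L_A(I)$ be its extension by a unary predicate $I$. $\mathrm{PA}(I)$ is Robinson's arithmetic $\mathrm Q$ together with the induction scheme for all $\mathcal L_A(I)$-formulas. $\mathrm{PAI}$ is $\mathrm{PA}(I)$ together with the sentence "$I$ is unbounded" and, for every $n$ and every $\mathcal L_A$-formula $\varphi(v_1,\dots,v_n)$, the sentence $\forall x_1,\dots,x_n,y_1,\dots,y_n\in I\ \bigl[x_1<\dots<x_n\wedge y_1<\dots<y_n\rightarrow(\varphi(x_1,\dots,x_n)\leftrightarrow\varphi(y_1,\dots,y_n))\bigr]$. $\mathrm{PAI}^\circ$ is obtained from $\mathrm{PAI}$ by adding, in each of these sentences, the premise $\ulcorner\varphi\urcorner<x_1\wedge\ulcorner\varphi\urcorner<y_1$. The sentence $\alpha$ of $\mathcal L_A(I)$ is defined as follows. For an $\mathcal L_A$-formula $\varphi$ built with $\neg,\vee,\exists$, let $\varphi^*$ be $\varphi$ if $\varphi$ is atomic, $(\neg\varphi)^*=\neg\varphi^*$, $(\varphi\vee\psi)^*=\varphi^*\vee\psi^*$, and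 $(\exists y\,\varphi)^*=\exists y<z_1\,\widetilde{\varphi^*}$, where $z_1,z_2,\dots$ are new variables and $\widetilde{\varphi^*}$ results from $\varphi^*$ by replacing each $z_i$ by $z_{i+1}$; thus $\varphi^*=\varphi^*(\bar x,z_1,\dots,z_k)$, where $k$ is the quantifier depth of $\varphi$, has only bounded quantifiers; this is formalized in arithmetic. The formula $\sigma(\varphi,\bar a)$ says: for some $m$, $\varphi$ is (the code of) an $\mathcal L_A$-formula in $m$ variables and $\bar a$ is an $m$-tuple, and $\varphi^*(\bar a,i_1,\dots,i_k)$ is true according to the arithmetical satisfaction predicate for formulas with bounded quantifiers, where $j$ is the first element of $I$ that is larger than $\ulcorner\varphi\urcorner$ and than all entries of $\bar a$, and $i_1<\dots<i_k$ are the first $k$ elements of $I$ above $j$. The sentence $\alpha$ says that $\sigma$ defines a full satisfaction class, i.e. that $\sigma$ satisfies Tarski's recursive conditions for all (codes of) $\mathcal L_A$-formulas and all tuples. "Definable" means definable with parameters. A structure $\mathcal N$ is interpreted in a structure $\mathcal M$, written $\mathcal M\trianglerighteq\mathcal N$, if the universe of $\mathcal N$ is a definable subset of $\mathcal M$ and all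 functions and relations of $\mathcal N$ are definable in $\mathcal M$. For a theory $U$ and a model $\mathcal M$ of $U$ let $(\mathbb S)$ be the property: for all models $\mathcal N,\mathcal M^*$ of $U$, if $\mathcal M\trianglerighteq\mathcal N\trianglerighteq\mathcal M^*$ and there is an $\mathcal M$-definable isomorphism $\mathcal M\to\mathcal M^*$, then there is an $\mathcal M$-definable isomorphism $\mathcal M\to\mathcal N$. $U$ is solid if $(\mathbb S)$ holds at every model of $U$, and nowhere solid if $(\mathbb S)$ fails at every model of $U$. **Theorem 5.5.** 1. Each $U\in\{\mathrm{PAI}^\circ,\ \mathrm{PAI},\ \mathrm{PAI}+\alpha\}$ is nowhere solid, and $U$ is not solid. 2. If $(\mathcal M,I)\models\mathrm{PAI}$ and $2I=\{2i:i\in I\}$, then $(\mathcal M,2I)\models\mathrm{PAI}$, each of $(\mathcal M,I)$ and $(\mathcal M,2I)$ is interpreted in the other (by the identity on the universe), and there is no $(\mathcal M,I)$-definable isomorphism between $(\mathcal M,I)$ and $(\mathcal M,2I)$. 3. Every model $(\mathcal M,I)$ of $\mathrm{PA}(I)$ is definably rigid: the identity is the only $(\mathcal M,I)$-definable automorphism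 of the $\mathcal L_A$-structure $\mathcal M$. -/

import Mathlib

universe u

namespace ArithInd

noncomputable section

open FirstOrder FirstOrder.Language

/-! ## Languages -/

/-- Function symbols of arithmetic: `0`, `S`, `+`, `·`. -/
inductive ArithFunc : ℕ → Type
  | zero : ArithFunc 0
  | succ : ArithFunc 1
  | add : ArithFunc 2
  | mul : ArithFunc 2

/-- Relation symbols of arithmetic: `<`. -/
inductive ArithRel : ℕ → Type
  | lt : ArithRel 2

/-- The language of arithmetic `{+, ·, S, <, 0}`. -/
def LA : FirstOrder.Language.{0, 0} := ⟨ArithFunc, ArithRel⟩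

/-- The single unary predicate `I`. -/
inductive IndRel : ℕ → Type
  | mem : IndRel 1

/-- The language with one unary predicate symbol `I`. -/
def LI : FirstOrder.Language.{0, 0} := ⟨fun _ => Empty, IndRel⟩

/-- The language of arithmetic together with the unary predicate `I`. -/
abbrev LAI : FirstOrder.Language.{0, 0} := LA.sum LI

/-! ## Terms and formulas

Formulas have free variables in `Fin n`.  `exF` and `allF` bind the variable with the largest
index: the variable bound by a quantifier that produces a formula in `n` variables has index `n`,
and all other variables keep their indices. -/

section Formulas

variable {α : Type} {n : ℕ} {L : FirstOrder.Language.{0, 0}}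

instance : Zero (LA.Term α) := ⟨Constants.term (L := LA) ArithFunc.zero⟩
instance : Add (LA.Term α) := ⟨Functions.apply₂ (L := LA) ArithFunc.add⟩
instance : Mul (LA.Term α) := ⟨Functions.apply₂ (L := LA) ArithFunc.mul⟩

/-- The successor term. -/
def sc (t : LA.Term α) : LA.Term α := Functions.apply₁ (L := LA) ArithFunc.succ t

/-- Numerals. -/
def num : ℕ → LA.Term α
  | 0 => 0
  | k + 1 => sc (num k)

/-- The variable with index `k`. -/
def v (k : Fin n) : LA.Term (Fin n) := Term.var k

/-- The formula `t = s`. -/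
def eqF (t s : LA.Term α) : LA.Formula α := t.equal s

/-- The formula `t < s`. -/
def ltF (t s : LA.Term α) : LA.Formula α := Relations.formula₂ (L := LA) ArithRel.lt t s

/-- The formula `t ≤ s`. -/
def leF (t s : LA.Term α) : LA.Formula α := ltF t s ⊔ eqF t s

/-- Universal quantification over the last variable. -/
def allF (φ : L.Formula (Fin (n + 1))) : L.Formula (Fin n) :=
  BoundedFormula.all (n := 0)
    (BoundedFormula.relabel (n := 1) (fun i : Fin (n + 1) =>
      (Fin.lastCases (Sum.inr 0) (fun j => Sum.inl j) i : Fin n ⊕ Fin 1)) φ)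

/-- Existential quantification over the last variable. -/
def exF (φ : L.Formula (Fin (n + 1))) : L.Formula (Fin n) := (allF φ.not).not

/-- Universal closure of a formula with finitely many free variables. -/
def closure {β : Type} [Finite β] (φ : L.Formula β) : L.Sentence :=
  Formula.iAlls β (φ.relabel Sum.inr : L.Formula (Empty ⊕ β))

/-- An arithmetical formula seen as a formula in the language with `I`. -/
def lift (φ : LA.Formula α) : LAI.Formula α := (LHom.sumInl : LA →ᴸ LAI).onFormula φ

/-- An arithmetical term seen as a term in the language with `I`. -/
def liftT (t : LA.Term α) : LAI.Term α := (LHom.sumInl : LA →ᴸ LAI).onTerm t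

/-- The formula `t ∈ I`. -/
def memI (t : LA.Term α) : LAI.Formula α :=
  Relations.formula₁ (L := LAI) (Sum.inr IndRel.mem) (liftT t)

end Formulas

/-! ## Peano arithmetic with a predicate -/

/-- Robinson's arithmetic `Q`. -/
def Q : LA.Theory :=
  { closure (β := Fin 1) (eqF (sc (v 0)) 0).not,
    closure (β := Fin 2) ((eqF (sc (v 0)) (sc (v 1))).imp (eqF (v 0) (v 1))),
    closure (β := Fin 1) ((eqF (v 0) 0).not.imp (exF (eqF (v 0) (sc (v 1))))),
    closure (β := Fin 1) (eqF (v 0 + 0) (v 0)),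
    closure (β := Fin 2) (eqF (v 0 + sc (v 1)) (sc (v 0 + v 1))),
    closure (β := Fin 1) (eqF (v 0 * 0) 0),
    closure (β := Fin 2) (eqF (v 0 * sc (v 1)) (v 0 * v 1 + v 0)),
    closure (β := Fin 2) ((ltF (v 0) (v 1)).iff (exF (eqF (sc (v 2) + v 0) (v 1)))) }

/-- The induction axiom for `φ(p, x)`: for all `p`, if `φ(p, 0)` and `φ(p, x) → φ(p, S x)` for
all `x`, then `φ(p, x)` for all `x`. -/
def induction {n : ℕ} (φ : LAI.Formula (Fin (n + 1))) : LAI.Sentence :=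
  closure (β := Fin n) <| Formula.imp
    (φ.subst (Fin.snoc (α := fun _ => LAI.Term (Fin n)) (fun i => Term.var i) (liftT 0)))
    (Formula.imp
      (allF (φ.imp (φ.subst (Fin.snoc (α := fun _ => LAI.Term (Fin (n + 1)))
        (fun i => Term.var i.castSucc) (liftT (sc (v (Fin.last n))))))))
      (allF φ))

/-- `PA(I)`: Robinson's arithmetic with induction for all formulas in the language with `I`. -/
def PAofI : LAI.Theory :=
  (LHom.sumInl : LA →ᴸ LAI).onTheory Q ∪
    {s | ∃ (n : ℕ) (φ : LAI.Formula (Fin (n + 1))), s = induction φ}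

/-! ## Gödel numbers

The codes of syntactic objects are built by the pairing function `⟨a, b⟩ = (a + b)² + a`.
Coded formulas use the connectives `¬`, `∨`, `∃` and de Bruijn indices: in the scope of a
quantifier the index `0` is the bound variable, and the index `i + 1` is the variable that has
index `i` outside.  There is a second sort of variables `z_0, z_1, …`. -/

section Codes

variable {T : Type*} [Zero T] [Add T] [Mul T]

/-- The pairing function, for numbers and for terms. -/
def pr (a b : T) : T := (a + b) * (a + b) + a

end Codes

section NatCodes

/-- Gödel number of the arithmetical term `t` whose variables are the free variables in `Fin n`
and the bound variables in `Fin k`. -/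
def gnTerm {n k : ℕ} : LA.Term (Fin n ⊕ Fin k) → ℕ
  | .var (Sum.inl i) => pr 0 (k + i)
  | .var (Sum.inr i) => pr 0 (k - 1 - i)
  | .func ArithFunc.zero _ => pr 2 0
  | .func ArithFunc.succ ts => pr 3 (gnTerm (ts 0))
  | .func ArithFunc.add ts => pr 4 (pr (gnTerm (ts 0)) (gnTerm (ts 1)))
  | .func ArithFunc.mul ts => pr 5 (pr (gnTerm (ts 0)) (gnTerm (ts 1)))

/-- Gödel number of an arithmetical formula, where `⊥`, `φ → ψ` and `∀ x φ` are read as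
`¬ 0 = 0`, `¬ φ ∨ ψ` and `¬ ∃ x ¬ φ`. -/
def gn {n : ℕ} : {k : ℕ} → LA.BoundedFormula (Fin n) k → ℕ
  | _, .falsum => pr 8 (pr 6 (pr (pr 2 0) (pr 2 0)))
  | _, .equal t s => pr 6 (pr (gnTerm t) (gnTerm s))
  | _, .rel ArithRel.lt ts => pr 7 (pr (gnTerm (ts 0)) (gnTerm (ts 1)))
  | _, .imp φ ψ => pr 9 (pr (pr 8 (gn φ)) (gn ψ))
  | _, .all φ => pr 8 (pr 10 (pr 8 (gn φ)))

end NatCodes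

/-! ## The theories `PAI` and `PAI°` -/

/-- `I` is unbounded. -/
def Ubd : LAI.Sentence :=
  closure (β := Fin 1) (exF (memI (v 1) ⊓ lift (ltF (v 0) (v 1))))

/-- The terms listed by `t` are elements of `I`, in increasing order. -/
def incrI {α : Type} {n : ℕ} (t : Fin n → LA.Term α) : LAI.Formula α :=
  Formula.iInf (fun i : Fin n => memI (t i)) ⊓
    Formula.iInf (fun p : {p : Fin n × Fin n // p.1 < p.2} => lift (ltF (t p.1.1) (t p.1.2)))

/-- The tuple `x` of variables. -/
def xs {n : ℕ} (i : Fin n) : LA.Term (Fin n ⊕ Fin n) := Term.var (Sum.inl i)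

/-- The tuple `y` of variables. -/
def ys {n : ℕ} (i : Fin n) : LA.Term (Fin n ⊕ Fin n) := Term.var (Sum.inr i)

/-- Any two increasing tuples `x`, `y` from `I` agree on `φ`. -/
def Indis {n : ℕ} (φ : LA.Formula (Fin n)) : LAI.Sentence :=
  closure (β := Fin n ⊕ Fin n) <|
    (incrI xs ⊓ incrI ys).imp ((lift (φ.subst xs)).iff (lift (φ.subst ys)))

/-- Any two increasing tuples `x`, `y` from `I` whose first entries exceed the Gödel number of `φ`
agree on `φ`. -/
def IndisCirc {n : ℕ} (φ : LA.Formula (Fin n)) : LAI.Sentence :=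
  closure (β := Fin n ⊕ Fin n) <|
    (incrI xs ⊓ incrI ys ⊓
      Formula.iInf (fun i : {i : Fin n // i.val = 0} =>
        lift (ltF (num (gn φ)) (xs i.1)) ⊓ lift (ltF (num (gn φ)) (ys i.1)))).imp
      ((lift (φ.subst xs)).iff (lift (φ.subst ys)))

/-- Peano arithmetic with indiscernibles. -/
def PAI : LAI.Theory :=
  PAofI ∪ {Ubd} ∪ {s | ∃ (n : ℕ) (φ : LA.Formula (Fin n)), s = Indis φ}

/-- The variant of `PAI` with the weakened indiscernibility scheme. -/
def PAICirc : LAI.Theory :=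
  PAofI ∪ {Ubd} ∪ {s | ∃ (n : ℕ) (φ : LA.Formula (Fin n)), s = IndisCirc φ}

/-! ## Arithmetized syntax

All the formulas below are arithmetical.  An inductively defined predicate is expressed by the
existence of a coded finite set `W` that contains the object in question and in which every member
is obtained from other members of `W` by one of the clauses. -/

section Arithmetization

variable {α : Type} {n : ℕ}

/-- Codes of variables, function terms and formulas. -/
def cVar (i : LA.Term α) : LA.Term α := pr (num 0) i
def cZ (i : LA.Term α) : LA.Term α := pr (num 1) i
def cZero : LA.Term α := pr (num 2) 0
def cSucc (t : LA.Term α) : LA.Term α := pr (num 3) t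
def cAdd (t s : LA.Term α) : LA.Term α := pr (num 4) (pr t s)
def cMul (t s : LA.Term α) : LA.Term α := pr (num 5) (pr t s)
def cEq (t s : LA.Term α) : LA.Term α := pr (num 6) (pr t s)
def cLt (t s : LA.Term α) : LA.Term α := pr (num 7) (pr t s)
def cNeg (φ : LA.Term α) : LA.Term α := pr (num 8) φ
def cOr (φ ψ : LA.Term α) : LA.Term α := pr (num 9) (pr φ ψ)
def cEx (φ : LA.Term α) : LA.Term α := pr (num 10) φ

/-- The code of the bounded quantification `∃ y < t, φ`, i.e. `∃ y ¬ (¬ y < t ∨ ¬ φ)`. -/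
def cBex (t φ : LA.Term α) : LA.Term α :=
  cEx (cNeg (cOr (cNeg (cLt (cVar 0) t)) (cNeg φ)))

/-- Tuples are coded as lists: the empty tuple is `0`, and `cons b a` has first entry `b`. -/
def cons (b a : LA.Term α) : LA.Term α := sc (pr b a)

/-- Variables `x, c, d`: `x` belongs to the finite set coded by `c = ⟨b, e⟩` and `d`, i.e. `x < b`
and `1 + (x + 1) · d` divides `e`. -/
def memF : LA.Formula (Fin 3) :=
  exF <| exF <| eqF (v 1) (pr (v 3) (v 4)) ⊓ ltF (v 0) (v 3) ⊓
    exF (eqF (sc (sc (v 0) * v 2) * v 5) (v 4))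

/-- `x` belongs to the finite set coded by `c`, `d`. -/
def inW (x c d : LA.Term (Fin n)) : LA.Formula (Fin n) := memF.subst ![x, c, d]

/-- Variables `l, m, k, t`: `t` is a term whose ordinary variables have indices in `[l, m)` and
whose `z`-variables have indices below `k`. -/
def termF : LA.Formula (Fin 4) :=
  exF <| exF <| inW (v 3) (v 4) (v 5) ⊓ allF ((inW (v 6) (v 4) (v 5)).imp
    (exF (leF (v 0) (v 7) ⊓ ltF (v 7) (v 1) ⊓ eqF (v 6) (cVar (v 7))) ⊔
     exF (ltF (v 7) (v 2) ⊓ eqF (v 6) (cZ (v 7))) ⊔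
     eqF (v 6) cZero ⊔
     exF (inW (v 7) (v 4) (v 5) ⊓ eqF (v 6) (cSucc (v 7))) ⊔
     exF (exF (inW (v 7) (v 4) (v 5) ⊓ inW (v 8) (v 4) (v 5) ⊓
       (eqF (v 6) (cAdd (v 7) (v 8)) ⊔ eqF (v 6) (cMul (v 7) (v 8)))))))

/-- `t` is a term whose ordinary variables have indices in `[l, m)` and whose `z`-variables have
indices below `k`. -/
def isTermIn (l m k t : LA.Term (Fin n)) : LA.Formula (Fin n) := termF.subst ![l, m, k, t]

/-- `t` is a term of arithmetic in the variables with indices below `m`. -/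
def isTerm (m t : LA.Term (Fin n)) : LA.Formula (Fin n) := isTermIn 0 m 0 t

/-- Variables `m, φ`: `φ` is a formula of arithmetic, with free variables of index below `m`.
The members of `W` are pairs `⟨m, φ⟩`. -/
def formF : LA.Formula (Fin 2) :=
  exF <| exF <| inW (pr (v 0) (v 1)) (v 2) (v 3) ⊓ allF ((inW (v 4) (v 2) (v 3)).imp
    (exF <| exF <| exF <|
      (isTerm (v 5) (v 6) ⊓ isTerm (v 5) (v 7) ⊓
        (eqF (v 4) (pr (v 5) (cEq (v 6) (v 7))) ⊔ eqF (v 4) (pr (v 5) (cLt (v 6) (v 7))))) ⊔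
      (inW (pr (v 5) (v 6)) (v 2) (v 3) ⊓ eqF (v 4) (pr (v 5) (cNeg (v 6)))) ⊔
      (inW (pr (v 5) (v 6)) (v 2) (v 3) ⊓ inW (pr (v 5) (v 7)) (v 2) (v 3) ⊓
        eqF (v 4) (pr (v 5) (cOr (v 6) (v 7)))) ⊔
      (inW (pr (sc (v 5)) (v 6)) (v 2) (v 3) ⊓ eqF (v 4) (pr (v 5) (cEx (v 6))))))

/-- `φ` is a formula of arithmetic in `m` variables. -/
def isForm (m φ : LA.Term (Fin n)) : LA.Formula (Fin n) := formF.subst ![m, φ]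

/-- Variables `m, a`: `a` is an `m`-tuple.  The members of `W` are pairs `⟨m, a⟩`. -/
def tupF : LA.Formula (Fin 2) :=
  exF <| exF <| inW (pr (v 0) (v 1)) (v 2) (v 3) ⊓ allF ((inW (v 4) (v 2) (v 3)).imp
    (eqF (v 4) (pr 0 0) ⊔
     exF (exF (exF (inW (pr (v 5) (v 6)) (v 2) (v 3) ⊓
       eqF (v 4) (pr (sc (v 5)) (cons (v 7) (v 6))))))))

/-- `a` is an `m`-tuple. -/
def isTup (m a : LA.Term (Fin n)) : LA.Formula (Fin n) := tupF.subst ![m, a]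

/-- Variables `a, i, x`: the entry of the tuple `a` with index `i` is `x`.
The members of `W` are pairs `⟨i, a⟩`. -/
def lookF : LA.Formula (Fin 3) :=
  exF <| exF <| inW (pr (v 1) (v 0)) (v 3) (v 4) ⊓ allF ((inW (v 5) (v 3) (v 4)).imp
    (exF (eqF (v 5) (pr 0 (cons (v 2) (v 6)))) ⊔
     exF (exF (exF (inW (pr (v 6) (v 7)) (v 3) (v 4) ⊓
       eqF (v 5) (pr (sc (v 6)) (cons (v 8) (v 7))))))))

/-- The entry of the tuple `a` with index `i` is `x`. -/
def entry (a i x : LA.Term (Fin n)) : LA.Formula (Fin n) := lookF.subst ![a, i, x]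

/-- Variables `a, g, t, x`: the term `t` has the value `x` when the ordinary variables are
evaluated by the tuple `a` and the `z`-variables by the tuple `g`.
The members of `W` are pairs `⟨t, x⟩`. -/
def valF : LA.Formula (Fin 4) :=
  exF <| exF <| inW (pr (v 2) (v 3)) (v 4) (v 5) ⊓ allF ((inW (v 6) (v 4) (v 5)).imp
    (exF (exF (entry (v 0) (v 7) (v 8) ⊓ eqF (v 6) (pr (cVar (v 7)) (v 8)))) ⊔
     exF (exF (entry (v 1) (v 7) (v 8) ⊓ eqF (v 6) (pr (cZ (v 7)) (v 8)))) ⊔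
     eqF (v 6) (pr cZero 0) ⊔
     exF (exF (inW (pr (v 7) (v 8)) (v 4) (v 5) ⊓ eqF (v 6) (pr (cSucc (v 7)) (sc (v 8))))) ⊔
     exF (exF (exF (exF (inW (pr (v 7) (v 8)) (v 4) (v 5) ⊓ inW (pr (v 9) (v 10)) (v 4) (v 5) ⊓
       (eqF (v 6) (pr (cAdd (v 7) (v 9)) (v 8 + v 10)) ⊔
        eqF (v 6) (pr (cMul (v 7) (v 9)) (v 8 * v 10)))))))))

/-- The value of the term `t` at `a`, `g` is `x`. -/
def val (a g t x : LA.Term (Fin n)) : LA.Formula (Fin n) := valF.subst ![a, g, t, x]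

/-- Variables `s, φ, ψ`: `ψ` is the result of bounding the quantifiers of `φ`, where a quantifier
in the scope of `i` other quantifiers is bounded by the variable `z_{s + i}`.  For `s = 0` this is
the transformation `φ ↦ φ*` with `(∃ y φ)* = ∃ y < z_0, φ*⁺`, where `φ*⁺` arises from `φ*` by
raising the indices of all `z`-variables by one.  The members of `W` are triples `⟨s, ⟨φ, ψ⟩⟩`. -/
def starF : LA.Formula (Fin 3) :=
  exF <| exF <| inW (pr (v 0) (pr (v 1) (v 2))) (v 3) (v 4) ⊓ allF ((inW (v 5) (v 3) (v 4)).imp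
    (exF <| exF <| exF <| exF <| exF <|
      eqF (v 5) (pr (v 6) (pr (cEq (v 7) (v 8)) (cEq (v 7) (v 8)))) ⊔
      eqF (v 5) (pr (v 6) (pr (cLt (v 7) (v 8)) (cLt (v 7) (v 8)))) ⊔
      (inW (pr (v 6) (pr (v 7) (v 8))) (v 3) (v 4) ⊓
        eqF (v 5) (pr (v 6) (pr (cNeg (v 7)) (cNeg (v 8))))) ⊔
      (inW (pr (v 6) (pr (v 7) (v 8))) (v 3) (v 4) ⊓
        inW (pr (v 6) (pr (v 9) (v 10))) (v 3) (v 4) ⊓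
        eqF (v 5) (pr (v 6) (pr (cOr (v 7) (v 9)) (cOr (v 8) (v 10))))) ⊔
      (inW (pr (sc (v 6)) (pr (v 7) (v 8))) (v 3) (v 4) ⊓
        eqF (v 5) (pr (v 6) (pr (cEx (v 7)) (cBex (cZ (v 6)) (v 8)))))))

/-- `ψ` is the formula `φ*`. -/
def isStar (φ ψ : LA.Term (Fin n)) : LA.Formula (Fin n) := starF.subst ![0, φ, ψ]

/-- Variables `φ, k`: the quantifier depth of `φ` is `k`.  The members of `W` are pairs
`⟨φ, k⟩`. -/
def depthF : LA.Formula (Fin 2) :=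
  exF <| exF <| inW (pr (v 0) (v 1)) (v 2) (v 3) ⊓ allF ((inW (v 4) (v 2) (v 3)).imp
    (exF <| exF <| exF <| exF <|
      eqF (v 4) (pr (cEq (v 5) (v 6)) 0) ⊔
      eqF (v 4) (pr (cLt (v 5) (v 6)) 0) ⊔
      (inW (pr (v 5) (v 6)) (v 2) (v 3) ⊓ eqF (v 4) (pr (cNeg (v 5)) (v 6))) ⊔
      (inW (pr (v 5) (v 6)) (v 2) (v 3) ⊓ inW (pr (v 7) (v 8)) (v 2) (v 3) ⊓
        ((leF (v 8) (v 6) ⊓ eqF (v 4) (pr (cOr (v 5) (v 7)) (v 6))) ⊔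
         (leF (v 6) (v 8) ⊓ eqF (v 4) (pr (cOr (v 5) (v 7)) (v 8))))) ⊔
      (inW (pr (v 5) (v 6)) (v 2) (v 3) ⊓ eqF (v 4) (pr (cEx (v 5)) (sc (v 6))))))

/-- The quantifier depth of `φ` is `k`. -/
def isDepth (φ k : LA.Term (Fin n)) : LA.Formula (Fin n) := depthF.subst ![φ, k]

/-- Variables `g, ψ, a, b`: the formula `ψ`, all of whose quantifiers are bounded by terms, has the
truth value `b` (`0` or `1`) when its ordinary variables are evaluated by the tuple `a` and its
`z`-variables by the tuple `g`.  The members of `W` are triples `⟨ψ, ⟨a, b⟩⟩`. -/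
def satF : LA.Formula (Fin 4) :=
  exF <| exF <| inW (pr (v 1) (pr (v 2) (v 3))) (v 4) (v 5) ⊓ allF ((inW (v 6) (v 4) (v 5)).imp
    (exF <|
      -- `7` is the evaluation `a` of the member, `8, 9` are terms with values `10, 11`
      (exF <| exF <| exF <| exF <| val (v 7) (v 0) (v 8) (v 10) ⊓ val (v 7) (v 0) (v 9) (v 11) ⊓
        ((eqF (v 10) (v 11) ⊓ eqF (v 6) (pr (cEq (v 8) (v 9)) (pr (v 7) (num 1)))) ⊔
         ((eqF (v 10) (v 11)).not ⊓ eqF (v 6) (pr (cEq (v 8) (v 9)) (pr (v 7) 0))) ⊔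
         (ltF (v 10) (v 11) ⊓ eqF (v 6) (pr (cLt (v 8) (v 9)) (pr (v 7) (num 1)))) ⊔
         ((ltF (v 10) (v 11)).not ⊓ eqF (v 6) (pr (cLt (v 8) (v 9)) (pr (v 7) 0))))) ⊔
      -- `8` is negated
      (exF <|
        (inW (pr (v 8) (pr (v 7) 0)) (v 4) (v 5) ⊓
          eqF (v 6) (pr (cNeg (v 8)) (pr (v 7) (num 1)))) ⊔
        (inW (pr (v 8) (pr (v 7) (num 1))) (v 4) (v 5) ⊓
          eqF (v 6) (pr (cNeg (v 8)) (pr (v 7) 0)))) ⊔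
      -- the disjunction of `8` and `9`
      (exF <| exF <|
        ((inW (pr (v 8) (pr (v 7) (num 1))) (v 4) (v 5) ⊔
            inW (pr (v 9) (pr (v 7) (num 1))) (v 4) (v 5)) ⊓
          eqF (v 6) (pr (cOr (v 8) (v 9)) (pr (v 7) (num 1)))) ⊔
        (inW (pr (v 8) (pr (v 7) 0)) (v 4) (v 5) ⊓ inW (pr (v 9) (pr (v 7) 0)) (v 4) (v 5) ⊓
          eqF (v 6) (pr (cOr (v 8) (v 9)) (pr (v 7) 0)))) ⊔
      -- `∃ y < 8, 9`, where the variable `y` does not occur in the term `8`, whose value is `10`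
      (exF <| exF <| exF <|
        exF (exF (isTermIn (num 1) (v 11) (v 12) (v 8))) ⊓
        val (cons 0 (v 7)) (v 0) (v 8) (v 10) ⊓
        ((exF (ltF (v 11) (v 10) ⊓
            inW (pr (v 9) (pr (cons (v 11) (v 7)) (num 1))) (v 4) (v 5)) ⊓
          eqF (v 6) (pr (cBex (v 8) (v 9)) (pr (v 7) (num 1)))) ⊔
         (allF ((ltF (v 11) (v 10)).imp
            (inW (pr (v 9) (pr (cons (v 11) (v 7)) 0)) (v 4) (v 5))) ⊓
          eqF (v 6) (pr (cBex (v 8) (v 9)) (pr (v 7) 0)))))))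

/-- The formula `ψ` with bounded quantifiers is true at `a`, `g`. -/
def sat (g ψ a : LA.Term (Fin n)) : LA.Formula (Fin n) := satF.subst ![g, ψ, a, num 1]

end Arithmetization

/-! ## The formula `σ` and the sentence `α` -/

section Alpha

variable {n : ℕ}

/-- Variables `φ, a, j`: `φ < j` and all entries of `a` are below `j`. -/
def belowF : LA.Formula (Fin 3) :=
  ltF (v 0) (v 2) ⊓ allF (allF ((entry (v 1) (v 3) (v 4)).imp (ltF (v 4) (v 2))))

/-- Variables `φ, a, j`: `j` is the first element of `I` above `φ` and all entries of `a`. -/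
def startF : LAI.Formula (Fin 3) :=
  memI (v 2) ⊓ lift belowF ⊓
    allF ((memI (v 3) ⊓ lift (belowF.subst ![v 0, v 1, v 3])).imp (lift (leF (v 2) (v 3))))

/-- Variables `j, g, i, w`: `w` is above `j` and above the entries of `g` of index below `i`. -/
def aboveF : LA.Formula (Fin 4) :=
  ltF (v 0) (v 3) ⊓
    allF (allF ((ltF (v 4) (v 2) ⊓ entry (v 1) (v 4) (v 5)).imp (ltF (v 5) (v 3))))

/-- Variables `j, g`: the tuple `g` lists, in increasing order and without omission, the first
elements of `I` above `j`. -/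
def firstF : LAI.Formula (Fin 2) :=
  allF <| allF <| (lift (entry (v 1) (v 2) (v 3))).imp
    (memI (v 3) ⊓ lift aboveF ⊓
      allF ((memI (v 4) ⊓ lift (aboveF.subst ![v 0, v 1, v 2, v 4])).imp
        (lift (leF (v 3) (v 4)))))

/-- The formula `σ`, with variables `φ, a`: for some `m`, `φ` is a formula in `m` variables and `a`
is an `m`-tuple; and `φ*(a, g)` is true, where `g` consists of the first `k` elements of `I` above
`j`, `k` is the quantifier depth of `φ`, and `j` is the first element of `I` above `φ` and all
entries of `a`. -/
def sigmaF : LAI.Formula (Fin 2) :=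
  -- the bound variables are `m, ψ, k, j, g`, where `ψ = φ*`
  exF <| exF <| exF <| exF <| exF <|
    lift (isForm (v 2) (v 0) ⊓ isTup (v 2) (v 1) ⊓ isStar (v 0) (v 3) ⊓ isDepth (v 0) (v 4)) ⊓
    startF.subst ![liftT (v 0), liftT (v 1), liftT (v 5)] ⊓
    lift (isTup (v 4) (v 6)) ⊓
    firstF.subst ![liftT (v 5), liftT (v 6)] ⊓
    lift (sat (v 6) (v 3) (v 1))

/-- `σ(φ, a)`. -/
def sigma (φ a : LA.Term (Fin n)) : LAI.Formula (Fin n) := sigmaF.subst ![liftT φ, liftT a]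

/-- The sentence `α`: the formula `σ` satisfies Tarski's conditions for a satisfaction predicate
for all arithmetical formulas and all tuples. -/
def alpha : LAI.Sentence :=
  -- `0` is the number of variables `m`, and `1` is an `m`-tuple `a`
  closure (β := Fin 2) <| (lift (isTup (v 0) (v 1))).imp <|
    allF (allF ((lift (isTerm (v 0) (v 2) ⊓ isTerm (v 0) (v 3))).imp
      (((sigma (cEq (v 2) (v 3)) (v 1)).iff
          (lift (exF (val (v 1) 0 (v 2) (v 4) ⊓ val (v 1) 0 (v 3) (v 4))))) ⊓
       ((sigma (cLt (v 2) (v 3)) (v 1)).iff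
          (lift (exF (exF (val (v 1) 0 (v 2) (v 4) ⊓ val (v 1) 0 (v 3) (v 5) ⊓
            ltF (v 4) (v 5))))))))) ⊓
    allF ((lift (isForm (v 0) (v 2))).imp
      ((sigma (cNeg (v 2)) (v 1)).iff (sigma (v 2) (v 1)).not)) ⊓
    allF (allF ((lift (isForm (v 0) (v 2) ⊓ isForm (v 0) (v 3))).imp
      ((sigma (cOr (v 2) (v 3)) (v 1)).iff (sigma (v 2) (v 1) ⊔ sigma (v 3) (v 1))))) ⊓
    allF ((lift (isForm (sc (v 0)) (v 2))).imp
      ((sigma (cEx (v 2)) (v 1)).iff (exF (sigma (v 2) (cons (v 3) (v 1))))))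

/-- The theory `PAI + α`. -/
def PAIalpha : LAI.Theory := PAI ∪ {alpha}

end Alpha

/-! ## Interpretations and solidity -/

section Solidity

variable (L : FirstOrder.Language.{0, 0})

/-- The map `f : N → M` identifies the structure `N` with a structure whose universe is a
definable subset of `M` and whose functions and relations are definable in `M`, with parameters
allowed everywhere. -/
structure IsInterpretation (N M : Type u) [L.Structure N] [L.Structure M] (f : N → M) : Prop where
  injective : Function.Injective f
  universe_definable : (Set.univ : Set M).Definable₁ L (Set.range f)
  function_definable : ∀ (n : ℕ) (F : L.Functions n), (Set.univ : Set M).Definable L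
    {x : Fin (n + 1) → M | ∃ y : Fin n → N,
      x = Fin.snoc (α := fun _ => M) (fun i => f (y i)) (f (Structure.funMap F y))}
  relation_definable : ∀ (n : ℕ) (R : L.Relations n), (Set.univ : Set M).Definable L
    {x : Fin n → M | ∃ y : Fin n → N, x = (fun i => f (y i)) ∧ Structure.RelMap R y}

/-- The map `f : M → M` is definable in `M`, with parameters allowed. -/
def DefinableMap (M : Type u) [L.Structure M] (f : M → M) : Prop :=
  (Set.univ : Set M).Definable₂ L {p : M × M | p.2 = f p.1}

variable {L}

/-- The solidity property at `M`: whenever `N` is interpreted in `M` (via `f`) and `M'` in `N`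
(via `g`), and there is an `M`-definable isomorphism from `M` to `M'`, then there is an
`M`-definable isomorphism from `M` to `N`. -/
def SolidAt (U : L.Theory) (M : Theory.ModelType.{0, 0, u} U) : Prop :=
  ∀ (N M' : Theory.ModelType.{0, 0, u} U) (f : N → M) (g : M' → N),
    IsInterpretation L N M f → IsInterpretation L M' N g →
      (∃ i₀ : M ≃[L] M', DefinableMap L M (fun x => f (g (i₀ x)))) →
        ∃ i : M ≃[L] N, DefinableMap L M (fun x => f (i x))

/-- `U` is solid. -/
def Solid (U : L.Theory) : Prop := ∀ M : Theory.ModelType.{0, 0, u} U, SolidAt U M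

/-- `U` is nowhere solid. -/
def NowhereSolid (U : L.Theory) : Prop := ∀ M : Theory.ModelType.{0, 0, u} U, ¬ SolidAt U M

end Solidity

/-! ## Expansions of a model of arithmetic by a subset -/

/-- The universe of the structure `(M, I)`. -/
def Expansion (M : Type u) (_I : Set M) : Type u := M

instance (M : Type u) [h : LA.Structure M] (I : Set M) : LA.Structure (Expansion M I) := h

instance (M : Type u) (I : Set M) : LI.Structure (Expansion M I) where
  funMap := fun f _ => nomatch f
  RelMap := fun {_} R => match R with
    | IndRel.mem => fun x => x 0 ∈ I

/-- The set `2I` of all `i + i` with `i ∈ I`. -/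
def double {M : Type u} [LA.Structure M] (I : Set M) : Set M :=
  {x | ∃ i ∈ I, x = Structure.funMap (L := LA) ArithFunc.add ![i, i]}

end

end ArithInd

open FirstOrder FirstOrder.Language ArithInd

namespace ArithInd

/-! ## Semantics of the formula builders -/

@[simp]
theorem snoc_vecCons {M : Type*} {n : ℕ} (a : M) (e : Fin n → M) (x : M) :
    (Fin.snoc (α := fun _ => M) (Matrix.vecCons a e) x : Fin (n + 1 + 1) → M) =
      Matrix.vecCons a (Fin.snoc (α := fun _ => M) e x) :=
  (Fin.cons_snoc_eq_snoc_cons (β := M) a e x).symm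

@[simp]
theorem snoc_vecEmpty {M : Type*} (x : M) :
    (Fin.snoc (α := fun _ => M) (![] : Fin 0 → M) x : Fin 1 → M) = ![x] := by
  funext i
  fin_cases i
  rfl

theorem realize_vecCons {L : FirstOrder.Language.{0, 0}} {M α : Type*} [L.Structure M]
    {n : ℕ} (t : L.Term α) (ts : Fin n → L.Term α) (e : α → M) :
    (fun i => (Matrix.vecCons t ts i).realize e) =
      Matrix.vecCons (t.realize e) (fun i => (ts i).realize e) := by
  funext i
  refine Fin.cases ?_ (fun j => ?_) i <;> simp

theorem realize_vecEmpty {L : FirstOrder.Language.{0, 0}} {M α : Type*} [L.Structure M]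
    (e : α → M) : (fun i => ((![] : Fin 0 → L.Term α) i).realize e) = ![] :=
  Subsingleton.elim _ _

section Realize

variable {L : FirstOrder.Language.{0, 0}} {M : Type u} [L.Structure M] {n : ℕ}

@[simp]
theorem realize_allF (φ : L.Formula (Fin (n + 1))) (e : Fin n → M) :
    (allF φ).Realize e ↔ ∀ x, φ.Realize (Fin.snoc (α := fun _ => M) e x) := by
  unfold allF Formula.Realize
  simp only [BoundedFormula.realize_all, BoundedFormula.realize_relabel]
  refine forall_congr' fun x => ?_
  have h : (Sum.elim e ((Fin.snoc default x : Fin 1 → M) ∘ Fin.castAdd 0) ∘ fun i : Fin (n + 1) =>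
      (Fin.lastCases (Sum.inr 0) (fun j => Sum.inl j) i : Fin n ⊕ Fin 1)) =
      Fin.snoc (α := fun _ => M) e x := by
    funext i
    refine Fin.lastCases ?_ (fun j => ?_) i
    · simp [Fin.snoc]
    · simp
  rw [h]
  exact iff_of_eq (congrArg _ (Subsingleton.elim _ _))

@[simp]
theorem realize_exF (φ : L.Formula (Fin (n + 1))) (e : Fin n → M) :
    (exF φ).Realize e ↔ ∃ x, φ.Realize (Fin.snoc (α := fun _ => M) e x) := by
  simp [exF, Formula.realize_not, realize_allF]

theorem realize_closure {β : Type} [Finite β] (φ : L.Formula β) :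
    M ⊨ closure φ ↔ ∀ e : β → M, φ.Realize e := by
  unfold closure Sentence.Realize
  rw [Formula.Realize, BoundedFormula.realize_iAlls]
  refine forall_congr' fun e => ?_
  rw [Formula.realize_relabel]
  rfl

@[simp]
theorem realize_substF {α β : Type} (φ : L.Formula α) (tf : α → L.Term β) (e : β → M) :
    Formula.Realize (BoundedFormula.subst φ tf) e ↔ φ.Realize (fun a => (tf a).realize e) :=
  BoundedFormula.realize_subst

@[simp]
theorem realize_iInfF {α β : Type} [Finite β] (f : β → L.Formula α) (e : α → M) :
    (Formula.iInf f).Realize e ↔ ∀ b, (f b).Realize e := by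
  simp [Formula.iInf, Formula.Realize, BoundedFormula.realize_iInf]

end Realize

/-! ## Models of arithmetic with algebraic notation -/

/-- The symbols of arithmetic are interpreted by the algebraic operations of `M`. -/
class ArithCompat (M : Type u) [LA.Structure M] [Zero M] [One M] [Add M] [Mul M] [LT M] :
    Prop where
  funMap_zero (x : Fin 0 → M) : Structure.funMap (L := LA) ArithFunc.zero x = 0
  funMap_succ (x : Fin 1 → M) : Structure.funMap (L := LA) ArithFunc.succ x = x 0 + 1
  funMap_add (x : Fin 2 → M) : Structure.funMap (L := LA) ArithFunc.add x = x 0 + x 1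
  funMap_mul (x : Fin 2 → M) : Structure.funMap (L := LA) ArithFunc.mul x = x 0 * x 1
  relMap_lt (x : Fin 2 → M) : Structure.RelMap (L := LA) ArithRel.lt x ↔ x 0 < x 1

@[simp]
theorem realize_v {M : Type u} [LA.Structure M] {n : ℕ} (k : Fin n) (e : Fin n → M) :
    (v k).realize e = e k :=
  rfl

@[simp]
theorem realize_eqF {M : Type u} [LA.Structure M] {α : Type} (t s : LA.Term α) (e : α → M) :
    (eqF t s).Realize e ↔ t.realize e = s.realize e :=
  Formula.realize_equal

section Compat

variable {M : Type u} [LA.Structure M] [Zero M] [One M] [Add M] [Mul M] [LT M] [ArithCompat M]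
variable {α : Type}

@[simp]
theorem realize_zeroT (e : α → M) : (0 : LA.Term α).realize e = 0 :=
  ArithCompat.funMap_zero _

@[simp]
theorem realize_sc (t : LA.Term α) (e : α → M) : (sc t).realize e = t.realize e + 1 :=
  ArithCompat.funMap_succ _

@[simp]
theorem realize_addT (t s : LA.Term α) (e : α → M) :
    (t + s).realize e = t.realize e + s.realize e :=
  ArithCompat.funMap_add _

@[simp]
theorem realize_mulT (t s : LA.Term α) (e : α → M) :
    (t * s).realize e = t.realize e * s.realize e :=
  ArithCompat.funMap_mul _

@[simp]
theorem realize_pr (t s : LA.Term α) (e : α → M) :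
    (pr t s).realize e = pr (t.realize e) (s.realize e) := by
  simp only [pr, realize_addT, realize_mulT]

@[simp]
theorem realize_ltF (t s : LA.Term α) (e : α → M) :
    (ltF t s).Realize e ↔ t.realize e < s.realize e :=
  (Formula.realize_rel₂ (L := LA) (R := ArithRel.lt)).trans (ArithCompat.relMap_lt _)

end Compat

/-! ## The ordered semiring structure of a model of Peano arithmetic -/

/-- The axioms of Peano arithmetic in semantic form; induction is for arithmetical formulas with
parameters. -/
class PeanoAxioms (M : Type u) [LA.Structure M] [Zero M] [One M] [Add M] [Mul M] [LT M] : Prop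
    extends ArithCompat M where
  succ_ne_zero (x : M) : x + 1 ≠ 0
  succ_inj {x y : M} : x + 1 = y + 1 → x = y
  add_zero' (x : M) : x + 0 = x
  zero_add_one : (0 : M) + 1 = 1
  add_succ (x y : M) : x + (y + 1) = x + y + 1
  mul_zero' (x : M) : x * 0 = 0
  mul_succ (x y : M) : x * (y + 1) = x * y + x
  lt_iff_exists_add {x y : M} : x < y ↔ ∃ z, z + 1 + x = y
  ind {n : ℕ} (φ : LA.Formula (Fin (n + 1))) (p : Fin n → M) :
    φ.Realize (Fin.snoc (α := fun _ => M) p 0) →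
    (∀ x, φ.Realize (Fin.snoc (α := fun _ => M) p x) →
      φ.Realize (Fin.snoc (α := fun _ => M) p (x + 1))) →
    ∀ x, φ.Realize (Fin.snoc (α := fun _ => M) p x)

namespace PeanoAxioms

variable {M : Type u} [LA.Structure M] [Zero M] [One M] [Add M] [Mul M] [LT M] [PeanoAxioms M]

theorem induct {n : ℕ} (φ : LA.Formula (Fin (n + 1))) (p : Fin n → M) (S : M → Prop)
    (hS : ∀ x, φ.Realize (Fin.snoc (α := fun _ => M) p x) ↔ S x) (h0 : S 0)
    (hs : ∀ x, S x → S (x + 1)) (x : M) : S x :=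
  (hS x).1 (ind φ p ((hS 0).2 h0) (fun y hy => (hS _).2 (hs y ((hS y).1 hy))) x)

protected theorem zero_add (x : M) : 0 + x = x :=
  induct (eqF (0 + v 0) (v 0)) ![] (fun x : M => 0 + x = x) (by simp) (add_zero' 0)
    (fun x hx => by rw [add_succ, hx]) x

protected theorem add_assoc (a b c : M) : a + b + c = a + (b + c) :=
  induct (eqF (v 0 + v 1 + v 2) (v 0 + (v 1 + v 2))) ![a, b] (fun c : M => a + b + c = a + (b + c))
    (by simp) (by rw [add_zero', add_zero'])
    (fun x hx => by rw [add_succ, add_succ, add_succ, hx]) c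

theorem succ_add (a b : M) : a + 1 + b = a + b + 1 :=
  induct (eqF (sc (v 0) + v 1) (sc (v 0 + v 1))) ![a] (fun b : M => a + 1 + b = a + b + 1)
    (by simp) (by rw [add_zero', add_zero'])
    (fun x hx => by rw [add_succ, add_succ, hx]) b

protected theorem add_comm (a b : M) : a + b = b + a :=
  induct (eqF (v 0 + v 1) (v 1 + v 0)) ![a] (fun b : M => a + b = b + a)
    (by simp) (by rw [add_zero', PeanoAxioms.zero_add])
    (fun x hx => by rw [add_succ, succ_add, hx]) b

protected theorem add_right_comm (a b c : M) : a + b + c = a + c + b := by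
  rw [PeanoAxioms.add_assoc, PeanoAxioms.add_assoc, PeanoAxioms.add_comm b c]

protected theorem add_right_cancel (a b c : M) (h : a + c = b + c) : a = b :=
  induct ((eqF (v 0 + v 2) (v 1 + v 2)).imp (eqF (v 0) (v 1))) ![a, b]
    (fun c : M => a + c = b + c → a = b) (by simp) (by simp [add_zero'])
    (fun x hx h => by rw [add_succ, add_succ] at h; exact hx (succ_inj h)) c h

protected theorem zero_mul (x : M) : 0 * x = 0 :=
  induct (eqF (0 * v 0) 0) ![] (fun x : M => 0 * x = 0) (by simp) (mul_zero' 0)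
    (fun x hx => by rw [mul_succ, hx, add_zero']) x

theorem succ_mul (a b : M) : (a + 1) * b = a * b + b :=
  induct (eqF (sc (v 0) * v 1) (v 0 * v 1 + v 1)) ![a] (fun b : M => (a + 1) * b = a * b + b)
    (by simp) (by rw [mul_zero', mul_zero', add_zero'])
    (fun x hx => by
      rw [mul_succ, mul_succ, hx, add_succ, add_succ, PeanoAxioms.add_right_comm _ x a]) b

protected theorem mul_comm (a b : M) : a * b = b * a :=
  induct (eqF (v 0 * v 1) (v 1 * v 0)) ![a] (fun b : M => a * b = b * a)
    (by simp) (by rw [mul_zero', PeanoAxioms.zero_mul])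
    (fun x hx => by rw [mul_succ, succ_mul, hx]) b

protected theorem mul_add (a b c : M) : a * (b + c) = a * b + a * c :=
  induct (eqF (v 0 * (v 1 + v 2)) (v 0 * v 1 + v 0 * v 2)) ![a, b]
    (fun c : M => a * (b + c) = a * b + a * c)
    (by simp) (by rw [add_zero', mul_zero', add_zero'])
    (fun x hx => by rw [add_succ, mul_succ, mul_succ, hx, PeanoAxioms.add_assoc]) c

protected theorem mul_assoc (a b c : M) : a * b * c = a * (b * c) :=
  induct (eqF (v 0 * v 1 * v 2) (v 0 * (v 1 * v 2))) ![a, b]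
    (fun c : M => a * b * c = a * (b * c))
    (by simp) (by rw [mul_zero', mul_zero', mul_zero'])
    (fun x hx => by rw [mul_succ, mul_succ, PeanoAxioms.mul_add, hx]) c

protected theorem mul_one (a : M) : a * 1 = a := by
  rw [← zero_add_one, mul_succ, mul_zero', PeanoAxioms.zero_add]

theorem eq_zero_or_succ (x : M) : x = 0 ∨ ∃ y, x = y + 1 :=
  induct (eqF (v 0) 0 ⊔ exF (eqF (v 0) (sc (v 1)))) ![] (fun x : M => x = 0 ∨ ∃ y, x = y + 1)
    (by simp) (Or.inl rfl) (fun x _ => Or.inr ⟨x, rfl⟩) x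

protected theorem eq_zero_of_add (a b : M) (h : a + b = 0) : b = 0 := by
  rcases eq_zero_or_succ b with rfl | ⟨y, rfl⟩
  · rfl
  · rw [add_succ] at h
    exact absurd h (succ_ne_zero _)

protected theorem total (a b : M) : (∃ z, a + z = b) ∨ ∃ z, b + z = a :=
  induct (exF (eqF (v 0 + v 2) (v 1)) ⊔ exF (eqF (v 1 + v 2) (v 0))) ![a]
    (fun b : M => (∃ z, a + z = b) ∨ ∃ z, b + z = a) (by simp)
    (Or.inr ⟨a, PeanoAxioms.zero_add a⟩)
    (fun x hx => by
      rcases hx with ⟨z, rfl⟩ | ⟨z, rfl⟩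
      · exact Or.inl ⟨z + 1, add_succ _ _⟩
      · rcases eq_zero_or_succ z with rfl | ⟨y, rfl⟩
        · exact Or.inl ⟨0 + 1, by rw [add_zero', add_succ, add_zero']⟩
        · exact Or.inr ⟨y, by rw [succ_add, add_succ]⟩) b

variable (M)

/-- A model of Peano arithmetic is a commutative semiring. -/
@[reducible]
def commSemiring : CommSemiring M where
  add := (· + ·)
  zero := 0
  mul := (· * ·)
  one := 1
  add_assoc := PeanoAxioms.add_assoc
  zero_add := PeanoAxioms.zero_add
  add_zero := add_zero'
  add_comm := PeanoAxioms.add_comm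
  left_distrib := PeanoAxioms.mul_add
  right_distrib a b c := by
    change (a + b) * c = a * c + b * c
    rw [PeanoAxioms.mul_comm, PeanoAxioms.mul_add, PeanoAxioms.mul_comm c, PeanoAxioms.mul_comm c]
  zero_mul := PeanoAxioms.zero_mul
  mul_zero := mul_zero'
  mul_assoc := PeanoAxioms.mul_assoc
  one_mul a := by
    change 1 * a = a
    rw [PeanoAxioms.mul_comm, PeanoAxioms.mul_one]
  mul_one := PeanoAxioms.mul_one
  mul_comm := PeanoAxioms.mul_comm
  nsmul := nsmulRec

/-- A model of Peano arithmetic is linearly ordered. -/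
@[reducible]
noncomputable def linearOrder : LinearOrder M where
  le a b := ∃ z, a + z = b
  lt := (· < ·)
  le_refl a := ⟨0, add_zero' a⟩
  le_trans a b c := by
    rintro ⟨x, rfl⟩ ⟨y, rfl⟩
    exact ⟨x + y, (PeanoAxioms.add_assoc _ _ _).symm⟩
  le_antisymm a b := by
    rintro ⟨x, rfl⟩ ⟨y, hy⟩
    rw [PeanoAxioms.add_assoc] at hy
    have h0 : x + y = 0 := PeanoAxioms.add_right_cancel _ _ a (by
      rw [PeanoAxioms.add_comm, hy, PeanoAxioms.zero_add])
    rw [PeanoAxioms.add_comm] at h0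
    rw [PeanoAxioms.eq_zero_of_add _ _ h0, add_zero']
  le_total := PeanoAxioms.total
  lt_iff_le_not_ge a b := by
    rw [lt_iff_exists_add]
    constructor
    · rintro ⟨z, rfl⟩
      refine ⟨⟨z + 1, PeanoAxioms.add_comm _ _⟩, ?_⟩
      rintro ⟨y, hy⟩
      refine succ_ne_zero (z + y) (PeanoAxioms.add_right_cancel _ _ a ?_)
      rw [PeanoAxioms.zero_add, ← succ_add, PeanoAxioms.add_right_comm, hy]
    · rintro ⟨⟨z, rfl⟩, h⟩
      rcases eq_zero_or_succ z with rfl | ⟨y, rfl⟩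
      · exact absurd ⟨0, by rw [add_zero', add_zero']⟩ h
      · exact ⟨y, PeanoAxioms.add_comm _ _⟩
  toDecidableLE := Classical.decRel _

end PeanoAxioms

/-- An ordered semiring whose operations interpret the language of arithmetic, and which satisfies
induction for arithmetical formulas with parameters. -/
class PeanoModel (M : Type u) [LA.Structure M] [CommSemiring M] [LinearOrder M]
    [IsStrictOrderedRing M] [CanonicallyOrderedAdd M] : Prop extends ArithCompat M where
  add_one_le_of_lt {x y : M} : x < y → x + 1 ≤ y
  ind {n : ℕ} (φ : LA.Formula (Fin (n + 1))) (p : Fin n → M) :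
    φ.Realize (Fin.snoc (α := fun _ => M) p 0) →
    (∀ x, φ.Realize (Fin.snoc (α := fun _ => M) p x) →
      φ.Realize (Fin.snoc (α := fun _ => M) p (x + 1))) →
    ∀ x, φ.Realize (Fin.snoc (α := fun _ => M) p x)

/-- The arithmetical structure on `M` comes from an ordered semiring with induction. -/
def IsPeano (M : Type u) [LA.Structure M] : Prop :=
  ∃ (_ : CommSemiring M) (_ : LinearOrder M) (_ : IsStrictOrderedRing M)
    (_ : CanonicallyOrderedAdd M), PeanoModel M

theorem PeanoAxioms.isPeano (M : Type u) [LA.Structure M] [Zero M] [One M] [Add M]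
    [Mul M] [LT M] [PeanoAxioms M] : IsPeano M := by
  let := commSemiring M
  let := linearOrder M
  have hadd : IsOrderedCancelAddMonoid M :=
    { add_le_add_left := by
        rintro a b ⟨z, rfl⟩ c
        exact ⟨z, PeanoAxioms.add_right_comm _ _ _⟩
      le_of_add_le_add_left := by
        rintro a b c ⟨z, hz⟩
        refine ⟨z, PeanoAxioms.add_right_cancel _ _ a ?_⟩
        rw [PeanoAxioms.add_comm, ← PeanoAxioms.add_assoc, hz, PeanoAxioms.add_comm] }
  have hlt : ∀ {a b : M}, a < b → ∃ z, b = a + (z + 1) := by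
    intro a b h
    obtain ⟨z, rfl⟩ := lt_iff_exists_add.1 h
    exact ⟨z, PeanoAxioms.add_comm _ _⟩
  have hpos : ∀ z : M, (0 : M) < z + 1 := fun z => lt_iff_exists_add.2 ⟨z, add_zero' _⟩
  have : CanonicallyOrderedAdd M :=
    { exists_add_of_le := fun {a b} h => by
        obtain ⟨z, rfl⟩ := h
        exact ⟨z, rfl⟩
      le_add_self := fun a b => ⟨b, PeanoAxioms.add_comm _ _⟩
      le_self_add := fun a b => ⟨b, rfl⟩ }
  have : ZeroLEOneClass M := ⟨⟨1, PeanoAxioms.zero_add 1⟩⟩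
  have : Nontrivial M := ⟨⟨0 + 1, 0, succ_ne_zero 0⟩⟩
  have : PosMulStrictMono M := ⟨fun a ha b c hbc => by
    obtain ⟨x, rfl⟩ := hlt ha
    obtain ⟨y, rfl⟩ := hlt hbc
    change (0 + (x + 1)) * b < (0 + (x + 1)) * (b + (y + 1))
    rw [mul_add]
    refine lt_add_of_pos_right _ ?_
    rw [zero_add, mul_add, mul_one, ← add_assoc]
    exact hpos _⟩
  have : IsStrictOrderedRing M :=
    { toPosMulStrictMono := inferInstance
      mul_lt_mul_of_pos_right := fun a ha b c hbc => by
        have := mul_lt_mul_of_pos_left hbc ha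
        simpa only [mul_comm] using this }
  refine ⟨inferInstance, inferInstance, inferInstance, inferInstance, ?_⟩
  exact
    { funMap_zero := ArithCompat.funMap_zero
      funMap_succ := ArithCompat.funMap_succ
      funMap_add := ArithCompat.funMap_add
      funMap_mul := ArithCompat.funMap_mul
      relMap_lt := ArithCompat.relMap_lt
      add_one_le_of_lt := fun {x y} h => by
        obtain ⟨z, rfl⟩ := hlt h
        exact ⟨z, by rw [add_assoc, add_comm 1]⟩
      ind := PeanoAxioms.ind }

/-! ## Coded finite sets in a model of Peano arithmetic -/

section Peano

set_option linter.unusedSectionVars false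

variable {M : Type u} [LA.Structure M] [CommSemiring M] [LinearOrder M]
  [IsStrictOrderedRing M] [CanonicallyOrderedAdd M] [PeanoModel M]

theorem PeanoModel.induct {n : ℕ} (φ : LA.Formula (Fin (n + 1))) (p : Fin n → M) (S : M → Prop)
    (hS : ∀ x, φ.Realize (Fin.snoc (α := fun _ => M) p x) ↔ S x) (h0 : S 0)
    (hs : ∀ x, S x → S (x + 1)) (x : M) : S x :=
  (hS x).1 (ind φ p ((hS 0).2 h0) (fun y hy => (hS _).2 (hs y ((hS y).1 hy))) x)

@[simp]
theorem realize_num {α : Type} (k : ℕ) (e : α → M) : (num k).realize e = (k : M) := by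
  induction k with
  | zero => simp [num]
  | succ k ih => simp [num, ih]

@[simp]
theorem realize_leF {α : Type} (t s : LA.Term α) (e : α → M) :
    (leF t s).Realize e ↔ t.realize e ≤ s.realize e := by
  simp [leF, le_iff_lt_or_eq]

theorem lt_add_one_iff_le {x y : M} : x < y + 1 ↔ x ≤ y := by
  constructor
  · intro h
    by_contra hc
    exact absurd (PeanoModel.add_one_le_of_lt (not_le.1 hc)) (not_le.2 h)
  · exact fun h => lt_of_le_of_lt h (lt_add_one y)

theorem pr_lt_of_add_lt {a b c d : M} (h : a + b < c + d) : pr a b < pr c d := by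
  have h1 := PeanoModel.add_one_le_of_lt h
  calc pr a b ≤ (a + b) * (a + b) + (a + b) := by
        unfold pr
        gcongr
        exact le_self_add
    _ < (a + b + 1) * (a + b + 1) := by
        have : (a + b + 1) * (a + b + 1) = (a + b) * (a + b) + (a + b) + ((a + b) + 1) := by ring
        rw [this]
        exact lt_add_of_pos_right _ (by positivity)
    _ ≤ (c + d) * (c + d) := by gcongr
    _ ≤ pr c d := le_self_add

@[simp]
theorem pr_inj {a b c d : M} : pr a b = pr c d ↔ a = c ∧ b = d := by
  constructor
  · intro h
    rcases lt_trichotomy (a + b) (c + d) with h1 | h1 | h1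
    · exact absurd h (pr_lt_of_add_lt h1).ne
    · have h2 : a = c := by
        unfold pr at h
        rw [h1] at h
        exact add_left_cancel h
      subst h2
      exact ⟨rfl, add_left_cancel h1⟩
    · exact absurd h (pr_lt_of_add_lt h1).ne'
  · rintro ⟨rfl, rfl⟩
    rfl

theorem le_pr_right (a b : M) : b ≤ pr a b := by
  rcases eq_or_ne b 0 with rfl | h
  · exact zero_le
  · have h1 : 1 ≤ b := by
      have := PeanoModel.add_one_le_of_lt (pos_iff_ne_zero.2 h)
      rwa [zero_add] at this
    calc b = 1 * b := (one_mul b).symm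
      _ ≤ (a + b) * (a + b) := by
        gcongr
        · exact h1.trans le_add_self
        · exact le_add_self
      _ ≤ pr a b := le_self_add

theorem le_pr_left (a b : M) : a ≤ pr a b :=
  le_add_self

theorem pr_lt_pr {a b c d : M} (h : a ≤ c) (h' : b < d) : pr a b < pr c d :=
  pr_lt_of_add_lt (add_lt_add_of_le_of_lt h h')

theorem pr_lt_pr_left {a b c d : M} (hac : a < c) (hbd : b ≤ d) : pr a b < pr c d :=
  pr_lt_of_add_lt (add_lt_add_of_lt_of_le hac hbd)

/-- `x` belongs to the finite set coded by `c`, `d`. -/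
def InW (x c d : M) : Prop := memF.Realize ![x, c, d]

@[simp]
theorem realize_inW {n : ℕ} (x c d : LA.Term (Fin n)) (e : Fin n → M) :
    (inW x c d).Realize e ↔ InW (x.realize e) (c.realize e) (d.realize e) := by
  simp only [inW, InW, realize_substF, realize_vecCons, realize_vecEmpty]

theorem inW_iff {x c d : M} :
    InW x c d ↔ ∃ b e, c = pr b e ∧ x < b ∧ ((x + 1) * d + 1) ∣ e := by
  simp [InW, memF, and_assoc, Dvd.dvd, eq_comm]

theorem dvd_of_dvd_add {a b c : M} (h : a ∣ b + c) (hb : a ∣ b) : a ∣ c := by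
  obtain ⟨u, rfl⟩ := hb
  obtain ⟨w, hw⟩ := h
  rcases eq_or_ne a 0 with rfl | ha
  · simp_all
  have huw : u ≤ w := by
    by_contra hc
    have h1 : a * w < a * u := mul_lt_mul_of_pos_left (not_le.1 hc) (pos_iff_ne_zero.2 ha)
    rw [← hw] at h1
    exact absurd h1 (not_lt.2 le_self_add)
  obtain ⟨t, rfl⟩ := exists_add_of_le huw
  rw [mul_add] at hw
  exact ⟨t, add_left_cancel hw⟩

/-- The moduli `(x + 1) d + 1` and `(y + 1) d + 1` are coprime if `|x - y|` divides `d`. -/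
theorem modulus_dvd_of_dvd_mul {d x y e t : M} (hxy : x + t = y ∨ y + t = x) (ht : t ∣ d)
    (h : ((x + 1) * d + 1) ∣ e * ((y + 1) * d + 1)) : ((x + 1) * d + 1) ∣ e := by
  have h1 : ((x + 1) * d + 1) ∣ t * e := by
    have h2 : ((x + 1) * d + 1) ∣ (x + 1) * (e * ((y + 1) * d + 1)) := h.mul_left _
    have h3 : ((x + 1) * d + 1) ∣ (y + 1) * e * ((x + 1) * d + 1) := Dvd.intro_left _ rfl
    rcases hxy with rfl | rfl
    · refine dvd_of_dvd_add ?_ h2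
      convert h3 using 1
      ring
    · refine dvd_of_dvd_add ?_ h3
      convert h2 using 1
      ring
  obtain ⟨s, rfl⟩ := ht
  have h4 : ((x + 1) * (t * s) + 1) ∣ (x + 1) * s * (t * e) := h1.mul_left _
  refine dvd_of_dvd_add (b := (x + 1) * s * (t * e)) ?_ h4
  exact ⟨e, by ring⟩

theorem exists_common_multiple (b : M) :
    ∃ d : M, 0 < d ∧ ∀ x, 0 < x ∧ x ≤ b → ∃ y, d = x * y := by
  refine PeanoModel.induct
    (exF (ltF 0 (v 1) ⊓ allF ((ltF 0 (v 2) ⊓ leF (v 2) (v 0)).imp (exF (eqF (v 1) (v 2 * v 3))))))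
    ![] (fun b : M => ∃ d : M, 0 < d ∧ ∀ x, 0 < x ∧ x ≤ b → ∃ y, d = x * y)
    (by simp) ?_ ?_ b
  · exact ⟨1, one_pos, fun x hx => absurd hx.1 (not_lt.2 hx.2)⟩
  · rintro b ⟨d, hd, h⟩
    refine ⟨d * (b + 1), mul_pos hd (by positivity), fun x hx => ?_⟩
    rcases hx.2.lt_or_eq with h1 | rfl
    · obtain ⟨y, rfl⟩ := h x ⟨hx.1, lt_add_one_iff_le.1 h1⟩
      exact ⟨y * (b + 1), mul_assoc _ _ _⟩
    · exact ⟨d, mul_comm _ _⟩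

theorem exists_product (c₁ d₁ c₂ d₂ y b d : M) (hd : 0 < d)
    (hb : ∀ x, 0 < x ∧ x ≤ b → ∃ y, d = x * y) (n : M) :
    n ≤ b → ∃ e : M, ∀ x, x < b → ((∃ z, e = ((x + 1) * d + 1) * z) ↔
      x < n ∧ (InW x c₁ d₁ ∨ InW x c₂ d₂ ∨ x = y)) := by
  refine PeanoModel.induct ((leF (v 7) (v 5)).imp (exF (allF ((ltF (v 9) (v 5)).imp
      ((exF (eqF (v 8) (sc (sc (v 9) * v 6) * v 10))).iff
        (ltF (v 9) (v 7) ⊓ (inW (v 9) (v 0) (v 1) ⊔ (inW (v 9) (v 2) (v 3) ⊔ eqF (v 9) (v 4)))))))))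
    ![c₁, d₁, c₂, d₂, y, b, d] (fun n : M => n ≤ b → ∃ e : M, ∀ x, x < b →
      ((∃ z, e = ((x + 1) * d + 1) * z) ↔ x < n ∧ (InW x c₁ d₁ ∨ InW x c₂ d₂ ∨ x = y)))
    (by simp) ?_ ?_ n
  · refine fun _ => ⟨1, fun x _ => ⟨?_, fun h => absurd h.1 not_lt_zero⟩⟩
    rintro ⟨z, hz⟩
    have h1 : 1 < (x + 1) * d + 1 := lt_add_of_pos_left _ (mul_pos (by positivity) hd)
    have hz0 : z ≠ 0 := by
      rintro rfl
      simp at hz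
    have h2 : (1 : M) ≤ z := by
      have := PeanoModel.add_one_le_of_lt (pos_iff_ne_zero.2 hz0)
      rwa [zero_add] at this
    exact absurd hz (h1.trans_le (le_mul_of_one_le_right zero_le h2)).ne
  · intro n ih hn
    obtain ⟨e, he⟩ := ih (le_self_add.trans hn)
    by_cases hp : InW n c₁ d₁ ∨ InW n c₂ d₂ ∨ n = y
    · refine ⟨e * ((n + 1) * d + 1), fun x hx => ?_⟩
      rcases eq_or_ne x n with rfl | hxn
      · exact ⟨fun _ => ⟨lt_add_one x, hp⟩, fun _ => ⟨e, mul_comm _ _⟩⟩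
      · have h1 : x < n + 1 ↔ x < n := by
          rw [lt_add_one_iff_le, lt_iff_le_and_ne]
          exact ⟨fun h => ⟨h, hxn⟩, fun h => h.1⟩
        rw [h1, ← he x hx]
        constructor
        · intro h2
          have hnb : n < b := (lt_add_one n).trans_le hn
          rcases lt_or_gt_of_ne hxn with h3 | h3
          · obtain ⟨t, ht⟩ := exists_add_of_le h3.le
            refine modulus_dvd_of_dvd_mul (t := t) (Or.inl ht.symm) (hb t ⟨?_, ?_⟩) h2
            · refine pos_iff_ne_zero.2 ?_
              rintro rfl
              exact hxn (by rw [ht, add_zero])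
            · exact (le_add_self.trans ht.ge).trans hnb.le
          · obtain ⟨t, ht⟩ := exists_add_of_le h3.le
            refine modulus_dvd_of_dvd_mul (t := t) (Or.inr ht.symm) (hb t ⟨?_, ?_⟩) h2
            · refine pos_iff_ne_zero.2 ?_
              rintro rfl
              exact hxn (by rw [ht, add_zero])
            · exact (le_add_self.trans ht.ge).trans hx.le
        · rintro ⟨z, rfl⟩
          exact ⟨z * ((n + 1) * d + 1), mul_assoc _ _ _⟩
    · refine ⟨e, fun x hx => ?_⟩
      rw [he x hx, lt_add_one_iff_le]
      refine and_congr_left fun h => ⟨fun h' => h'.le, fun h' => lt_of_le_of_ne h' ?_⟩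
      rintro rfl
      exact hp h

theorem exists_inW_insert_union (c₁ d₁ c₂ d₂ y : M) :
    ∃ c d, ∀ x, InW x c d ↔ InW x c₁ d₁ ∨ InW x c₂ d₂ ∨ x = y := by
  have hlt : ∀ {x c d : M}, InW x c d → x < c + 1 := by
    intro x c d h
    obtain ⟨b, e, rfl, hx, -⟩ := inW_iff.1 h
    exact lt_add_one_iff_le.2 (hx.le.trans (le_pr_left _ _))
  obtain ⟨d, hd, hdb⟩ := exists_common_multiple ((c₁ + 1) + (c₂ + 1) + (y + 1))
  obtain ⟨e, he⟩ := exists_product c₁ d₁ c₂ d₂ y _ d hd hdb _ le_rfl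
  refine ⟨pr ((c₁ + 1) + (c₂ + 1) + (y + 1)) e, d, fun x => ?_⟩
  rw [inW_iff]
  constructor
  · rintro ⟨b', e', h, hx, hdv⟩
    obtain ⟨rfl, rfl⟩ := pr_inj.1 h
    exact ((he x hx).1 hdv).2
  · intro h
    have hx : x < (c₁ + 1) + (c₂ + 1) + (y + 1) := by
      rcases h with h | h | rfl
      · exact (hlt h).trans_le (le_self_add.trans le_self_add)
      · exact (hlt h).trans_le (le_add_self.trans le_self_add)
      · exact (lt_add_one x).trans_le le_add_self
    exact ⟨_, e, rfl, hx, (he x hx).2 ⟨hx, h⟩⟩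

theorem exists_inW_empty : ∃ c d : M, ∀ x, ¬ InW x c d := by
  refine ⟨pr 0 0, 0, fun x h => ?_⟩
  obtain ⟨b, e, h, hx, -⟩ := inW_iff.1 h
  obtain ⟨rfl, rfl⟩ := pr_inj.1 h
  exact not_lt_zero hx

/-- `x` belongs to a coded finite set all of whose members `y` satisfy `Φ W y`. -/
def Gen (Φ : (M → Prop) → M → Prop) (x : M) : Prop :=
  ∃ c d, InW x c d ∧ ∀ y, InW y c d → Φ (fun z => InW z c d) y

theorem Gen.elim {Φ : (M → Prop) → M → Prop} (hΦ : Monotone Φ) {x : M} (h : Gen Φ x) :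
    Φ (Gen Φ) x := by
  obtain ⟨c, d, hx, h⟩ := h
  exact hΦ (fun z hz => ⟨c, d, hz, h⟩) x (h x hx)

theorem Gen.intro {Φ : (M → Prop) → M → Prop} (hΦ : Monotone Φ) {x : M} {F : Set M}
    (hF : F.Finite) (hFx : Φ (· ∈ F) x) (h : ∀ y ∈ F, Gen Φ y) : Gen Φ x := by
  obtain ⟨c, d, h1, h2⟩ : ∃ c d : M, (∀ y ∈ F, InW y c d) ∧
      ∀ y, InW y c d → Φ (fun z => InW z c d) y := by
    clear hFx
    induction F, hF using Set.Finite.induction_on with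
    | empty =>
      obtain ⟨c, d, h⟩ := exists_inW_empty (M := M)
      exact ⟨c, d, by simp, fun y hy => absurd hy (h y)⟩
    | insert _ _ ih =>
      obtain ⟨c₁, d₁, h1, h2⟩ := ih fun y hy => h y (Set.mem_insert_of_mem _ hy)
      obtain ⟨c₂, d₂, h3, h4⟩ := h _ (Set.mem_insert _ _)
      obtain ⟨c, d, hcd⟩ := exists_inW_insert_union c₁ d₁ c₂ d₂ _
      refine ⟨c, d, fun y hy => (hcd y).2 ?_, fun y hy => ?_⟩
      · rcases hy with rfl | hy
        · exact Or.inr (Or.inl h3)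
        · exact Or.inl (h1 y hy)
      · have h5 : InW y c₁ d₁ ∨ InW y c₂ d₂ := by
          rcases (hcd y).1 hy with h | h | rfl
          · exact Or.inl h
          · exact Or.inr h
          · exact Or.inr h3
        rcases h5 with h5 | h5
        · exact hΦ (fun z hz => (hcd z).2 (Or.inl hz)) y (h2 y h5)
        · exact hΦ (fun z hz => (hcd z).2 (Or.inr (Or.inl hz))) y (h4 y h5)
  obtain ⟨c', d', hcd⟩ := exists_inW_insert_union c d c d x
  refine ⟨c', d', (hcd x).2 (Or.inr (Or.inr rfl)), fun y hy => ?_⟩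
  rcases (hcd y).1 hy with h | h | rfl
  · exact hΦ (fun z hz => (hcd z).2 (Or.inl hz)) y (h2 y h)
  · exact hΦ (fun z hz => (hcd z).2 (Or.inl hz)) y (h2 y h)
  · exact hΦ (fun z hz => (hcd z).2 (Or.inl (h1 z hz))) y hFx

end Peano

/-! ## Arithmetized syntax in a model of Peano arithmetic -/

section Finitary

variable {M : Type u}

/-- A monotone property of predicates that depends only on finite parts of the predicate. -/
def Finitary (Ψ : (M → Prop) → Prop) : Prop :=
  Monotone Ψ ∧ ∀ P, Ψ P → ∃ F : Set M, F.Finite ∧ (∀ y ∈ F, P y) ∧ Ψ (· ∈ F)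

namespace Finitary

theorem const (p : Prop) : Finitary (fun _ : M → Prop => p) :=
  ⟨fun _ _ _ => id, fun _ h => ⟨∅, Set.finite_empty, by simp, h⟩⟩

theorem app (a : M) : Finitary (fun P : M → Prop => P a) :=
  ⟨fun _ _ h => h a, fun _ h => ⟨{a}, Set.finite_singleton a, by simpa using h, rfl⟩⟩

theorem and {Ψ Ξ : (M → Prop) → Prop} (h : Finitary Ψ) (h' : Finitary Ξ) :
    Finitary fun P => Ψ P ∧ Ξ P := by
  refine ⟨fun P Q hPQ hP => ⟨h.1 hPQ hP.1, h'.1 hPQ hP.2⟩, fun P hP => ?_⟩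
  obtain ⟨F, hF, h1, h2⟩ := h.2 P hP.1
  obtain ⟨G, hG, h3, h4⟩ := h'.2 P hP.2
  exact ⟨F ∪ G, hF.union hG, fun y hy => hy.elim (h1 y) (h3 y),
    h.1 (fun _ => Or.inl) h2, h'.1 (fun _ => Or.inr) h4⟩

theorem or {Ψ Ξ : (M → Prop) → Prop} (h : Finitary Ψ) (h' : Finitary Ξ) :
    Finitary fun P => Ψ P ∨ Ξ P := by
  refine ⟨fun P Q hPQ hP => hP.imp (h.1 hPQ) (h'.1 hPQ), fun P hP => ?_⟩
  rcases hP with hP | hP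
  · obtain ⟨F, hF, h1, h2⟩ := h.2 P hP
    exact ⟨F, hF, h1, Or.inl h2⟩
  · obtain ⟨F, hF, h1, h2⟩ := h'.2 P hP
    exact ⟨F, hF, h1, Or.inr h2⟩

theorem ex {ι : Type*} {Ψ : ι → (M → Prop) → Prop} (h : ∀ i, Finitary (Ψ i)) :
    Finitary fun P => ∃ i, Ψ i P := by
  refine ⟨fun P Q hPQ ⟨i, hP⟩ => ⟨i, (h i).1 hPQ hP⟩, fun P ⟨i, hP⟩ => ?_⟩
  obtain ⟨F, hF, h1, h2⟩ := (h i).2 P hP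
  exact ⟨F, hF, h1, i, h2⟩

end Finitary

end Finitary

section Peano

set_option linter.unusedSectionVars false

variable {M : Type u} [LA.Structure M] [CommSemiring M] [LinearOrder M]
  [IsStrictOrderedRing M] [CanonicallyOrderedAdd M] [PeanoModel M]

theorem Gen.iff {Φ : (M → Prop) → M → Prop} (hΦ : ∀ x, Finitary fun P => Φ P x) (x : M) :
    Gen Φ x ↔ Φ (Gen Φ) x := by
  have hm : Monotone Φ := fun P Q h x => (hΦ x).1 h
  refine ⟨Gen.elim hm, fun h => ?_⟩
  obtain ⟨F, hF, h1, h2⟩ := (hΦ x).2 _ h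
  exact Gen.intro hm hF h2 h1

/-! ### Terms -/

/-- The clauses defining terms. -/
def TermStep (l m k : M) (W : M → Prop) (y : M) : Prop :=
  (∃ i, (l ≤ i ∧ i < m) ∧ y = pr 0 i) ∨ (∃ i, i < k ∧ y = pr 1 i) ∨ y = pr 2 0 ∨
    (∃ t, W t ∧ y = pr 3 t) ∨
    ∃ t s, (W t ∧ W s) ∧ (y = pr 4 (pr t s) ∨ y = pr 5 (pr t s))

/-- `t` is a term with ordinary variables in `[l, m)` and `z`-variables below `k`. -/
def IsTermIn (l m k t : M) : Prop := Gen (TermStep l m k) t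

@[simp]
theorem realize_isTermIn {n : ℕ} (l m k t : LA.Term (Fin n)) (e : Fin n → M) :
    (isTermIn l m k t).Realize e ↔
      IsTermIn (l.realize e) (m.realize e) (k.realize e) (t.realize e) := by
  simp only [isTermIn, realize_substF, realize_vecCons, realize_vecEmpty]
  simp [termF, IsTermIn, Gen, TermStep, cVar, cZ,
    cZero, cSucc, cAdd, cMul, or_assoc]

theorem isTermIn_iff (l m k t : M) : IsTermIn l m k t ↔ TermStep l m k (IsTermIn l m k) t := by
  refine Gen.iff (fun x => ?_) t
  unfold TermStep
  repeat' first
    | exact Finitary.const _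
    | exact Finitary.app _
    | refine Finitary.and ?_ ?_
    | refine Finitary.or ?_ ?_
    | refine Finitary.ex fun _ => ?_

theorem isTermIn_z {l m k i : M} : IsTermIn l m k (pr 1 i) ↔ i < k := by
  rw [isTermIn_iff]
  simp [TermStep]

theorem isTermIn_zero {l m k : M} : IsTermIn l m k (pr 2 0) := by
  rw [isTermIn_iff]
  simp [TermStep]

theorem isTermIn_succ {l m k t : M} : IsTermIn l m k (pr 3 t) ↔ IsTermIn l m k t := by
  rw [isTermIn_iff]
  simp [TermStep]

/-! ### Formulas -/

/-- The clauses defining formulas. -/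
def FormStep (W : M → Prop) (y : M) : Prop :=
  ∃ m p q,
    ((IsTermIn 0 m 0 p ∧ IsTermIn 0 m 0 q) ∧
      (y = pr m (pr 6 (pr p q)) ∨ y = pr m (pr 7 (pr p q)))) ∨
    (W (pr m p) ∧ y = pr m (pr 8 p)) ∨
    ((W (pr m p) ∧ W (pr m q)) ∧ y = pr m (pr 9 (pr p q))) ∨
    (W (pr (m + 1) p) ∧ y = pr m (pr 10 p))

/-- `φ` is a formula in `m` variables. -/
def IsForm (m φ : M) : Prop := Gen FormStep (pr m φ)

@[simp]
theorem realize_isForm {n : ℕ} (m φ : LA.Term (Fin n)) (e : Fin n → M) :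
    (isForm m φ).Realize e ↔ IsForm (m.realize e) (φ.realize e) := by
  simp only [isForm, realize_substF, realize_vecCons, realize_vecEmpty]
  simp [formF, IsForm, Gen, FormStep, isTerm,
    cEq, cLt, cNeg, cOr, cEx, or_assoc]

theorem isForm_iff (m φ : M) : IsForm m φ ↔ FormStep (Gen FormStep) (pr m φ) := by
  refine Gen.iff (fun x => ?_) _
  unfold FormStep
  repeat' first
    | exact Finitary.const _
    | exact Finitary.app _
    | refine Finitary.and ?_ ?_
    | refine Finitary.or ?_ ?_
    | refine Finitary.ex fun _ => ?_

theorem isForm_lt {m t s : M} :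
    IsForm m (pr 7 (pr t s)) ↔ IsTermIn 0 m 0 t ∧ IsTermIn 0 m 0 s := by
  rw [isForm_iff]
  simp [FormStep]

theorem isForm_or {m φ ψ : M} : IsForm m (pr 9 (pr φ ψ)) ↔ IsForm m φ ∧ IsForm m ψ := by
  rw [isForm_iff]
  simp [FormStep, IsForm]

/-! ### Tuples -/

/-- The clauses defining tuples. -/
def TupStep (W : M → Prop) (y : M) : Prop :=
  y = pr 0 0 ∨ ∃ m a b, W (pr m a) ∧ y = pr (m + 1) (pr b a + 1)

/-- `a` is an `m`-tuple. -/
def IsTup (m a : M) : Prop := Gen TupStep (pr m a)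

@[simp]
theorem realize_isTup {n : ℕ} (m a : LA.Term (Fin n)) (e : Fin n → M) :
    (isTup m a).Realize e ↔ IsTup (m.realize e) (a.realize e) := by
  simp only [isTup, realize_substF, realize_vecCons, realize_vecEmpty]
  simp [tupF, IsTup, Gen, TupStep, cons]

theorem isTup_iff (m a : M) :
    IsTup m a ↔ (m = 0 ∧ a = 0) ∨ ∃ m' a' b, IsTup m' a' ∧ m = m' + 1 ∧ a = pr b a' + 1 := by
  have h : IsTup m a ↔ TupStep (Gen TupStep) (pr m a) := by
    refine Gen.iff (fun x => ?_) _
    unfold TupStep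
    repeat' first
      | exact Finitary.const _
      | exact Finitary.app _
      | refine Finitary.and ?_ ?_
      | refine Finitary.or ?_ ?_
      | refine Finitary.ex fun _ => ?_
  rw [h]
  simp [TupStep, IsTup]

/-- The clauses defining the entries of tuples. -/
def LookStep (x : M) (W : M → Prop) (y : M) : Prop :=
  (∃ a, y = pr 0 (pr x a + 1)) ∨ ∃ i a b, W (pr i a) ∧ y = pr (i + 1) (pr b a + 1)

/-- The entry of the tuple `a` with index `i` is `x`. -/
def Entry (a i x : M) : Prop := Gen (LookStep x) (pr i a)

@[simp]
theorem realize_entry {n : ℕ} (a i x : LA.Term (Fin n)) (e : Fin n → M) :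
    (entry a i x).Realize e ↔ Entry (a.realize e) (i.realize e) (x.realize e) := by
  simp only [entry, realize_substF, realize_vecCons, realize_vecEmpty]
  simp [lookF, Entry, Gen, LookStep, cons]

theorem entry_iff (a i x : M) :
    Entry a i x ↔ (i = 0 ∧ ∃ a', a = pr x a' + 1) ∨
      ∃ i' a' b, Entry a' i' x ∧ i = i' + 1 ∧ a = pr b a' + 1 := by
  have h : Entry a i x ↔ LookStep x (Gen (LookStep x)) (pr i a) := by
    refine Gen.iff (fun x => ?_) _
    unfold LookStep
    repeat' first
      | exact Finitary.const _
      | exact Finitary.app _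
      | refine Finitary.and ?_ ?_
      | refine Finitary.or ?_ ?_
      | refine Finitary.ex fun _ => ?_
  rw [h]
  simp [LookStep, Entry]

/-! ### Values of terms -/

/-- The clauses defining the values of terms. -/
def ValStep (a g : M) (W : M → Prop) (y : M) : Prop :=
  (∃ i x, Entry a i x ∧ y = pr (pr 0 i) x) ∨ (∃ i x, Entry g i x ∧ y = pr (pr 1 i) x) ∨
    y = pr (pr 2 0) 0 ∨ (∃ t x, W (pr t x) ∧ y = pr (pr 3 t) (x + 1)) ∨
    ∃ t x s z, (W (pr t x) ∧ W (pr s z)) ∧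
      (y = pr (pr 4 (pr t s)) (x + z) ∨ y = pr (pr 5 (pr t s)) (x * z))

/-- The value of the term `t` at `a`, `g` is `x`. -/
def Val (a g t x : M) : Prop := Gen (ValStep a g) (pr t x)

@[simp]
theorem realize_val {n : ℕ} (a g t x : LA.Term (Fin n)) (e : Fin n → M) :
    (val a g t x).Realize e ↔ Val (a.realize e) (g.realize e) (t.realize e) (x.realize e) := by
  simp only [val, realize_substF, realize_vecCons, realize_vecEmpty]
  simp [valF, Val, Gen, ValStep, cVar, cZ, cZero, cSucc,
    cAdd, cMul, or_assoc]

theorem val_iff (a g t x : M) : Val a g t x ↔ ValStep a g (Gen (ValStep a g)) (pr t x) := by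
  refine Gen.iff (fun x => ?_) _
  unfold ValStep
  repeat' first
    | exact Finitary.const _
    | exact Finitary.app _
    | refine Finitary.and ?_ ?_
    | refine Finitary.or ?_ ?_
    | refine Finitary.ex fun _ => ?_

theorem val_zero {a g x : M} : Val a g (pr 2 0) x ↔ x = 0 := by
  rw [val_iff]
  simp [ValStep]

/-! ### Bounding quantifiers, and quantifier depth -/

/-- The clauses defining the bounding of quantifiers. -/
def StarStep (W : M → Prop) (y : M) : Prop :=
  ∃ s p q p' q',
    y = pr s (pr (pr 6 (pr p q)) (pr 6 (pr p q))) ∨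
    y = pr s (pr (pr 7 (pr p q)) (pr 7 (pr p q))) ∨
    (W (pr s (pr p q)) ∧ y = pr s (pr (pr 8 p) (pr 8 q))) ∨
    ((W (pr s (pr p q)) ∧ W (pr s (pr p' q'))) ∧ y = pr s (pr (pr 9 (pr p p')) (pr 9 (pr q q')))) ∨
    (W (pr (s + 1) (pr p q)) ∧ y = pr s (pr (pr 10 p)
      (pr 10 (pr 8 (pr 9 (pr (pr 8 (pr 7 (pr (pr 0 0) (pr 1 s)))) (pr 8 q)))))))

/-- `ψ` arises from `φ` by bounding the quantifiers, starting with the variable `z_s`. -/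
def IsStar (s φ ψ : M) : Prop := Gen StarStep (pr s (pr φ ψ))

@[simp]
theorem realize_isStar {n : ℕ} (φ ψ : LA.Term (Fin n)) (e : Fin n → M) :
    (isStar φ ψ).Realize e ↔ IsStar 0 (φ.realize e) (ψ.realize e) := by
  simp only [isStar, realize_substF, realize_vecCons, realize_vecEmpty]
  simp [starF, IsStar, Gen, StarStep, cEq, cLt, cNeg,
    cOr, cEx, cBex, cVar, cZ, or_assoc]

theorem isStar_iff (s φ ψ : M) : IsStar s φ ψ ↔ StarStep (Gen StarStep) (pr s (pr φ ψ)) := by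
  refine Gen.iff (fun x => ?_) _
  unfold StarStep
  repeat' first
    | exact Finitary.const _
    | exact Finitary.app _
    | refine Finitary.and ?_ ?_
    | refine Finitary.or ?_ ?_
    | refine Finitary.ex fun _ => ?_

theorem isStar_lt {s t u ψ : M} : IsStar s (pr 7 (pr t u)) ψ ↔ ψ = pr 7 (pr t u) := by
  rw [isStar_iff]
  simp [StarStep]

theorem isStar_or {s φ φ' ψ : M} : IsStar s (pr 9 (pr φ φ')) ψ ↔
    ∃ q q', IsStar s φ q ∧ IsStar s φ' q' ∧ ψ = pr 9 (pr q q') := by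
  rw [isStar_iff]
  simp [StarStep, IsStar, and_assoc]

/-- The clauses defining the quantifier depth. -/
def DepthStep (W : M → Prop) (y : M) : Prop :=
  ∃ p k q l,
    y = pr (pr 6 (pr p k)) 0 ∨ y = pr (pr 7 (pr p k)) 0 ∨
    (W (pr p k) ∧ y = pr (pr 8 p) k) ∨
    ((W (pr p k) ∧ W (pr q l)) ∧
      ((l ≤ k ∧ y = pr (pr 9 (pr p q)) k) ∨ (k ≤ l ∧ y = pr (pr 9 (pr p q)) l))) ∨
    (W (pr p k) ∧ y = pr (pr 10 p) (k + 1))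

/-- The quantifier depth of `φ` is `k`. -/
def IsDepth (φ k : M) : Prop := Gen DepthStep (pr φ k)

@[simp]
theorem realize_isDepth {n : ℕ} (φ k : LA.Term (Fin n)) (e : Fin n → M) :
    (isDepth φ k).Realize e ↔ IsDepth (φ.realize e) (k.realize e) := by
  simp only [isDepth, realize_substF, realize_vecCons, realize_vecEmpty]
  simp [depthF, IsDepth, Gen, DepthStep, cEq, cLt,
    cNeg, cOr, cEx, or_assoc]

theorem isDepth_iff (φ k : M) : IsDepth φ k ↔ DepthStep (Gen DepthStep) (pr φ k) := by
  refine Gen.iff (fun x => ?_) _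
  unfold DepthStep
  repeat' first
    | exact Finitary.const _
    | exact Finitary.app _
    | refine Finitary.and ?_ ?_
    | refine Finitary.or ?_ ?_
    | refine Finitary.ex fun _ => ?_

theorem isDepth_lt {t s k : M} : IsDepth (pr 7 (pr t s)) k ↔ k = 0 := by
  rw [isDepth_iff]
  simp [DepthStep]

theorem isDepth_or {φ φ' k : M} : IsDepth (pr 9 (pr φ φ')) k ↔
    ∃ l l', IsDepth φ l ∧ IsDepth φ' l' ∧ (l' ≤ l ∧ k = l ∨ l ≤ l' ∧ k = l') := by
  rw [isDepth_iff]
  simp only [DepthStep, IsDepth]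
  constructor
  · rintro ⟨p, l, q, l', h⟩
    simp only [pr_inj, OfNat.ofNat_eq_ofNat, Nat.reduceEqDiff, false_and, and_false, false_or,
      or_false, true_and] at h
    obtain ⟨⟨h1, h2⟩, ⟨h3, ⟨rfl, rfl⟩, h4⟩ | ⟨h3, ⟨rfl, rfl⟩, h4⟩⟩ := h
    · exact ⟨l, l', h1, h2, Or.inl ⟨h3, h4⟩⟩
    · exact ⟨l, l', h1, h2, Or.inr ⟨h3, h4⟩⟩
  · rintro ⟨l, l', h1, h2, h3⟩
    exact ⟨φ, l, φ', l', Or.inr (Or.inr (Or.inr (Or.inl ⟨⟨h1, h2⟩, by simpa using h3⟩)))⟩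

/-! ### Truth for formulas with bounded quantifiers -/

/-- The clauses defining truth of formulas with bounded quantifiers. -/
def SatStep (g : M) (W : M → Prop) (y : M) : Prop :=
  ∃ a,
    (∃ t u x z, (Val a g t x ∧ Val a g u z) ∧
      ((x = z ∧ y = pr (pr 6 (pr t u)) (pr a 1)) ∨ (x ≠ z ∧ y = pr (pr 6 (pr t u)) (pr a 0)) ∨
        (x < z ∧ y = pr (pr 7 (pr t u)) (pr a 1)) ∨
        (¬ x < z ∧ y = pr (pr 7 (pr t u)) (pr a 0)))) ∨
    (∃ p, (W (pr p (pr a 0)) ∧ y = pr (pr 8 p) (pr a 1)) ∨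
      (W (pr p (pr a 1)) ∧ y = pr (pr 8 p) (pr a 0))) ∨
    (∃ p q, ((W (pr p (pr a 1)) ∨ W (pr q (pr a 1))) ∧ y = pr (pr 9 (pr p q)) (pr a 1)) ∨
      ((W (pr p (pr a 0)) ∧ W (pr q (pr a 0))) ∧ y = pr (pr 9 (pr p q)) (pr a 0))) ∨
    ∃ t p x, ((∃ m k, IsTermIn 1 m k t) ∧ Val (pr 0 a + 1) g t x) ∧
      (((∃ z, z < x ∧ W (pr p (pr (pr z a + 1) 1))) ∧
          y = pr (pr 10 (pr 8 (pr 9 (pr (pr 8 (pr 7 (pr (pr 0 0) t))) (pr 8 p))))) (pr a 1)) ∨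
        ((∀ z, z < x → W (pr p (pr (pr z a + 1) 0))) ∧
          y = pr (pr 10 (pr 8 (pr 9 (pr (pr 8 (pr 7 (pr (pr 0 0) t))) (pr 8 p))))) (pr a 0)))

/-- The formula `ψ` with bounded quantifiers has the truth value `b` at `a`, `g`. -/
def Sat (g ψ a b : M) : Prop := Gen (SatStep g) (pr ψ (pr a b))

@[simp]
theorem realize_sat {n : ℕ} (g ψ a : LA.Term (Fin n)) (e : Fin n → M) :
    (sat g ψ a).Realize e ↔ Sat (g.realize e) (ψ.realize e) (a.realize e) 1 := by
  simp only [sat, realize_substF, realize_vecCons, realize_vecEmpty]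
  simp [satF, Sat, Gen, SatStep, cEq, cLt,
    cNeg, cOr, cEx, cBex, cVar, cons, or_assoc]

theorem satStep_mono (g : M) : Monotone (SatStep g) := by
  intro W W' h y
  rintro ⟨a, h1 | ⟨p, h2⟩ | ⟨p, q, h3⟩ | ⟨t, p, x, ht, h4⟩⟩
  · exact ⟨a, Or.inl h1⟩
  · exact ⟨a, Or.inr (Or.inl ⟨p, h2.imp (And.imp_left (h _)) (And.imp_left (h _))⟩)⟩
  · exact ⟨a, Or.inr (Or.inr (Or.inl ⟨p, q, h3.imp (And.imp_left (Or.imp (h _) (h _)))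
      (And.imp_left (And.imp (h _) (h _)))⟩))⟩
  · exact ⟨a, Or.inr (Or.inr (Or.inr ⟨t, p, x, ht, h4.imp
      (And.imp_left (Exists.imp fun z => And.imp_right (h _)))
      (And.imp_left fun h5 z hz => h _ (h5 z hz))⟩))⟩

theorem Sat.elim {g ψ a b : M} (h : Sat g ψ a b) :
    SatStep g (Gen (SatStep g)) (pr ψ (pr a b)) :=
  Gen.elim (satStep_mono g) h

theorem sat_or_one {g p q a : M} :
    Sat g (pr 9 (pr p q)) a 1 ↔ Sat g p a 1 ∨ Sat g q a 1 := by
  constructor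
  · intro h
    have := h.elim
    simpa [SatStep, Sat] using this
  · rintro (h | h)
    · exact Gen.intro (satStep_mono g) (F := {pr p (pr a 1)}) (Set.finite_singleton _)
        (by simp [SatStep]) (by simpa [Sat] using h)
    · exact Gen.intro (satStep_mono g) (F := {pr q (pr a 1)}) (Set.finite_singleton _)
        (by simp [SatStep]) (by simpa [Sat] using h)

theorem not_sat_lt_zero {g t a : M} : ¬ Sat g (pr 7 (pr t (pr 2 0))) a 1 := by
  intro h
  have := h.elim
  simp [SatStep, val_zero] at this

end Peano

/-! ## Structures with a predicate -/

section Expansion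

variable {M : Type u} [LA.Structure M] {α : Type*}

/-- Truth of a formula in the structure `(M, I)`. -/
def RI (I : Set M) (φ : LAI.Formula α) (e : α → M) : Prop :=
  Formula.Realize (M := Expansion M I) φ e

/-- The value of a term in the structure `(M, I)`. -/
def TI (I : Set M) (t : LAI.Term α) (e : α → M) : M :=
  Term.realize (M := Expansion M I) e t

theorem termRealize_expansion (I J : Set M) (t : LAI.Term α) (e : α → M) :
    TI I t e = TI J t e := by
  induction t with
  | var => rfl
  | func f ts ih =>
    rcases f with f | f
    · exact congrArg (Structure.funMap (L := LA) (M := M) f) (funext ih)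
    · exact f.elim

variable (I : Set M)

@[simp]
theorem ri_not (φ : LAI.Formula α) (e : α → M) : RI I φ.not e ↔ ¬ RI I φ e := Iff.rfl

@[simp]
theorem ri_inf (φ ψ : LAI.Formula α) (e : α → M) : RI I (φ ⊓ ψ) e ↔ RI I φ e ∧ RI I ψ e :=
  Formula.realize_inf

@[simp]
theorem ri_sup (φ ψ : LAI.Formula α) (e : α → M) : RI I (φ ⊔ ψ) e ↔ RI I φ e ∨ RI I ψ e :=
  Formula.realize_sup

@[simp]
theorem ri_imp (φ ψ : LAI.Formula α) (e : α → M) : RI I (φ.imp ψ) e ↔ (RI I φ e → RI I ψ e) :=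
  Formula.realize_imp

@[simp]
theorem ri_iff (φ ψ : LAI.Formula α) (e : α → M) : RI I (φ.iff ψ) e ↔ (RI I φ e ↔ RI I ψ e) :=
  Formula.realize_iff

@[simp]
theorem ri_allF {n : ℕ} (φ : LAI.Formula (Fin (n + 1))) (e : Fin n → M) :
    RI I (allF φ) e ↔ ∀ x : M, RI I φ (Fin.snoc (α := fun _ => M) e x) :=
  realize_allF (M := Expansion M I) φ e

@[simp]
theorem ri_exF {n : ℕ} (φ : LAI.Formula (Fin (n + 1))) (e : Fin n → M) :
    RI I (exF φ) e ↔ ∃ x : M, RI I φ (Fin.snoc (α := fun _ => M) e x) :=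
  realize_exF (M := Expansion M I) φ e

theorem ri_iInf {α β : Type} [Finite β] (f : β → LAI.Formula α) (e : α → M) :
    RI I (Formula.iInf f) e ↔ ∀ b, RI I (f b) e :=
  realize_iInfF (M := Expansion M I) f e

@[simp]
theorem ri_lift {α : Type} (φ : LA.Formula α) (e : α → M) : RI I (lift φ) e ↔ φ.Realize e :=
  LHom.realize_onFormula (M := Expansion M I) _ φ

@[simp]
theorem ti_liftT {α : Type} (t : LA.Term α) (e : α → M) : TI I (liftT t) e = t.realize e :=
  LHom.realize_onTerm (M := Expansion M I) _ t e

@[simp]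
theorem ri_memI {α : Type} (t : LA.Term α) (e : α → M) : RI I (memI t) e ↔ t.realize e ∈ I := by
  rw [← ti_liftT I]
  exact Formula.realize_rel₁ (M := Expansion M I)

theorem ri_subst {α β : Type} (φ : LAI.Formula α) (tf : α → LAI.Term β) (e : β → M) :
    RI I (BoundedFormula.subst φ tf) e ↔ RI I φ (fun a => TI I (tf a) e) :=
  realize_substF (M := Expansion M I) φ tf e

theorem ri_relabel {α β : Type*} (φ : LAI.Formula α) (f : α → β) (e : β → M) :
    RI I (φ.relabel f) e ↔ RI I φ (e ∘ f) :=
  Formula.realize_relabel (M := Expansion M I)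

theorem ri_subst_vec2 {n : ℕ} (φ : LAI.Formula (Fin 2)) (t s : LA.Term (Fin n)) (e : Fin n → M) :
    RI I (BoundedFormula.subst φ ![liftT t, liftT s]) e ↔
      RI I φ ![t.realize e, s.realize e] := by
  rw [ri_subst]
  refine iff_of_eq (congrArg _ (funext fun i => ?_))
  fin_cases i <;> exact ti_liftT I _ e

theorem ri_subst_vec3 {n : ℕ} (φ : LAI.Formula (Fin 3)) (t s r : LA.Term (Fin n)) (e : Fin n → M) :
    RI I (BoundedFormula.subst φ ![liftT t, liftT s, liftT r]) e ↔
      RI I φ ![t.realize e, s.realize e, r.realize e] := by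
  rw [ri_subst]
  refine iff_of_eq (congrArg _ (funext fun i => ?_))
  fin_cases i <;> exact ti_liftT I _ e

theorem model_closure {β : Type} [Finite β] (φ : LAI.Formula β) :
    Expansion M I ⊨ closure φ ↔ ∀ e : β → M, RI I φ e :=
  realize_closure (M := Expansion M I) φ

/-! ### Definability -/

/-- The property `P` of tuples is definable in `(M, I)`, with parameters. -/
def DefIn (P : (α → M) → Prop) : Prop :=
  ∃ φ : LAI.Formula (M ⊕ α), ∀ e, RI I φ (Sum.elim id e) ↔ P e

variable {I}

theorem definable_iff_defIn {s : Set (α → M)} :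
    (Set.univ : Set (Expansion M I)).Definable LAI (M := Expansion M I) s ↔
      DefIn I (fun e => e ∈ s) := by
  refine Set.definable_iff_exists_formula_sum.trans ?_
  constructor
  · rintro ⟨φ, rfl⟩
    refine ⟨φ.relabel (Sum.map (fun x => x.1) id), fun e => ?_⟩
    rw [ri_relabel]
    refine iff_of_eq (congrArg (RI I φ) (funext fun i => ?_))
    rcases i with i | i <;> rfl
  · rintro ⟨φ, hφ⟩
    refine ⟨φ.relabel (Sum.map (fun x => ⟨x, trivial⟩) id), Set.ext fun e => ?_⟩
    refine (hφ e).symm.trans (Iff.trans ?_ (ri_relabel I φ _ _).symm)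
    refine iff_of_eq (congrArg (RI I φ) (funext fun i => ?_))
    rcases i with i | i <;> rfl

theorem definable₁_iff_defIn {s : Set M} :
    (Set.univ : Set (Expansion M I)).Definable₁ LAI (M := Expansion M I) s ↔
      DefIn I (fun e : Fin 1 → M => e 0 ∈ s) :=
  definable_iff_defIn

theorem DefIn.of_formula {n : ℕ} (φ : LAI.Formula (Fin (n + 1))) (p : Fin n → M) :
    DefIn I (fun e : Fin 1 → M => RI I φ (Fin.snoc (α := fun _ => M) p (e 0))) := by
  refine ⟨φ.relabel (Fin.snoc (α := fun _ => M ⊕ Fin 1) (fun i => Sum.inl (p i)) (Sum.inr 0)),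
    fun e => ?_⟩
  rw [ri_relabel]
  refine iff_of_eq (congrArg (RI I φ) (funext fun i => ?_))
  refine Fin.lastCases ?_ (fun j => ?_) i <;> simp

theorem DefIn.exists_formula {P : M → Prop} (h : DefIn I (fun e : Fin 1 → M => P (e 0))) :
    ∃ (n : ℕ) (φ : LAI.Formula (Fin (n + 1))) (p : Fin n → M),
      ∀ x, RI I φ (Fin.snoc (α := fun _ => M) p x) ↔ P x := by
  classical
  obtain ⟨φ, hφ⟩ := h
  let s : Finset (M ⊕ Fin 1) := BoundedFormula.freeVarFinset φ
  have hn : Nonempty M := ⟨Structure.funMap (L := LA) ArithFunc.zero ![]⟩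
  let p : Fin s.card → M := fun i => Sum.elim id (fun _ => hn.some) (s.equivFin.symm i).1
  let f : s → Fin (s.card + 1) := fun x =>
    if x.1.isRight then Fin.last _ else (s.equivFin x).castSucc
  refine ⟨s.card, BoundedFormula.restrictFreeVar φ f, p, fun x => ?_⟩
  refine Iff.trans ?_ (hφ ![x])
  refine BoundedFormula.realize_restrictFreeVar (α := M ⊕ Fin 1) (M := Expansion M I) (φ := φ)
    (f := f) _ (fun a => ?_)
  obtain ⟨a | a, ha⟩ := a
  · simp [f, p]
    rfl
  · simp [f, Subsingleton.elim a 0]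
    rfl

/-- A set definable in `(M, J)` is definable in `(M, I)`, if `J` is. -/
theorem DefIn.trans {J : Set M} (hJ : DefIn I (fun e : Fin 1 → M => e 0 ∈ J))
    {P : (α → M) → Prop} (hP : DefIn J P) : DefIn I P := by
  obtain ⟨θ, hθ⟩ := hJ
  have key : ∀ {n : ℕ} (φ : LAI.BoundedFormula (M ⊕ α) n), ∃ ψ : LAI.BoundedFormula (M ⊕ α) n,
      ∀ (e : α → M) (xs : Fin n → M),
        BoundedFormula.Realize (M := Expansion M I) ψ (Sum.elim id e) xs ↔
        BoundedFormula.Realize (M := Expansion M J) φ (Sum.elim id e) xs := by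
    intro n φ
    induction φ with
    | falsum => exact ⟨.falsum, fun _ _ => Iff.rfl⟩
    | equal t s =>
      refine ⟨.equal t s, fun e xs => ?_⟩
      have h1 := termRealize_expansion I J t (Sum.elim (Sum.elim id e) xs)
      have h2 := termRealize_expansion I J s (Sum.elim (Sum.elim id e) xs)
      exact iff_of_eq (congrArg₂ (fun a b : M => a = b) h1 h2)
    | imp φ ψ ih ih' =>
      obtain ⟨φ', h⟩ := ih
      obtain ⟨ψ', h'⟩ := ih'
      exact ⟨.imp φ' ψ', fun e xs => imp_congr (h e xs) (h' e xs)⟩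
    | all φ ih =>
      obtain ⟨φ', h⟩ := ih
      exact ⟨.all φ', fun e xs => forall_congr' fun x => h e _⟩
    | @rel n l R ts =>
      rcases R with R | R
      · refine ⟨.rel (Sum.inl R) ts, fun e xs => ?_⟩
        refine iff_of_eq (congrArg (Structure.RelMap (L := LA) (M := M) R) (funext fun i => ?_))
        exact termRealize_expansion I J (ts i) (Sum.elim (Sum.elim id e) xs)
      · cases R
        refine ⟨BoundedFormula.relabel (n := n) (k := 0) id (BoundedFormula.subst θ (Sum.elim
          (fun x => Term.var (Sum.inl (Sum.inl x))) (fun _ => ts 0))), fun e xs => ?_⟩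
        refine Iff.trans (BoundedFormula.realize_relabel (M := Expansion M I)) ?_
        refine Iff.trans (BoundedFormula.realize_subst (M := Expansion M I)) ?_
        have h1 := termRealize_expansion I J (ts 0) (Sum.elim (Sum.elim id e) xs)
        refine Iff.trans ?_ (hθ ![TI J (ts 0) (Sum.elim (Sum.elim id e) xs)])
        refine iff_of_eq (congrArg₂ _ (funext fun i => ?_) (Subsingleton.elim _ _))
        rcases i with i | i
        · rfl
        · simp only [Sum.elim_inr, Fin.isValue, Matrix.cons_val_fin_one]
          exact h1
  obtain ⟨φ, hφ⟩ := hP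
  obtain ⟨ψ, hψ⟩ := key φ
  exact ⟨ψ, fun e => (hψ e _).trans (hφ e)⟩

end Expansion

/-! ## Models of `PA(I)` -/

section PAofI

variable {M : Type u} [LA.Structure M]

variable (M) in
/-- The number `0` of the model. -/
def zeroM : M := Structure.funMap (L := LA) ArithFunc.zero ![]

/-- The successor function of the model. -/
def succM (x : M) : M := Structure.funMap (L := LA) ArithFunc.succ ![x]

theorem realize_zero_eq {α : Type} (e : α → M) : (0 : LA.Term α).realize e = zeroM M :=
  Term.realize_constants (L := LA)

theorem realize_sc_eq {α : Type} (t : LA.Term α) (e : α → M) :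
    (sc t).realize e = succM (t.realize e) :=
  Term.realize_functions_apply₁ (L := LA)

theorem model_PAofI_iff {I : Set M} : Expansion M I ⊨ PAofI ↔ M ⊨ Q ∧
    ∀ (n : ℕ) (φ : LAI.Formula (Fin (n + 1))) (p : Fin n → M),
      RI I φ (Fin.snoc (α := fun _ => M) p (zeroM M)) →
      (∀ x, RI I φ (Fin.snoc (α := fun _ => M) p x) →
        RI I φ (Fin.snoc (α := fun _ => M) p (succM x))) →
      ∀ x, RI I φ (Fin.snoc (α := fun _ => M) p x) := by
  have h1 : ∀ {n : ℕ} (φ : LAI.Formula (Fin (n + 1))) (p : Fin n → M),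
      RI I (BoundedFormula.subst φ (Fin.snoc (α := fun _ => LAI.Term (Fin n))
        (fun i => Term.var i) (liftT 0))) p ↔
        RI I φ (Fin.snoc (α := fun _ => M) p (zeroM M)) := by
    intro n φ p
    rw [ri_subst]
    refine iff_of_eq (congrArg _ (funext fun i => ?_))
    refine Fin.lastCases ?_ (fun j => ?_) i
    · simp only [Fin.snoc_last, ti_liftT, realize_zero_eq]
    · simp only [Fin.snoc_castSucc]
      rfl
  have h2 : ∀ {n : ℕ} (φ : LAI.Formula (Fin (n + 1))) (p : Fin n → M) (x : M),
      RI I (BoundedFormula.subst φ (Fin.snoc (α := fun _ => LAI.Term (Fin (n + 1)))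
        (fun i => Term.var i.castSucc) (liftT (sc (v (Fin.last n))))))
          (Fin.snoc (α := fun _ => M) p x) ↔
        RI I φ (Fin.snoc (α := fun _ => M) p (succM x)) := by
    intro n φ p x
    rw [ri_subst]
    refine iff_of_eq (congrArg _ (funext fun i => ?_))
    refine Fin.lastCases ?_ (fun j => ?_) i
    · simp only [Fin.snoc_last, ti_liftT, realize_sc_eq, realize_v]
    · simp only [Fin.snoc_castSucc]
      exact Fin.snoc_castSucc (α := fun _ => M) x p j
  have h3 : Expansion M I ⊨ (LHom.sumInl : LA →ᴸ LAI).onTheory Q ↔ M ⊨ Q :=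
    LHom.onTheory_model (M := Expansion M I) _ Q
  rw [PAofI, Theory.model_union_iff, h3]
  refine and_congr_right fun _ => ?_
  simp only [Theory.model_iff, Set.mem_ofPred_eq]
  constructor
  · intro h n φ p h0 hs
    have h4 := (model_closure I _).1 (h _ ⟨n, φ, rfl⟩) p
    simp only [ri_imp, ri_allF, h1, h2] at h4
    exact h4 h0 hs
  · rintro h _ ⟨n, φ, rfl⟩
    refine (model_closure I _).2 fun p => ?_
    simp only [ri_imp, ri_allF, h1, h2]
    exact h n φ p

theorem PAofI.induct {I : Set M} (h : Expansion M I ⊨ PAofI) {P : M → Prop}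
    (hP : DefIn I (fun e : Fin 1 → M => P (e 0))) (h0 : P (zeroM M))
    (hs : ∀ x, P x → P (succM x)) (x : M) : P x := by
  obtain ⟨n, φ, p, hφ⟩ := hP.exists_formula
  have := (model_PAofI_iff.1 h).2 n φ p
  simp only [hφ] at this
  exact this h0 hs x

theorem PAofI.of_defIn {I J : Set M} (h : Expansion M I ⊨ PAofI)
    (hJ : DefIn I (fun e : Fin 1 → M => e 0 ∈ J)) : Expansion M J ⊨ PAofI :=
  model_PAofI_iff.2 ⟨(model_PAofI_iff.1 h).1, fun _ φ p =>
    PAofI.induct h (P := fun x => RI J φ (Fin.snoc (α := fun _ => M) p x))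
      (DefIn.trans hJ (DefIn.of_formula φ p))⟩

theorem PAofI.isPeano {I : Set M} (h : Expansion M I ⊨ PAofI) : IsPeano M := by
  obtain ⟨hQ, hind⟩ := model_PAofI_iff.1 h
  obtain ⟨_, hzero⟩ : ∃ _ : Zero M, 0 = zeroM M := ⟨⟨zeroM M⟩, rfl⟩
  obtain ⟨_, hone⟩ : ∃ _ : One M, 1 = succM (zeroM M) := ⟨⟨succM (zeroM M)⟩, rfl⟩
  obtain ⟨_, hadd⟩ : ∃ _ : Add M, ∀ x : Fin 2 → M,
      Structure.funMap (L := LA) ArithFunc.add x = x 0 + x 1 :=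
    ⟨⟨fun x y => Structure.funMap (L := LA) ArithFunc.add ![x, y]⟩, fun x =>
      congrArg (Structure.funMap (L := LA) ArithFunc.add)
        (funext fun i => by fin_cases i <;> rfl)⟩
  obtain ⟨_, hmul⟩ : ∃ _ : Mul M, ∀ x : Fin 2 → M,
      Structure.funMap (L := LA) ArithFunc.mul x = x 0 * x 1 :=
    ⟨⟨fun x y => Structure.funMap (L := LA) ArithFunc.mul ![x, y]⟩, fun x =>
      congrArg (Structure.funMap (L := LA) ArithFunc.mul)
        (funext fun i => by fin_cases i <;> rfl)⟩
  obtain ⟨_, hlt⟩ : ∃ _ : LT M, ∀ x : Fin 2 → M,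
      Structure.RelMap (L := LA) ArithRel.lt x ↔ x 0 < x 1 :=
    ⟨⟨fun x y => Structure.RelMap (L := LA) ArithRel.lt ![x, y]⟩, fun x =>
      iff_of_eq (congrArg (Structure.RelMap (L := LA) ArithRel.lt)
        (funext fun i => by fin_cases i <;> rfl))⟩
  have haddT : ∀ {α : Type} (t s : LA.Term α) (e : α → M),
      (t + s).realize e = t.realize e + s.realize e :=
    fun t s e => hadd _
  have hax : ∀ {n : ℕ} {φ : LA.Formula (Fin n)}, closure φ ∈ Q → ∀ e : Fin n → M, φ.Realize e :=
    fun hφ => (realize_closure _).1 ((Theory.model_iff _).1 hQ _ hφ)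
  have hadd0 : ∀ x : M, x + 0 = x := fun x => by
    have := hax (n := 1) (φ := eqF (v 0 + 0) (v 0)) (by simp [Q]) ![x]
    rwa [realize_eqF, haddT, realize_zero_eq, ← hzero] at this
  have hadds : ∀ x y : M, x + succM y = succM (x + y) := fun x y => by
    have := hax (n := 2) (φ := eqF (v 0 + sc (v 1)) (sc (v 0 + v 1))) (by simp [Q]) ![x, y]
    rwa [realize_eqF, haddT, realize_sc_eq, realize_sc_eq, haddT] at this
  have hsucc : ∀ x : M, succM x = x + 1 := fun x => by
    rw [hone, hadds, ← hzero, hadd0]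
  have : ArithCompat M :=
    { funMap_zero := fun x => hzero ▸ congrArg _ (Subsingleton.elim _ _)
      funMap_succ := fun x => by
        rw [← hsucc]
        refine congrArg (Structure.funMap (L := LA) ArithFunc.succ) (funext fun i => ?_)
        fin_cases i
        rfl
      funMap_add := hadd
      funMap_mul := hmul
      relMap_lt := hlt }
  have : PeanoAxioms M :=
    { succ_ne_zero := fun x => by
        simpa using hax (n := 1) (φ := (eqF (sc (v 0)) 0).not) (by simp [Q]) ![x]
      succ_inj := fun {x y} => by
        simpa using hax (n := 2) (φ := (eqF (sc (v 0)) (sc (v 1))).imp (eqF (v 0) (v 1)))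
          (by simp [Q]) ![x, y]
      add_zero' := hadd0
      zero_add_one := by rw [← hsucc, hone, hzero]
      add_succ := fun x y => by
        rw [← hsucc, ← hsucc]
        exact hadds x y
      mul_zero' := fun x => by
        have := hax (n := 1) (φ := eqF (v 0 * 0) 0) (by simp [Q]) ![x]
        rwa [realize_eqF, realize_mulT, realize_zeroT] at this
      mul_succ := fun x y => by
        have := hax (n := 2) (φ := eqF (v 0 * sc (v 1)) (v 0 * v 1 + v 0)) (by simp [Q]) ![x, y]
        rwa [realize_eqF, realize_mulT, realize_sc, haddT, realize_mulT] at this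
      lt_iff_exists_add := fun {x y} => by
        have := hax (n := 2) (φ := (ltF (v 0) (v 1)).iff (exF (eqF (sc (v 2) + v 0) (v 1))))
          (by simp [Q]) ![x, y]
        simp only [Formula.realize_iff, realize_ltF, realize_exF, realize_eqF, realize_addT,
          realize_sc] at this
        exact this
      ind := fun {n} φ p h0 hs x => by
        have := hind n (lift φ) p
        simp only [ri_lift, hsucc, ← hzero] at this
        exact this h0 hs x }
  exact PeanoAxioms.isPeano M

/-! ### Definable rigidity and interpretations on the same universe -/

theorem PAofI.eq_self {I : Set M} (h : Expansion M I ⊨ PAofI) {f : M → M}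
    (hf : DefinableMap LAI (Expansion M I) f) (h0 : f (zeroM M) = zeroM M)
    (hs : ∀ x, f (succM x) = succM (f x)) (x : M) : f x = x := by
  refine PAofI.induct h (P := fun x => f x = x) ?_ h0 (fun x hx => by rw [hs, hx]) x
  obtain ⟨φ, hφ⟩ := definable_iff_defIn.1 hf
  refine ⟨φ.relabel (Sum.map id fun _ => 0), fun e => ?_⟩
  rw [ri_relabel]
  refine Iff.trans (iff_of_eq (congrArg (RI I φ) (funext fun i => ?_)))
    ((hφ ![e 0, e 0]).trans eq_comm)
  rcases i with i | i
  · rfl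
  · fin_cases i <;> rfl

theorem isInterpretation_id {I J : Set M} (hJ : DefIn I (fun e : Fin 1 → M => e 0 ∈ J)) :
    IsInterpretation LAI (Expansion M J) (Expansion M I) (id : M → M) where
  injective := Function.injective_id
  universe_definable := by
    refine definable_iff_defIn.2 ⟨⊤, fun e => ?_⟩
    exact iff_of_true ((Formula.realize_top (M := Expansion M I)).2 trivial) ⟨e 0, rfl⟩
  function_definable n F := by
    refine definable_iff_defIn.2 ⟨Term.equal (Term.var (Sum.inr (Fin.last n)))
      (Term.func F fun i => Term.var (Sum.inr i.castSucc)), fun e => ?_⟩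
    refine Iff.trans (Formula.realize_equal (M := Expansion M I)) ?_
    have hF : ∀ y : Fin n → M, Structure.funMap (L := LAI) (M := Expansion M I) F y =
        Structure.funMap (L := LAI) (M := Expansion M J) F y := by
      intro y
      rcases F with F | F
      · rfl
      · exact F.elim
    constructor
    · intro h
      refine ⟨fun i => e i.castSucc, funext fun i => ?_⟩
      refine Fin.lastCases ?_ (fun j => ?_) i
      · exact (h.trans (hF _)).trans (Fin.snoc_last (α := fun _ => M) _ _).symm
      · exact (Fin.snoc_castSucc (α := fun _ => M) _ (fun i : Fin n => e i.castSucc) j).symm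
    · rintro ⟨y, rfl⟩
      refine Eq.trans (Fin.snoc_last (α := fun _ => M) _ _) ((hF y).symm.trans ?_)
      exact congrArg (Structure.funMap (L := LAI) (M := Expansion M I) F)
        (funext fun i => (Fin.snoc_castSucc (α := fun _ => M) _ _ i).symm)
  relation_definable n R := by
    refine definable_iff_defIn.2 (DefIn.trans hJ ⟨Relations.formula R fun i => Term.var (Sum.inr i),
      fun e => ?_⟩)
    refine Iff.trans (Formula.realize_rel (M := Expansion M J)) ?_
    constructor
    · exact fun h => ⟨e, rfl, h⟩
    · rintro ⟨y, rfl, h⟩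
      exact h

/-- There is no definable isomorphism between `(M, I)` and a different `(M, J)`. -/
theorem PAofI.eq_of_definable_iso {I J : Set M} (h : Expansion M I ⊨ PAofI)
    (f : Expansion M I ≃[LAI] Expansion M J) (hf : DefinableMap LAI (Expansion M I) (f : M → M)) :
    I = J := by
  have h1 : ∀ x : M, (f : M → M) x = x := by
    refine PAofI.eq_self h hf ?_ fun x => ?_
    · refine (f.map_fun' (Sum.inl ArithFunc.zero : LAI.Functions 0) ![]).trans ?_
      exact congrArg (Structure.funMap (L := LA) (M := M) ArithFunc.zero) (Subsingleton.elim _ _)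
    · refine (f.map_fun' (Sum.inl ArithFunc.succ : LAI.Functions 1) ![x]).trans ?_
      refine congrArg (Structure.funMap (L := LA) (M := M) ArithFunc.succ) (funext fun i => ?_)
      fin_cases i
      rfl
  ext x
  have h2 := f.map_rel' (Sum.inr IndRel.mem : LAI.Relations 1) ![x]
  refine Iff.trans h2.symm ?_
  exact iff_of_eq (congrArg (· ∈ J) (h1 x))

end PAofI

/-! ## Models of `PAI` and `PAI°` -/

section PAI

set_option linter.unusedSectionVars false

variable {M : Type u} [LA.Structure M] [CommSemiring M] [LinearOrder M]
  [IsStrictOrderedRing M] [CanonicallyOrderedAdd M] [PeanoModel M]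

theorem zeroM_eq : zeroM M = 0 := ArithCompat.funMap_zero _

theorem succM_eq (x : M) : succM x = x + 1 := ArithCompat.funMap_succ _

theorem model_Ubd {I : Set M} : Expansion M I ⊨ Ubd ↔ ∀ x : M, ∃ y ∈ I, x < y := by
  unfold Ubd
  rw [model_closure]
  simp only [ri_exF, ri_inf, ri_memI, ri_lift, realize_ltF, realize_v]
  constructor
  · intro h x
    simpa using h ![x]
  · intro h e
    obtain ⟨y, hy, hxy⟩ := h (e 0)
    exact ⟨y, hy, hxy⟩

theorem ri_incrI {I : Set M} {α : Type} {n : ℕ} (t : Fin n → LA.Term α) (e : α → M) :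
    RI I (incrI t) e ↔ (∀ i, (t i).realize e ∈ I) ∧ StrictMono fun i => (t i).realize e := by
  simp only [incrI, ri_inf, ri_iInf, ri_memI, ri_lift, realize_ltF, Subtype.forall, Prod.forall]
  rfl

theorem model_Indis {I : Set M} {n : ℕ} (φ : LA.Formula (Fin n)) :
    Expansion M I ⊨ Indis φ ↔ ∀ x y : Fin n → M, (∀ i, x i ∈ I) → StrictMono x →
      (∀ i, y i ∈ I) → StrictMono y → (φ.Realize x ↔ φ.Realize y) := by
  unfold Indis
  rw [model_closure]
  simp only [ri_imp, ri_inf, ri_incrI, ri_iff, ri_lift, realize_substF]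
  constructor
  · intro h x y hx hx' hy hy'
    exact h (Sum.elim x y) ⟨⟨hx, hx'⟩, hy, hy'⟩
  · rintro h e ⟨⟨hx, hx'⟩, hy, hy'⟩
    exact h _ _ hx hx' hy hy'

theorem model_IndisCirc {I : Set M} {n : ℕ} (φ : LA.Formula (Fin n)) :
    Expansion M I ⊨ IndisCirc φ ↔ ∀ x y : Fin n → M, (∀ i, x i ∈ I) → StrictMono x →
      (∀ i, y i ∈ I) → StrictMono y →
      (∀ i, i.val = 0 → (gn φ : M) < x i ∧ (gn φ : M) < y i) → (φ.Realize x ↔ φ.Realize y) := by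
  unfold IndisCirc
  rw [model_closure]
  simp only [ri_imp, ri_inf, ri_incrI, ri_iff, ri_lift, realize_substF, ri_iInf, realize_ltF,
    realize_num, Subtype.forall]
  constructor
  · intro h x y hx hx' hy hy' h0
    exact h (Sum.elim x y) ⟨⟨⟨hx, hx'⟩, hy, hy'⟩, h0⟩
  · rintro h e ⟨⟨⟨hx, hx'⟩, hy, hy'⟩, h0⟩
    exact h _ _ hx hx' hy hy' h0

theorem model_PAI_iff {I : Set M} : Expansion M I ⊨ PAI ↔
    Expansion M I ⊨ PAofI ∧ (∀ x : M, ∃ y ∈ I, x < y) ∧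
      ∀ (n : ℕ) (φ : LA.Formula (Fin n)) (x y : Fin n → M), (∀ i, x i ∈ I) → StrictMono x →
        (∀ i, y i ∈ I) → StrictMono y → (φ.Realize x ↔ φ.Realize y) := by
  rw [PAI, Theory.model_union_iff, Theory.model_union_iff, Theory.model_singleton_iff, model_Ubd,
    and_assoc]
  refine and_congr_right fun _ => and_congr_right fun _ => ?_
  simp only [Theory.model_iff, Set.mem_ofPred_eq, forall_exists_index]
  constructor
  · intro h n φ
    exact (model_Indis φ).1 (h _ n φ rfl)
  · rintro h _ n φ rfl
    exact (model_Indis φ).2 (h n φ)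

theorem model_PAICirc_iff {I : Set M} : Expansion M I ⊨ PAICirc ↔
    Expansion M I ⊨ PAofI ∧ (∀ x : M, ∃ y ∈ I, x < y) ∧
      ∀ (n : ℕ) (φ : LA.Formula (Fin n)) (x y : Fin n → M), (∀ i, x i ∈ I) → StrictMono x →
        (∀ i, y i ∈ I) → StrictMono y →
        (∀ i, i.val = 0 → (gn φ : M) < x i ∧ (gn φ : M) < y i) →
        (φ.Realize x ↔ φ.Realize y) := by
  rw [PAICirc, Theory.model_union_iff, Theory.model_union_iff, Theory.model_singleton_iff,
    model_Ubd, and_assoc]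
  refine and_congr_right fun _ => and_congr_right fun _ => ?_
  simp only [Theory.model_iff, Set.mem_ofPred_eq, forall_exists_index]
  constructor
  · intro h n φ
    exact (model_IndisCirc φ).1 (h _ n φ rfl)
  · rintro h _ n φ rfl
    exact (model_IndisCirc φ).2 (h n φ)

theorem model_PAICirc_of_PAI {I : Set M} (h : Expansion M I ⊨ PAI) : Expansion M I ⊨ PAICirc := by
  obtain ⟨h1, h2, h3⟩ := model_PAI_iff.1 h
  exact model_PAICirc_iff.2 ⟨h1, h2, fun n φ x y hx hx' hy hy' _ => h3 n φ x y hx hx' hy hy'⟩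

theorem model_PAI_of_subset {I J : Set M} (h : Expansion M I ⊨ PAI)
    (hJ : DefIn I (fun e : Fin 1 → M => e 0 ∈ J)) (hJI : J ⊆ I)
    (hub : ∀ x : M, ∃ y ∈ J, x < y) : Expansion M J ⊨ PAI := by
  obtain ⟨h1, -, h3⟩ := model_PAI_iff.1 h
  exact model_PAI_iff.2 ⟨PAofI.of_defIn h1 hJ, hub, fun n φ x y hx hx' hy hy' =>
    h3 n φ x y (fun i => hJI (hx i)) hx' (fun i => hJI (hy i)) hy'⟩

theorem model_PAICirc_of_subset {I J : Set M} (h : Expansion M I ⊨ PAICirc)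
    (hJ : DefIn I (fun e : Fin 1 → M => e 0 ∈ J)) (hJI : J ⊆ I)
    (hub : ∀ x : M, ∃ y ∈ J, x < y) : Expansion M J ⊨ PAICirc := by
  obtain ⟨h1, -, h3⟩ := model_PAICirc_iff.1 h
  exact model_PAICirc_iff.2 ⟨PAofI.of_defIn h1 hJ, hub, fun n φ x y hx hx' hy hy' =>
    h3 n φ x y (fun i => hJI (hx i)) hx' (fun i => hJI (hy i)) hy'⟩

theorem PAofI.exists_least {I : Set M} (h : Expansion M I ⊨ PAofI) (hI : I.Nonempty) :
    ∃ i ∈ I, ∀ x ∈ I, i ≤ x := by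
  by_contra hc
  push Not at hc
  have key : ∀ n : M, ∀ x : M, x < n → x ∉ I := by
    refine PAofI.induct h (P := fun n => ∀ x : M, x < n → x ∉ I) ?_ ?_ ?_
    · convert DefIn.of_formula (I := I) (allF ((lift (ltF (v 1) (v 0))).imp (memI (v 1)).not)) ![]
        using 2
      simp
    · intro x hx
      rw [zeroM_eq] at hx
      exact absurd hx not_lt_zero
    · intro n hn x hx hxI
      rw [succM_eq, lt_add_one_iff_le] at hx
      obtain ⟨y, hy, hyx⟩ := hc x hxI
      exact hn y (hyx.trans_le hx) hy
  obtain ⟨i, hi⟩ := hI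
  exact key (i + 1) i (lt_add_one i) hi

theorem defIn_diff_singleton (I : Set M) (a : M) :
    DefIn I (fun e : Fin 1 → M => e 0 ∈ I \ {a}) := by
  convert DefIn.of_formula (I := I) (memI (v 1) ⊓ (lift (eqF (v 1) (v 0))).not) ![a] using 2
  simp

theorem defIn_of_diff_singleton {I : Set M} {a : M} (ha : a ∈ I) :
    DefIn (I \ {a}) (fun e : Fin 1 → M => e 0 ∈ I) := by
  convert DefIn.of_formula (I := I \ {a}) (memI (v 1) ⊔ lift (eqF (v 1) (v 0))) ![a] using 2 with e
  by_cases h : e 0 = a <;> simp [h, ha]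

/-! ### Doubling -/

theorem mem_double {I : Set M} {x : M} : x ∈ double I ↔ ∃ i ∈ I, x = i + i := by
  have h : ∀ i : M, Structure.funMap (L := LA) ArithFunc.add ![i, i] = i + i :=
    fun i => ArithCompat.funMap_add _
  change (∃ i ∈ I, x = Structure.funMap (L := LA) ArithFunc.add ![i, i]) ↔ _
  simp only [h]

theorem add_self_lt_add_self {x y : M} : x + x < y + y ↔ x < y := by
  refine ⟨fun h => ?_, fun h => add_lt_add h h⟩
  by_contra hc
  exact absurd h (not_lt.2 (add_le_add (not_lt.1 hc) (not_lt.1 hc)))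

theorem add_self_inj {x y : M} (h : x + x = y + y) : x = y := by
  rcases lt_trichotomy x y with h1 | h1 | h1
  · exact absurd h (add_lt_add h1 h1).ne
  · exact h1
  · exact absurd h (add_lt_add h1 h1).ne'

theorem defIn_double (I : Set M) : DefIn I (fun e : Fin 1 → M => e 0 ∈ double I) := by
  convert DefIn.of_formula (I := I) (exF (memI (v 1) ⊓ lift (eqF (v 0) (v 1 + v 1)))) ![] using 2
  simp [mem_double]

theorem defIn_of_double (I : Set M) : DefIn (double I) (fun e : Fin 1 → M => e 0 ∈ I) := by
  convert DefIn.of_formula (I := double I) (memI (v 0 + v 0)) ![] using 2 with e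
  simp only [snoc_vecEmpty, ri_memI, realize_addT, realize_v, mem_double]
  constructor
  · exact fun h => ⟨e 0, h, rfl⟩
  · rintro ⟨i, hi, h⟩
    have h1 : e 0 = i := add_self_inj h
    rwa [h1]

theorem model_PAI_double {I : Set M} (h : Expansion M I ⊨ PAI) : Expansion M (double I) ⊨ PAI := by
  obtain ⟨h1, h2, h3⟩ := model_PAI_iff.1 h
  refine model_PAI_iff.2 ⟨PAofI.of_defIn h1 (defIn_double I), fun x => ?_, ?_⟩
  · obtain ⟨y, hy, hxy⟩ := h2 x
    exact ⟨y + y, mem_double.2 ⟨y, hy, rfl⟩, hxy.trans_le le_self_add⟩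
  · intro n φ x y hx hx' hy hy'
    choose x₀ hx₀ hxx using fun i => mem_double.1 (hx i)
    choose y₀ hy₀ hyy using fun i => mem_double.1 (hy i)
    have h4 := h3 n (BoundedFormula.subst φ fun i => v i + v i) x₀ y₀ hx₀
      (fun i j hij => add_self_lt_add_self.1 (by simpa only [← hxx] using hx' hij)) hy₀
      (fun i j hij => add_self_lt_add_self.1 (by simpa only [← hyy] using hy' hij))
    simpa only [realize_substF, realize_addT, realize_v, ← hxx, ← hyy] using h4

theorem double_ne {I : Set M} (h : Expansion M I ⊨ PAI) : I ≠ double I := by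
  intro hI
  obtain ⟨h1, h2, h3⟩ := model_PAI_iff.1 h
  obtain ⟨x, hx, -⟩ := h2 0
  obtain ⟨i, hi, hmin⟩ := PAofI.exists_least h1 ⟨x, hx⟩
  have hi' := hi
  rw [hI] at hi'
  obtain ⟨j, hj, hij⟩ := mem_double.1 hi'
  have h0 : i = 0 := by
    have h4 : i + i ≤ i + 0 := by
      rw [add_zero]
      conv_rhs => rw [hij]
      exact add_le_add (hmin j hj) (hmin j hj)
    exact le_antisymm (le_of_add_le_add_left h4) zero_le
  subst h0
  obtain ⟨y, hy, h0y⟩ := h2 0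
  have h5 := h3 1 (eqF (v 0) 0) ![0] ![y] (by simpa using hi) (Subsingleton.strictMono _)
    (by simpa using hy) (Subsingleton.strictMono _)
  simp at h5
  exact h0y.ne' h5

end PAI

theorem double_isInterpreted {M : Type u} [LA.Structure M] {I : Set M} (h : Expansion M I ⊨ PAI) :
    Expansion M (double I) ⊨ PAI ∧
      IsInterpretation LAI (Expansion M (double I)) (Expansion M I) (id : M → M) ∧
      IsInterpretation LAI (Expansion M I) (Expansion M (double I)) (id : M → M) ∧
      ¬ ∃ f : Expansion M I ≃[LAI] Expansion M (double I),
        DefinableMap LAI (Expansion M I) (f : M → M) := by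
  have hPA : Expansion M I ⊨ PAofI :=
    h.mono (Set.subset_union_left.trans Set.subset_union_left)
  obtain ⟨_, _, _, _, _⟩ := PAofI.isPeano hPA
  refine ⟨model_PAI_double h, isInterpretation_id (defIn_double I),
    isInterpretation_id (defIn_of_double I), ?_⟩
  rintro ⟨f, hf⟩
  exact double_ne h (PAofI.eq_of_definable_iso hPA f hf)

theorem definably_rigid {M : Type u} [LA.Structure M] {I : Set M} (h : Expansion M I ⊨ PAofI)
    (f : M ≃[LA] M) (hf : DefinableMap LAI (Expansion M I) (f : M → M)) (x : M) : f x = x := by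
  refine PAofI.eq_self h hf ?_ (fun x => ?_) x
  · refine (f.map_fun' (ArithFunc.zero : LA.Functions 0) ![]).trans ?_
    exact congrArg (Structure.funMap (L := LA) (M := M) ArithFunc.zero) (Subsingleton.elim _ _)
  · refine (f.map_fun' (ArithFunc.succ : LA.Functions 1) ![x]).trans ?_
    refine congrArg (Structure.funMap (L := LA) (M := M) ArithFunc.succ) (funext fun i => ?_)
    fin_cases i
    rfl

/-! ## The formula `σ` and the sentence `α` in models -/

section Alpha

set_option linter.unusedSectionVars false

variable {M : Type u} [LA.Structure M] [CommSemiring M] [LinearOrder M]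
  [IsStrictOrderedRing M] [CanonicallyOrderedAdd M] [PeanoModel M]

/-- `φ` and all entries of `a` are below `j`. -/
def Below (φ a j : M) : Prop := φ < j ∧ ∀ i x, Entry a i x → x < j

/-- `j` is the first element of `I` above `φ` and all entries of `a`. -/
def Start (I : Set M) (φ a j : M) : Prop :=
  (j ∈ I ∧ Below φ a j) ∧ ∀ w, w ∈ I ∧ Below φ a w → j ≤ w

/-- `w` is above `j` and above the entries of `g` of index below `i`. -/
def Above (j g i w : M) : Prop := j < w ∧ ∀ i' x, i' < i ∧ Entry g i' x → x < w

/-- The tuple `g` lists the first elements of `I` above `j`. -/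
def First (I : Set M) (j g : M) : Prop :=
  ∀ i x, Entry g i x → (x ∈ I ∧ Above j g i x) ∧ ∀ w, w ∈ I ∧ Above j g i w → x ≤ w

/-- The relation defined by `σ`. -/
def Sigma' (I : Set M) (φ a : M) : Prop :=
  ∃ m ψ k j g, ((((((IsForm m φ ∧ IsTup m a) ∧ IsStar 0 φ ψ) ∧ IsDepth φ k) ∧ Start I φ a j) ∧
    IsTup k g) ∧ First I j g) ∧ Sat g ψ a 1

theorem realize_belowF (φ a j : M) : belowF.Realize ![φ, a, j] ↔ Below φ a j := by
  simp [belowF, Below]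

theorem realize_aboveF (j g i w : M) : aboveF.Realize ![j, g, i, w] ↔ Above j g i w := by
  simp [aboveF, Above]

theorem ri_startF (I : Set M) (φ a j : M) : RI I startF ![φ, a, j] ↔ Start I φ a j := by
  simp only [startF, ri_inf, ri_memI, ri_lift, ri_allF, ri_imp, realize_substF, realize_vecCons,
    realize_vecEmpty, snoc_vecCons, snoc_vecEmpty, realize_leF, realize_v, realize_belowF]
  rfl

theorem ri_firstF (I : Set M) (j g : M) : RI I firstF ![j, g] ↔ First I j g := by
  simp only [firstF, ri_inf, ri_memI, ri_lift, ri_allF, ri_imp, realize_substF, realize_vecCons,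
    realize_vecEmpty, snoc_vecCons, snoc_vecEmpty, realize_leF, realize_v, realize_aboveF,
    realize_entry]
  exact forall_congr' fun _ => forall_congr' fun _ => imp_congr_right fun _ =>
    and_congr_left fun _ => and_congr_right fun _ => realize_aboveF _ _ _ _

theorem ri_sigma (I : Set M) {n : ℕ} (φ a : LA.Term (Fin n)) (e : Fin n → M) :
    RI I (sigma φ a) e ↔ Sigma' I (φ.realize e) (a.realize e) := by
  unfold sigma
  rw [ri_subst_vec2]
  simp only [sigmaF, ri_exF, ri_inf, ri_lift, ri_subst_vec2, ri_subst_vec3, snoc_vecCons,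
    snoc_vecEmpty, realize_v, ri_startF, ri_firstF, realize_isForm, realize_isTup, realize_isStar,
    realize_isDepth, realize_sat, Formula.realize_inf]
  rfl

/-- Tarski's conditions for the relation `S`. -/
def Tarski (S : M → M → Prop) : Prop :=
  ∀ m a, IsTup m a →
    (((∀ t s, IsTermIn 0 m 0 t ∧ IsTermIn 0 m 0 s →
      (S (pr 6 (pr t s)) a ↔ ∃ x, Val a 0 t x ∧ Val a 0 s x) ∧
      (S (pr 7 (pr t s)) a ↔ ∃ x y, (Val a 0 t x ∧ Val a 0 s y) ∧ x < y)) ∧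
    (∀ φ, IsForm m φ → (S (pr 8 φ) a ↔ ¬ S φ a))) ∧
    (∀ φ ψ, IsForm m φ ∧ IsForm m ψ → (S (pr 9 (pr φ ψ)) a ↔ S φ a ∨ S ψ a))) ∧
    ∀ φ, IsForm (m + 1) φ → (S (pr 10 φ) a ↔ ∃ y, S φ (pr y a + 1))

theorem model_alpha {I : Set M} : Expansion M I ⊨ alpha ↔ Tarski (Sigma' I) := by
  unfold alpha
  rw [model_closure]
  have h : ∀ P : (Fin 2 → M) → Prop, (∀ e, P e) ↔ ∀ m a, P ![m, a] := by
    refine fun P => ⟨fun h m a => h _, fun h e => ?_⟩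
    convert h (e 0) (e 1) using 1
    funext i
    fin_cases i <;> rfl
  rw [h]
  refine forall_congr' fun m => forall_congr' fun a => ?_
  simp [ri_sigma, isTerm, cEq, cLt, cNeg, cOr, cEx, cons, and_assoc]

/-! ### Removing the first indiscernible -/

theorem exists_closed_term (x : M) : ∃ t : M, x ≤ t ∧ ∀ m, IsTermIn 0 m 0 t := by
  refine PeanoModel.induct (exF (leF (v 0) (v 1) ⊓ allF (isTerm (v 2) (v 1)))) ![]
    (fun x : M => ∃ t : M, x ≤ t ∧ ∀ m, IsTermIn 0 m 0 t) (by simp [isTerm]) ?_ ?_ x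
  · exact ⟨pr 2 0, zero_le, fun m => isTermIn_zero⟩
  · rintro x ⟨t, hxt, ht⟩
    refine ⟨pr 3 t, ?_, fun m => isTermIn_succ.2 (ht m)⟩
    calc x + 1 ≤ t + 3 := by
          gcongr
          norm_num
      _ = 3 + t := add_comm _ _
      _ ≤ pr 3 t := by
          unfold pr
          rw [show ((3 : M) + t) * (3 + t) + 3 = (3 + t) + ((3 + t) * (2 + t) + 3) by ring]
          exact le_self_add

theorem exists_padding {I : Set M} (h : Expansion M I ⊨ PAI) {i j : M} (hi : i ∈ I) (hj : j ∈ I)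
    (hij : i < j) :
    ∃ t : M, (∀ m, IsTermIn 0 m 0 t) ∧ i ≤ t ∧ pr 9 (pr i (pr 7 (pr t (pr 2 0)))) < j := by
  obtain ⟨-, h2, h3⟩ := model_PAI_iff.1 h
  obtain ⟨t, hit, ht⟩ := exists_closed_term i
  obtain ⟨y, hy, hty⟩ := h2 (i + pr 9 (pr i (pr 7 (pr t (pr 2 0)))))
  have h4 := h3 2 (exF ((allF (isTerm (v 3) (v 2))) ⊓ leF (v 0) (v 2) ⊓
    ltF (cOr (v 0) (cLt (v 2) cZero)) (v 1))) ![i, y] ![i, j]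
    (by simp [Fin.forall_fin_two, hi, hy])
    (by
      rw [Fin.strictMono_iff_lt_succ]
      simpa using le_self_add.trans_lt hty)
    (by simp [Fin.forall_fin_two, hi, hj])
    (by
      rw [Fin.strictMono_iff_lt_succ]
      simpa using hij)
  simp [isTerm, cOr, cLt, cZero, and_assoc] at h4
  exact h4.1 ⟨t, ht, hit, le_add_self.trans_lt hty⟩

variable {I : Set M} {i₀ : M}

theorem first_diff_iff {j g : M} (hj : i₀ ≤ j) : First (I \ {i₀}) j g ↔ First I j g := by
  have h : ∀ {w}, j < w → (w ∈ I \ {i₀} ↔ w ∈ I) := by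
    intro w hw
    simp only [Set.mem_sdiff, Set.mem_singleton_iff, and_iff_left_iff_imp]
    rintro - rfl
    exact absurd hw (not_lt.2 hj)
  unfold First
  refine forall_congr' fun i => forall_congr' fun x => imp_congr_right fun _ => and_congr ?_ ?_
  · exact and_congr_left fun h' => h h'.1
  · exact forall_congr' fun w => imp_congr_left (and_congr_left fun h' => h h'.1)

theorem start_diff_iff_of_not_below {φ a j : M} (hb : ¬ Below φ a i₀) :
    Start (I \ {i₀}) φ a j ↔ Start I φ a j := by
  have h : ∀ {w}, Below φ a w → (w ∈ I \ {i₀} ↔ w ∈ I) := by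
    intro w hw
    simp only [Set.mem_sdiff, Set.mem_singleton_iff, and_iff_left_iff_imp]
    rintro - rfl
    exact hb hw
  unfold Start
  refine and_congr ?_ ?_
  · exact and_congr_left fun h' => h h'
  · exact forall_congr' fun w => imp_congr_left (and_congr_left fun h' => h h')

theorem Below.mono {φ a j w : M} (h : Below φ a j) (hw : j ≤ w) : Below φ a w :=
  ⟨h.1.trans_le hw, fun i x hx => (h.2 i x hx).trans_le hw⟩

/-- Removing the least element of `I` does not change the relation defined by `σ`. -/
theorem sigma_diff_iff (hPAI : Expansion M I ⊨ PAI) (hα : Expansion M I ⊨ alpha) (hi₀ : i₀ ∈ I)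
    (hmin : ∀ x ∈ I, i₀ ≤ x) (φ a : M) : Sigma' (I \ {i₀}) φ a ↔ Sigma' I φ a := by
  have hαT := model_alpha.1 hα
  obtain ⟨hPA, hub, -⟩ := model_PAI_iff.1 hPAI
  by_cases hb : Below φ a i₀
  · -- the second element of `I`
    obtain ⟨y, hy, hiy⟩ := hub i₀
    obtain ⟨i₁, hi₁, hmin₁⟩ := PAofI.exists_least
      (PAofI.of_defIn hPA (defIn_diff_singleton I i₀)) ⟨y, hy, hiy.ne'⟩
    have hlt : i₀ < i₁ := lt_of_le_of_ne (hmin _ hi₁.1) (Ne.symm hi₁.2)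
    obtain ⟨t, ht, hit, hpad⟩ := exists_padding hPAI hi₀ hi₁.1 hlt
    set χ : M := pr 7 (pr t (pr 2 0)) with hχ
    have hχlt : pr 9 (pr φ χ) < i₁ := by
      refine lt_trans (pr_lt_pr le_rfl (pr_lt_pr_left hb.1 le_rfl)) hpad
    have hχge : i₀ ≤ pr 9 (pr φ χ) :=
      calc i₀ ≤ t := hit
        _ ≤ pr t (pr 2 0) := le_pr_left _ _
        _ ≤ χ := le_pr_right _ _
        _ ≤ pr φ χ := le_pr_right _ _
        _ ≤ pr 9 (pr φ χ) := le_pr_right _ _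
    have hstart : ∀ j, Start (I \ {i₀}) φ a j ↔ Start I (pr 9 (pr φ χ)) a j := by
      intro j
      have hb₁ : Below (pr 9 (pr φ χ)) a i₁ := ⟨hχlt, (hb.mono hlt.le).2⟩
      have h1 : Start (I \ {i₀}) φ a j ↔ j = i₁ := by
        refine ⟨fun h => le_antisymm (h.2 _ ⟨hi₁, hb.mono hlt.le⟩) (hmin₁ _ h.1.1), ?_⟩
        rintro rfl
        exact ⟨⟨hi₁, hb.mono hlt.le⟩, fun w hw => hmin₁ w hw.1⟩
      have h2 : Start I (pr 9 (pr φ χ)) a j ↔ j = i₁ := by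
        have h3 : ∀ w, w ∈ I ∧ Below (pr 9 (pr φ χ)) a w → i₁ ≤ w := by
          rintro w ⟨hw, hbw⟩
          refine hmin₁ w ⟨hw, ?_⟩
          rintro rfl
          exact absurd hbw.1 (not_lt.2 hχge)
        refine ⟨fun h => le_antisymm (h.2 _ ⟨hi₁.1, hb₁⟩) (h3 _ h.1), ?_⟩
        rintro rfl
        exact ⟨⟨hi₁.1, hb₁⟩, h3⟩
      rw [h1, h2]
    have hχform : ∀ m, IsForm m χ := fun m => isForm_lt.2 ⟨ht m, isTermIn_zero⟩
    have hpadded : Sigma' (I \ {i₀}) φ a ↔ Sigma' I (pr 9 (pr φ χ)) a := by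
      have hfirst : ∀ {j g}, Start (I \ {i₀}) φ a j → (First (I \ {i₀}) j g ↔ First I j g) :=
        fun h => first_diff_iff (hmin _ h.1.1.1)
      constructor
      · rintro ⟨m, ψ, k, j, g, ⟨⟨⟨⟨⟨⟨h1, h2⟩, h3⟩, h4⟩, h5⟩, h6⟩, h7⟩, h8⟩
        exact ⟨m, pr 9 (pr ψ χ), k, j, g, ⟨⟨⟨⟨⟨⟨isForm_or.2 ⟨h1, hχform m⟩, h2⟩,
          isStar_or.2 ⟨ψ, χ, h3, isStar_lt.2 rfl, rfl⟩⟩,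
          isDepth_or.2 ⟨k, 0, h4, isDepth_lt.2 rfl, Or.inl ⟨zero_le, rfl⟩⟩⟩, (hstart j).1 h5⟩, h6⟩,
          (hfirst h5).1 h7⟩, sat_or_one.2 (Or.inl h8)⟩
      · rintro ⟨m, ψ, k, j, g, ⟨⟨⟨⟨⟨⟨h1, h2⟩, h3⟩, h4⟩, h5⟩, h6⟩, h7⟩, h8⟩
        obtain ⟨ψ, χ', h9, h10, rfl⟩ := isStar_or.1 h3
        obtain rfl := isStar_lt.1 h10
        obtain ⟨l, l', h11, h12, h13⟩ := isDepth_or.1 h4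
        obtain rfl := isDepth_lt.1 h12
        have hk : k = l := by
          rcases h13 with h | ⟨h, rfl⟩
          · exact h.2
          · exact le_antisymm zero_le h
        subst hk
        have h5' := (hstart j).2 h5
        exact ⟨m, ψ, k, j, g, ⟨⟨⟨⟨⟨⟨(isForm_or.1 h1).1, h2⟩, h9⟩, h11⟩, h5'⟩, h6⟩,
          (hfirst h5').2 h7⟩, (sat_or_one.1 h8).resolve_right not_sat_lt_zero⟩
    have hor : ∀ m, IsForm m φ → IsTup m a → (Sigma' I (pr 9 (pr φ χ)) a ↔ Sigma' I φ a) := by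
      intro m hm ha
      obtain ⟨⟨⟨h1, -⟩, h2⟩, -⟩ := hαT m a ha
      rw [h2 φ χ ⟨hm, hχform m⟩, (h1 t (pr 2 0) ⟨ht m, isTermIn_zero⟩).2, or_iff_left]
      rintro ⟨x, y, ⟨-, hy⟩, hxy⟩
      rw [val_zero.1 hy] at hxy
      exact not_lt_zero hxy
    constructor
    · intro h
      obtain ⟨m, -, -, -, -, ⟨⟨⟨⟨⟨⟨h1, h2⟩, -⟩, -⟩, -⟩, -⟩, -⟩, -⟩ := id h
      exact (hor m h1 h2).1 (hpadded.1 h)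
    · intro h
      obtain ⟨m, -, -, -, -, ⟨⟨⟨⟨⟨⟨h1, h2⟩, -⟩, -⟩, -⟩, -⟩, -⟩, -⟩ := id h
      exact hpadded.2 ((hor m h1 h2).2 h)
  · unfold Sigma'
    refine exists_congr fun m => exists_congr fun ψ => exists_congr fun k => exists_congr fun j =>
      exists_congr fun g => and_congr_left fun _ => ?_
    rw [start_diff_iff_of_not_below hb]
    exact and_congr_right fun h => first_diff_iff (hmin _ h.1.2.1.1)

theorem model_alpha_diff (hPAI : Expansion M I ⊨ PAI) (hα : Expansion M I ⊨ alpha) (hi₀ : i₀ ∈ I)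
    (hmin : ∀ x ∈ I, i₀ ≤ x) : Expansion M (I \ {i₀}) ⊨ alpha := by
  rw [model_alpha]
  have h : Sigma' (I \ {i₀}) = Sigma' I :=
    funext fun φ => funext fun a => propext (sigma_diff_iff hPAI hα hi₀ hmin φ a)
  rw [h]
  exact model_alpha.1 hα

end Alpha

/-! ## Failure of solidity -/

theorem exists_expansion_eq {M : Type u} (S : LAI.Structure M) :
    ∃ (_ : LA.Structure M) (I : Set M), S = (inferInstance : LAI.Structure (Expansion M I)) := by
  refine ⟨(LHom.sumInl : LA →ᴸ LAI).reduct M,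
    {x | Structure.RelMap (L := LAI) (Sum.inr IndRel.mem : LAI.Relations 1) ![x]}, ?_⟩
  refine Structure.ext (funext fun n => funext fun f => ?_) (funext fun n => funext fun R => ?_)
  · rcases f with f | f
    · rfl
    · exact f.elim
  · rcases R with R | R
    · rfl
    · cases R
      funext x
      refine congrArg (Structure.RelMap (L := LAI) (M := M) (Sum.inr IndRel.mem)) (funext fun i => ?_)
      fin_cases i
      rfl

theorem not_solidAt_of_diff {M : Type u} [LA.Structure M] {I : Set M} {U : LAI.Theory}
    [Nonempty (Expansion M I)] [hM : Expansion M I ⊨ U] (hPA : Expansion M I ⊨ PAofI) {i₀ : M}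
    (hi₀ : i₀ ∈ I) (hU : Expansion M (I \ {i₀}) ⊨ U) :
    ¬ SolidAt U (Theory.ModelType.of U (Expansion M I)) := by
  intro h
  obtain ⟨_, _, _, _, _⟩ := PAofI.isPeano hPA
  have : Nonempty (Expansion M (I \ {i₀})) := ⟨i₀⟩
  have hid : DefinableMap LAI (Expansion M I) (fun x => x) := definable_iff_defIn.2
    ⟨Term.equal (Term.var (Sum.inr 1)) (Term.var (Sum.inr 0)),
      fun e => Formula.realize_equal (M := Expansion M I)⟩
  obtain ⟨f, hf⟩ := h (Theory.ModelType.of U (Expansion M (I \ {i₀})))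
    (Theory.ModelType.of U (Expansion M I)) (id : M → M) (id : M → M)
    (isInterpretation_id (M := M) (defIn_diff_singleton I i₀))
    (isInterpretation_id (M := M) (defIn_of_diff_singleton hi₀))
    ⟨FirstOrder.Language.Equiv.refl LAI _, hid⟩
  have h1 := PAofI.eq_of_definable_iso hPA (J := I \ {i₀}) f hf
  rw [h1] at hi₀
  exact hi₀.2 rfl

theorem nowhereSolid {U : LAI.Theory} (hU : U ∈ ({PAICirc, PAI, PAIalpha} : Set LAI.Theory)) :
    NowhereSolid.{u} U := by
  rintro @⟨M, S, hM, hne⟩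
  obtain ⟨_, I, rfl⟩ := exists_expansion_eq S
  have hsub : PAofI ∪ {Ubd} ⊆ U := by
    rcases hU with rfl | rfl | rfl
    · exact Set.subset_union_left
    · exact Set.subset_union_left
    · exact Set.subset_union_left.trans Set.subset_union_left
  have hM' : Expansion M I ⊨ U := hM
  have hPA : Expansion M I ⊨ PAofI := hM'.mono (Set.subset_union_left.trans hsub)
  obtain ⟨_, _, _, _, _⟩ := PAofI.isPeano hPA
  have hub : ∀ x : M, ∃ y ∈ I, x < y :=
    model_Ubd.1 ((Theory.model_iff _).1 hM' _ (hsub (Or.inr rfl)))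
  obtain ⟨i₀, hi₀, hmin⟩ := PAofI.exists_least hPA ((hub 0).imp fun _ h => h.1)
  have hub' : ∀ x : M, ∃ y ∈ I \ {i₀}, x < y := by
    intro x
    obtain ⟨y, hy, hxy⟩ := hub (x + i₀)
    exact ⟨y, ⟨hy, (le_add_self.trans_lt hxy).ne'⟩, le_self_add.trans_lt hxy⟩
  have hdef := defIn_diff_singleton I i₀
  have : Nonempty (Expansion M I) := hne
  refine not_solidAt_of_diff (hM := hM') hPA hi₀ ?_
  rcases hU with rfl | rfl | rfl
  · exact model_PAICirc_of_subset hM' hdef Set.sdiff_subset hub'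
  · exact model_PAI_of_subset hM' hdef Set.sdiff_subset hub'
  · have h1 : Expansion M I ⊨ PAI := hM'.mono Set.subset_union_left
    exact Theory.model_union_iff.2 ⟨model_PAI_of_subset h1 hdef Set.sdiff_subset hub',
      Theory.model_singleton_iff.2 (model_alpha_diff h1
        ((Theory.model_iff _).1 hM' _ (Or.inr rfl)) hi₀ hmin)⟩

/-! ## Sparse homogeneous sets of natural numbers -/

section Ramsey

open Filter

theorem exists_diagonal_set (R : List ℕ → ℕ → Prop)
    (hR : ∀ l, ∀ᶠ x in (hyperfilter ℕ : Filter ℕ), R l x) :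
    ∃ I : Set ℕ, (∀ m, ∃ x ∈ I, m < x) ∧ ∀ l x, l.Pairwise (· < ·) → (∀ y ∈ l, y ∈ I) → x ∈ I →
      (∀ y ∈ l, y < x) → R l x := by
  classical
  have hnext : ∀ s : List ℕ, ∃ x, (∀ y ∈ s, y < x) ∧ ∀ l, l.Sublist s → R l x := by
    intro s
    have h1 : ∀ᶠ x in (hyperfilter ℕ : Filter ℕ), ∀ y ∈ s.toFinset, y < x :=
      (eventually_all_finset _).2 fun y _ => (eventually_gt_atTop y).filter_mono
        Nat.hyperfilter_le_atTop
    have h2 : ∀ᶠ x in (hyperfilter ℕ : Filter ℕ), ∀ l ∈ s.sublists.toFinset, R l x :=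
      (eventually_all_finset _).2 fun l _ => hR l
    obtain ⟨x, hx1, hx2⟩ := (h1.and h2).exists
    exact ⟨x, fun y hy => hx1 y (List.mem_toFinset.2 hy),
      fun l hl => hx2 l (List.mem_toFinset.2 (List.mem_sublists.2 hl))⟩
  choose next hlt hnextR using hnext
  let seq : ℕ → List ℕ := fun k => Nat.rec [] (fun _ s => s ++ [next s]) k
  have hseq : ∀ k, seq (k + 1) = seq k ++ [next (seq k)] := fun k => rfl
  have hsorted : ∀ k, (seq k).Pairwise (· < ·) := by
    intro k
    induction k with
    | zero => exact List.Pairwise.nil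
    | succ k ih =>
      rw [hseq, List.pairwise_append]
      refine ⟨ih, List.pairwise_singleton _ _, fun a ha b hb => ?_⟩
      rw [List.mem_singleton.1 hb]
      exact hlt _ a ha
  have hmono : ∀ {k m}, k ≤ m → ∀ x ∈ seq k, x ∈ seq m := by
    intro k m hkm
    induction m, hkm using Nat.le_induction with
    | base => exact fun x hx => hx
    | succ m _ ih =>
      intro x hx
      rw [hseq]
      exact List.mem_append_left _ (ih x hx)
  have hnew : ∀ k, next (seq k) ∈ seq (k + 1) := by
    intro k
    rw [hseq]
    exact List.mem_append_right _ (List.mem_singleton.2 rfl)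
  have hincr : ∀ {k m}, k < m → next (seq k) < next (seq m) := fun hkm =>
    hlt _ _ (hmono hkm _ (hnew _))
  have hmem : ∀ k, ∀ x ∈ seq k, ∃ m, m < k ∧ x = next (seq m) := by
    intro k
    induction k with
    | zero => exact fun x hx => absurd hx List.not_mem_nil
    | succ k ih =>
      intro x hx
      rw [hseq, List.mem_append, List.mem_singleton] at hx
      rcases hx with hx | hx
      · obtain ⟨m, hm, rfl⟩ := ih x hx
        exact ⟨m, hm.trans (Nat.lt_succ_self k), rfl⟩
      · exact ⟨k, Nat.lt_succ_self k, hx⟩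
  refine ⟨Set.range fun k => next (seq k), fun m => ?_, ?_⟩
  · have hsm : StrictMono fun k => next (seq k) := fun a b h => hincr h
    exact ⟨_, ⟨m + 1, rfl⟩, (Nat.lt_succ_self m).trans_le (hsm.le_apply (x := m + 1))⟩
  · rintro l _ hl hlI ⟨k, rfl⟩ hlx
    refine hnextR _ l (List.sublist_of_subperm_of_pairwise (List.subperm_of_subset
      (hl.imp fun h => h.ne) fun y hy => ?_) hl (hsorted k))
    obtain ⟨m, rfl⟩ := hlI y hy
    refine hmono (k := m + 1) ?_ _ (hnew m)
    by_contra hc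
    rcases (Nat.lt_succ_iff.1 (not_le.1 hc)).eq_or_lt with rfl | h
    · exact lt_irrefl _ (hlx _ hy)
    · exact lt_asymm (hlx _ hy) (hincr h)

/-- The iterated limit of a property of `n`-element lists along a nonprincipal ultrafilter. -/
def iterLim : ℕ → (List ℕ → Prop) → Prop
  | 0, p => p []
  | n + 1, p => ∀ᶠ x in (hyperfilter ℕ : Filter ℕ), iterLim n fun l => p (x :: l)

theorem eventually_iterLim_iff {n : ℕ} (p : List ℕ → Prop) {l : List ℕ} (hl : l.length < n) :
    ∀ᶠ x in (hyperfilter ℕ : Filter ℕ),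
      (iterLim (n - (l ++ [x]).length) (fun l' => p ((l ++ [x]) ++ l')) ↔
        iterLim (n - l.length) fun l' => p (l ++ l')) := by
  obtain ⟨k, hk⟩ : ∃ k, n - l.length = k + 1 := ⟨n - l.length - 1, by omega⟩
  have hk' : ∀ x, n - (l ++ [x]).length = k := fun x => by
    rw [List.length_append, List.length_singleton]
    omega
  simp only [hk, hk', List.append_assoc, List.singleton_append, iterLim]
  by_cases h : ∀ᶠ x in (hyperfilter ℕ : Filter ℕ), iterLim k fun l' => p (l ++ x :: l')
  · filter_upwards [h] with x hx
    exact iff_of_true hx h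
  · filter_upwards [Ultrafilter.eventually_not.2 h] with x hx
    exact iff_of_false hx h

theorem exists_sparse_homogeneous {ι : Type*} [Finite ι] (n : ι → ℕ) (p : ι → List ℕ → Prop)
    (F : ℕ → ℕ) :
    ∃ I : Set ℕ, (∀ m, ∃ x ∈ I, m < x) ∧ (∀ i ∈ I, ∀ j ∈ I, i < j → F i ≤ j) ∧
      ∀ k l l', l.Pairwise (· < ·) → (∀ y ∈ l, y ∈ I) → l.length = n k →
        l'.Pairwise (· < ·) → (∀ y ∈ l', y ∈ I) → l'.length = n k → (p k l ↔ p k l') := by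
  let Q : ι → List ℕ → Prop := fun k l => iterLim (n k - l.length) fun l' => p k (l ++ l')
  obtain ⟨I, hI, hR⟩ := exists_diagonal_set
    (fun l x => (∀ k, l.length < n k → (Q k (l ++ [x]) ↔ Q k l)) ∧ ∀ i ∈ l, F i ≤ x) (by
      intro l
      refine Eventually.and (eventually_all.2 fun k => ?_) ?_
      · by_cases h : l.length < n k
        · filter_upwards [eventually_iterLim_iff (p k) h] with x hx _
          exact hx
        · exact Eventually.of_forall fun x h' => absurd h' h
      · have := (eventually_all_finset l.toFinset).2 fun i _ =>
          (eventually_ge_atTop (F i)).filter_mono Nat.hyperfilter_le_atTop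
        filter_upwards [this] with x hx i hi
        exact hx i (List.mem_toFinset.2 hi))
  have key : ∀ k l, l.Pairwise (· < ·) → (∀ y ∈ l, y ∈ I) → l.length ≤ n k →
      (Q k l ↔ Q k []) := by
    intro k l
    induction l using List.reverseRecOn with
    | nil => exact fun _ _ _ => Iff.rfl
    | append_singleton l x ih =>
      intro h1 h2 h3
      rw [List.pairwise_append] at h1
      rw [List.length_append, List.length_singleton] at h3
      have h4 : ∀ y ∈ l, y ∈ I := fun y hy => h2 y (List.mem_append_left _ hy)
      rw [(hR l x h1.1 h4 (h2 x (by simp)) fun y hy => h1.2.2 y hy x (by simp)).1 k h3]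
      exact ih h1.1 h4 (Nat.le_of_succ_le h3)
  have key' : ∀ k l, l.Pairwise (· < ·) → (∀ y ∈ l, y ∈ I) → l.length = n k →
      (p k l ↔ Q k []) := by
    intro k l h1 h2 h3
    rw [← key k l h1 h2 h3.le]
    simp [Q, h3, iterLim]
  refine ⟨I, hI, fun i hi j hj hij => ?_, fun k l l' h1 h2 h3 h4 h5 h6 => ?_⟩
  · exact (hR [i] j (List.pairwise_singleton _ _) (by simpa using hi) hj (by simpa using hij)).2 i
      (by simp)
  · rw [key' k l h1 h2 h3, key' k l' h4 h5 h6]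

end Ramsey

/-! ## Truth in the standard model -/

/-- The standard model of arithmetic. -/
instance natStructure : LA.Structure ℕ where
  funMap := fun {_} f => match f with
    | ArithFunc.zero => fun _ => 0
    | ArithFunc.succ => fun x => x 0 + 1
    | ArithFunc.add => fun x => x 0 + x 1
    | ArithFunc.mul => fun x => x 0 * x 1
  RelMap := fun {_} R => match R with
    | ArithRel.lt => fun x => x 0 < x 1

instance : PeanoModel ℕ where
  funMap_zero _ := rfl
  funMap_succ _ := rfl
  funMap_add _ := rfl
  funMap_mul _ := rfl
  relMap_lt _ := Iff.rfl
  add_one_le_of_lt h := h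
  ind _ _ h0 hs x := Nat.rec h0 hs x

/-! ### Terms and formulas with de Bruijn indices -/

/-- Terms of arithmetic. -/
inductive PTerm
  | var (i : ℕ)
  | zero
  | succ (t : PTerm)
  | add (t s : PTerm)
  | mul (t s : PTerm)

/-- Formulas of arithmetic, with de Bruijn indices. -/
inductive PForm
  | eq (t s : PTerm)
  | lt (t s : PTerm)
  | neg (φ : PForm)
  | or (φ ψ : PForm)
  | ex (φ : PForm)

/-- The evaluation that maps the index `0` to `y` and `k + 1` to `e k`. -/
def consEnv (y : ℕ) (e : ℕ → ℕ) : ℕ → ℕ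
  | 0 => y
  | k + 1 => e k

namespace PTerm

/-- Gödel number of a term. -/
def code : PTerm → ℕ
  | var i => pr 0 i
  | zero => pr 2 0
  | succ t => pr 3 t.code
  | add t s => pr 4 (pr t.code s.code)
  | mul t s => pr 5 (pr t.code s.code)

/-- All variables have index below `m`. -/
def VarsLt (m : ℕ) : PTerm → Prop
  | var i => i < m
  | zero => True
  | succ t => t.VarsLt m
  | add t s => t.VarsLt m ∧ s.VarsLt m
  | mul t s => t.VarsLt m ∧ s.VarsLt m

/-- The value of a term. -/
def eval (e : ℕ → ℕ) : PTerm → ℕ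
  | var i => e i
  | zero => 0
  | succ t => t.eval e + 1
  | add t s => t.eval e + s.eval e
  | mul t s => t.eval e * s.eval e

theorem code_injective : Function.Injective code := by
  intro t
  induction t with
  | var i => rintro (_ | _ | _ | _ | _) <;> simp [code]
  | zero => rintro (_ | _ | _ | _ | _) <;> simp [code]
  | succ t ih =>
    rintro (_ | _ | _ | _ | _) <;> simp [code]
    exact fun h => ih h
  | add t s ih ih' =>
    rintro (_ | _ | _ | _ | _) <;> simp [code]
    exact fun h h' => ⟨ih h, ih' h'⟩
  | mul t s ih ih' =>
    rintro (_ | _ | _ | _ | _) <;> simp [code]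
    exact fun h h' => ⟨ih h, ih' h'⟩

theorem VarsLt.mono {m n : ℕ} (h : m ≤ n) : ∀ {t : PTerm}, t.VarsLt m → t.VarsLt n
  | var _, ht => lt_of_lt_of_le ht h
  | zero, _ => trivial
  | succ t, ht => VarsLt.mono h (t := t) ht
  | add t s, ht => ⟨VarsLt.mono h (t := t) ht.1, VarsLt.mono h (t := s) ht.2⟩
  | mul t s, ht => ⟨VarsLt.mono h (t := t) ht.1, VarsLt.mono h (t := s) ht.2⟩

theorem exists_varsLt (t : PTerm) : ∃ m, t.VarsLt m := by
  induction t with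
  | var i => exact ⟨i + 1, Nat.lt_succ_self i⟩
  | zero => exact ⟨0, trivial⟩
  | succ t ih => exact ih
  | add t s ih ih' =>
    obtain ⟨m, hm⟩ := ih
    obtain ⟨n, hn⟩ := ih'
    exact ⟨max m n, hm.mono (le_max_left _ _), hn.mono (le_max_right _ _)⟩
  | mul t s ih ih' =>
    obtain ⟨m, hm⟩ := ih
    obtain ⟨n, hn⟩ := ih'
    exact ⟨max m n, hm.mono (le_max_left _ _), hn.mono (le_max_right _ _)⟩

theorem eval_congr {m : ℕ} {e e' : ℕ → ℕ} (he : ∀ k < m, e k = e' k) {t : PTerm}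
    (ht : t.VarsLt m) : t.eval e = t.eval e' := by
  induction t with
  | var i => exact he i ht
  | zero => rfl
  | succ t ih => rw [eval, eval, ih ht]
  | add t s ih ih' => rw [eval, eval, ih ht.1, ih' ht.2]
  | mul t s ih ih' => rw [eval, eval, ih ht.1, ih' ht.2]

theorem isTermIn_code {m : ℕ} (t : PTerm) : IsTermIn 0 m 0 t.code ↔ t.VarsLt m := by
  induction t with
  | var i =>
    rw [isTermIn_iff]
    simp [TermStep, code, VarsLt]
  | zero => exact iff_of_true isTermIn_zero trivial
  | succ t ih => exact isTermIn_succ.trans ih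
  | add t s ih ih' =>
    rw [isTermIn_iff]
    simp [TermStep, code, VarsLt, ih, ih']
  | mul t s ih ih' =>
    rw [isTermIn_iff]
    simp [TermStep, code, VarsLt, ih, ih']

end PTerm

theorem lt_pr_of_pos {a b : ℕ} (ha : 0 < a) : b < pr a b := by
  unfold pr
  nlinarith

theorem exists_pterm {m : ℕ} (t : ℕ) (h : IsTermIn 0 m 0 t) : ∃ T : PTerm, T.code = t := by
  induction t using Nat.strong_induction_on with
  | _ t ih =>
    rcases (isTermIn_iff _ _ _ _).1 h with ⟨i, -, rfl⟩ | ⟨i, hi, -⟩ | rfl | ⟨t, ht, rfl⟩ |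
      ⟨t, s, ⟨ht, hs⟩, h⟩
    · exact ⟨.var i, rfl⟩
    · exact absurd hi (Nat.not_lt_zero i)
    · exact ⟨.zero, rfl⟩
    · obtain ⟨T, rfl⟩ := ih t (lt_pr_of_pos (by norm_num)) ht
      exact ⟨.succ T, rfl⟩
    · rcases h with rfl | rfl
      · obtain ⟨T, rfl⟩ := ih t ((le_pr_left _ _).trans_lt (lt_pr_of_pos (by norm_num))) ht
        obtain ⟨S, rfl⟩ := ih s ((le_pr_right _ _).trans_lt (lt_pr_of_pos (by norm_num))) hs
        exact ⟨.add T S, rfl⟩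
      · obtain ⟨T, rfl⟩ := ih t ((le_pr_left _ _).trans_lt (lt_pr_of_pos (by norm_num))) ht
        obtain ⟨S, rfl⟩ := ih s ((le_pr_right _ _).trans_lt (lt_pr_of_pos (by norm_num))) hs
        exact ⟨.mul T S, rfl⟩

namespace PForm

/-- Gödel number of a formula. -/
def code : PForm → ℕ
  | eq t s => pr 6 (pr t.code s.code)
  | lt t s => pr 7 (pr t.code s.code)
  | neg φ => pr 8 φ.code
  | or φ ψ => pr 9 (pr φ.code ψ.code)
  | ex φ => pr 10 φ.code

/-- All free variables have index below `m`. -/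
def VarsLt : ℕ → PForm → Prop
  | m, eq t s => t.VarsLt m ∧ s.VarsLt m
  | m, lt t s => t.VarsLt m ∧ s.VarsLt m
  | m, neg φ => φ.VarsLt m
  | m, or φ ψ => φ.VarsLt m ∧ ψ.VarsLt m
  | m, ex φ => φ.VarsLt (m + 1)

/-- Truth of a formula in the standard model. -/
def Holds : (ℕ → ℕ) → PForm → Prop
  | e, eq t s => t.eval e = s.eval e
  | e, lt t s => t.eval e < s.eval e
  | e, neg φ => ¬ φ.Holds e
  | e, or φ ψ => φ.Holds e ∨ ψ.Holds e
  | e, ex φ => ∃ y, φ.Holds (consEnv y e)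

/-- Quantifier depth. -/
def depth : PForm → ℕ
  | eq _ _ => 0
  | lt _ _ => 0
  | neg φ => φ.depth
  | or φ ψ => max φ.depth ψ.depth
  | ex φ => φ.depth + 1

/-- The Gödel number of the formula with quantifiers bounded by `z_s, z_{s+1}, …`. -/
def star : ℕ → PForm → ℕ
  | _, eq t s => pr 6 (pr t.code s.code)
  | _, lt t s => pr 7 (pr t.code s.code)
  | s, neg φ => pr 8 (φ.star s)
  | s, or φ ψ => pr 9 (pr (φ.star s) (ψ.star s))
  | s, ex φ => pr 10 (pr 8 (pr 9 (pr (pr 8 (pr 7 (pr (pr 0 0) (pr 1 s)))) (pr 8 (φ.star (s + 1))))))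

theorem code_injective : Function.Injective code := by
  intro φ
  induction φ with
  | eq t s =>
    rintro (_ | _ | _ | _ | _) <;> simp [code]
    exact fun h h' => ⟨PTerm.code_injective h, PTerm.code_injective h'⟩
  | lt t s =>
    rintro (_ | _ | _ | _ | _) <;> simp [code]
    exact fun h h' => ⟨PTerm.code_injective h, PTerm.code_injective h'⟩
  | neg φ ih =>
    rintro (_ | _ | _ | _ | _) <;> simp [code]
    exact fun h => ih h
  | or φ ψ ih ih' =>
    rintro (_ | _ | _ | _ | _) <;> simp [code]
    exact fun h h' => ⟨ih h, ih' h'⟩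
  | ex φ ih =>
    rintro (_ | _ | _ | _ | _) <;> simp [code]
    exact fun h => ih h

theorem VarsLt.mono {φ : PForm} : ∀ {m n : ℕ}, m ≤ n → φ.VarsLt m → φ.VarsLt n := by
  induction φ with
  | eq t s => exact fun h h' => ⟨h'.1.mono h, h'.2.mono h⟩
  | lt t s => exact fun h h' => ⟨h'.1.mono h, h'.2.mono h⟩
  | neg φ ih => exact fun h h' => ih h h'
  | or φ ψ ih ih' => exact fun h h' => ⟨ih h h'.1, ih' h h'.2⟩
  | ex φ ih => exact fun h h' => ih (Nat.succ_le_succ h) h'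

theorem exists_varsLt (φ : PForm) : ∃ m, φ.VarsLt m := by
  induction φ with
  | eq t s =>
    obtain ⟨m, hm⟩ := t.exists_varsLt
    obtain ⟨n, hn⟩ := s.exists_varsLt
    exact ⟨max m n, hm.mono (le_max_left _ _), hn.mono (le_max_right _ _)⟩
  | lt t s =>
    obtain ⟨m, hm⟩ := t.exists_varsLt
    obtain ⟨n, hn⟩ := s.exists_varsLt
    exact ⟨max m n, hm.mono (le_max_left _ _), hn.mono (le_max_right _ _)⟩
  | neg φ ih => exact ih
  | or φ ψ ih ih' =>
    obtain ⟨m, hm⟩ := ih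
    obtain ⟨n, hn⟩ := ih'
    exact ⟨max m n, hm.mono (le_max_left _ _), hn.mono (le_max_right _ _)⟩
  | ex φ ih =>
    obtain ⟨m, hm⟩ := ih
    exact ⟨m, VarsLt.mono (φ := φ) (Nat.le_succ m) hm⟩

theorem holds_congr {φ : PForm} : ∀ {m : ℕ} {e e' : ℕ → ℕ}, (∀ k < m, e k = e' k) →
    φ.VarsLt m → (φ.Holds e ↔ φ.Holds e') := by
  induction φ with
  | eq t s =>
    intro m e e' he h
    rw [Holds, Holds, PTerm.eval_congr he h.1, PTerm.eval_congr he h.2]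
  | lt t s =>
    intro m e e' he h
    rw [Holds, Holds, PTerm.eval_congr he h.1, PTerm.eval_congr he h.2]
  | neg φ ih => exact fun he h => not_congr (ih he h)
  | or φ ψ ih ih' => exact fun he h => or_congr (ih he h.1) (ih' he h.2)
  | ex φ ih =>
    intro m e e' he h
    refine exists_congr fun y => ih (m := m + 1) (fun k hk => ?_) h
    cases k with
    | zero => rfl
    | succ k => exact he k (Nat.lt_of_succ_lt_succ hk)

/-- Witnesses for `∃ y, φ` at evaluations with values below `h` can be found below some bound. -/
theorem exists_witness_bound (φ : PForm) (h : ℕ) : ∃ B, ∀ e : ℕ → ℕ, (∀ k, e k < h) →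
    (∃ y, φ.Holds (consEnv y e)) → ∃ y < B, φ.Holds (consEnv y e) := by
  classical
  obtain ⟨m, hm⟩ := φ.exists_varsLt
  let ext : (Fin m → Fin h) → ℕ → ℕ := fun f k => if hk : k < m then f ⟨k, hk⟩ else 0
  have h1 : ∀ f : Fin m → Fin h, ∃ B, (∃ y, φ.Holds (consEnv y (ext f))) →
      ∃ y < B, φ.Holds (consEnv y (ext f)) := by
    intro f
    by_cases hf : ∃ y, φ.Holds (consEnv y (ext f))
    · obtain ⟨y, hy⟩ := hf
      exact ⟨y + 1, fun _ => ⟨y, Nat.lt_succ_self y, hy⟩⟩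
    · exact ⟨0, fun hf' => absurd hf' hf⟩
  choose B hB using h1
  refine ⟨Finset.univ.sup B, fun e he hy => ?_⟩
  let f : Fin m → Fin h := fun k => ⟨e k, he k⟩
  have h2 : ∀ y, φ.Holds (consEnv y e) ↔ φ.Holds (consEnv y (ext f)) := by
    intro y
    refine holds_congr (m := m + 1) (fun k hk => ?_) (hm.mono (Nat.le_succ m))
    cases k with
    | zero => rfl
    | succ k => simp [consEnv, ext, f, Nat.lt_of_succ_lt_succ hk]
  simp only [h2] at hy ⊢
  obtain ⟨y, hyB, hy⟩ := hB f hy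
  exact ⟨y, hyB.trans_le (Finset.le_sup (Finset.mem_univ f)), hy⟩

theorem exists_witness_function : ∃ F : ℕ → ℕ, ∀ (h : ℕ) (φ : PForm), φ.code < h →
    ∀ e : ℕ → ℕ, (∀ k, e k < h) → (∃ y, φ.Holds (consEnv y e)) →
      ∃ y < F h, φ.Holds (consEnv y e) := by
  choose B hB using exists_witness_bound
  have h1 : ∀ h : ℕ, BddAbove ((fun φ => B φ h) '' {φ : PForm | φ.code < h}) := fun h =>
    (Set.Finite.image _ ((Set.finite_Iio h).preimage code_injective.injOn)).bddAbove
  choose F hF using h1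
  refine ⟨F, fun h φ hφ e he hy => ?_⟩
  obtain ⟨y, hyB, hy⟩ := hB φ h e he hy
  exact ⟨y, hyB.trans_le (hF h ⟨φ, hφ, rfl⟩), hy⟩

theorem isForm_code (φ : PForm) : ∀ {m : ℕ}, IsForm m φ.code ↔ φ.VarsLt m := by
  induction φ with
  | eq t s =>
    intro m
    rw [isForm_iff]
    simp [FormStep, code, VarsLt, PTerm.isTermIn_code]
  | lt t s =>
    intro m
    rw [isForm_iff]
    simp [FormStep, code, VarsLt, PTerm.isTermIn_code]
  | neg φ ih =>
    intro m
    rw [isForm_iff, VarsLt, ← ih]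
    simp [FormStep, code, IsForm]
  | or φ ψ ih ih' =>
    intro m
    rw [isForm_iff, VarsLt, ← ih, ← ih']
    simp [FormStep, code, IsForm]
  | ex φ ih =>
    intro m
    rw [isForm_iff, VarsLt, ← ih]
    simp [FormStep, code, IsForm]

theorem isStar_code (φ : PForm) : ∀ {s ψ : ℕ}, IsStar s φ.code ψ ↔ ψ = φ.star s := by
  induction φ with
  | eq t u =>
    intro s ψ
    rw [isStar_iff]
    simp [StarStep, code, star]
  | lt t u =>
    intro s ψ
    rw [isStar_iff]
    simp [StarStep, code, star]
  | neg φ ih =>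
    intro s ψ
    unfold IsStar at ih
    rw [isStar_iff]
    simp [StarStep, code, star, ih]
  | or φ ψ ih ih' =>
    intro s χ
    rw [code, isStar_or]
    simp [star, ih, ih']
  | ex φ ih =>
    intro s ψ
    unfold IsStar at ih
    rw [isStar_iff]
    simp [StarStep, code, star, ih]

theorem isDepth_code (φ : PForm) : ∀ {k : ℕ}, IsDepth φ.code k ↔ k = φ.depth := by
  induction φ with
  | eq t u =>
    intro k
    rw [isDepth_iff]
    simp [DepthStep, code, depth]
  | lt t u =>
    intro k
    rw [isDepth_iff]
    simp [DepthStep, code, depth]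
  | neg φ ih =>
    intro k
    unfold IsDepth at ih
    rw [isDepth_iff]
    simp [DepthStep, code, depth, ih]
  | or φ ψ ih ih' =>
    intro k
    rw [code, isDepth_or]
    simp only [ih, ih', exists_and_left, exists_eq_left, depth]
    omega
  | ex φ ih =>
    intro k
    unfold IsDepth at ih
    rw [isDepth_iff]
    simp [DepthStep, code, depth, ih]

end PForm

theorem exists_pform (φ : ℕ) : ∀ {m : ℕ}, IsForm m φ → ∃ P : PForm, P.code = φ := by
  induction φ using Nat.strong_induction_on with
  | _ φ ih =>
    intro m h
    obtain ⟨m', p, q, ⟨⟨hp, hq⟩, h⟩ | ⟨hp, h⟩ | ⟨⟨hp, hq⟩, h⟩ | ⟨hp, h⟩⟩ := (isForm_iff _ _).1 h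
    · obtain ⟨T, rfl⟩ := exists_pterm p hp
      obtain ⟨S, rfl⟩ := exists_pterm q hq
      rcases h with h | h
      · exact ⟨.eq T S, (pr_inj.1 h).2.symm⟩
      · exact ⟨.lt T S, (pr_inj.1 h).2.symm⟩
    · obtain ⟨rfl, rfl⟩ := pr_inj.1 h
      obtain ⟨P, rfl⟩ := ih p (lt_pr_of_pos (by norm_num)) hp
      exact ⟨.neg P, rfl⟩
    · obtain ⟨rfl, rfl⟩ := pr_inj.1 h
      obtain ⟨P, rfl⟩ := ih p ((le_pr_left _ _).trans_lt (lt_pr_of_pos (by norm_num))) hp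
      obtain ⟨Q, rfl⟩ := ih q ((le_pr_right _ _).trans_lt (lt_pr_of_pos (by norm_num))) hq
      exact ⟨.or P Q, rfl⟩
    · obtain ⟨rfl, rfl⟩ := pr_inj.1 h
      obtain ⟨P, rfl⟩ := ih p (lt_pr_of_pos (by norm_num)) hp
      exact ⟨.ex P, rfl⟩

/-! ### Tuples of natural numbers -/

/-- The code of a finite sequence. -/
def codeL : List ℕ → ℕ
  | [] => 0
  | b :: l => pr b (codeL l) + 1

theorem codeL_injective : Function.Injective codeL := by
  intro l
  induction l with
  | nil => rintro (_ | ⟨b, l⟩) <;> simp [codeL]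
  | cons b l ih =>
    rintro (_ | ⟨c, l'⟩) <;> simp [codeL]
    exact fun h h' => ⟨h, ih h'⟩

theorem isTup_nat {m a : ℕ} : IsTup m a ↔ ∃ l : List ℕ, l.length = m ∧ a = codeL l := by
  constructor
  · intro h
    induction m generalizing a with
    | zero =>
      rcases (isTup_iff _ _).1 h with ⟨-, rfl⟩ | ⟨m', a', b, -, hm, -⟩
      · exact ⟨[], rfl, rfl⟩
      · omega
    | succ m ih =>
      rcases (isTup_iff _ _).1 h with ⟨hm, -⟩ | ⟨m', a', b, h', hm, rfl⟩
      · omega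
      · obtain rfl : m = m' := by omega
        obtain ⟨l, rfl, rfl⟩ := ih h'
        exact ⟨b :: l, rfl, rfl⟩
  · rintro ⟨l, rfl, rfl⟩
    induction l with
    | nil => exact (isTup_iff _ _).2 (Or.inl ⟨rfl, rfl⟩)
    | cons b l ih => exact (isTup_iff _ _).2 (Or.inr ⟨_, _, b, ih, rfl, rfl⟩)

theorem isTup_codeL {m : ℕ} {l : List ℕ} : IsTup m (codeL l) ↔ l.length = m := by
  rw [isTup_nat]
  refine ⟨fun ⟨l', h, h'⟩ => ?_, fun h => ⟨l, h, rfl⟩⟩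
  rw [codeL_injective h', h]

theorem entry_codeL {l : List ℕ} {i x : ℕ} : Entry (codeL l) i x ↔ l[i]? = some x := by
  induction l generalizing i with
  | nil =>
    rw [entry_iff]
    simp [codeL]
  | cons b l ih =>
    rw [entry_iff]
    cases i with
    | zero => simp [codeL, eq_comm]
    | succ i => simp [codeL, ← ih]

/-- The evaluation given by a finite sequence. -/
def envL (l : List ℕ) : ℕ → ℕ := fun i => l.getD i 0

theorem envL_cons (z : ℕ) (l : List ℕ) : envL (z :: l) = consEnv z (envL l) := by
  funext i
  cases i <;> simp [envL, consEnv]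

theorem envL_lt {l : List ℕ} {h : ℕ} (h0 : 0 < h) (hl : ∀ x ∈ l, x < h) (k : ℕ) :
    envL l k < h := by
  by_cases hk : k < l.length
  · simp [envL, hk, hl]
  · simpa [envL, hk] using h0

theorem val_z {a g : ℕ} {s x : ℕ} : Val a g (pr 1 s) x ↔ Entry g s x := by
  rw [val_iff]
  simp [ValStep]

theorem PTerm.val_code {l : List ℕ} {g : ℕ} {t : PTerm} (ht : t.VarsLt l.length) {x : ℕ} :
    Val (codeL l) g t.code x ↔ x = t.eval (envL l) := by
  induction t generalizing x with
  | var i =>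
    have hi : i < l.length := ht
    rw [val_iff]
    simp [ValStep, PTerm.code, PTerm.eval, entry_codeL, envL, hi, eq_comm]
  | zero => exact val_zero
  | succ t ih =>
    have ih := @ih ht
    unfold Val at ih
    rw [val_iff]
    simp [ValStep, PTerm.code, PTerm.eval, ih]
  | add t s ih ih' =>
    have ih := @ih ht.1
    have ih' := @ih' ht.2
    unfold Val at ih ih'
    rw [val_iff]
    simp [ValStep, PTerm.code, PTerm.eval, ih, ih']
  | mul t s ih ih' =>
    have ih := @ih ht.1
    have ih' := @ih' ht.2
    unfold Val at ih ih'
    rw [val_iff]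
    simp [ValStep, PTerm.code, PTerm.eval, ih, ih']

/-! ### Truth of formulas with bounded quantifiers -/

theorem Finitary.all_lt {M : Type*} {Ψ : ℕ → (M → Prop) → Prop} (h : ∀ z, Finitary (Ψ z))
    (x : ℕ) : Finitary fun P => ∀ z, z < x → Ψ z P := by
  refine ⟨fun P Q hPQ hP z hz => (h z).1 hPQ (hP z hz), fun P hP => ?_⟩
  choose! F hF using fun z (hz : z < x) => (h z).2 P (hP z hz)
  refine ⟨⋃ z ∈ Set.Iio x, F z, (Set.finite_Iio x).biUnion fun z hz => (hF z hz).1, ?_, ?_⟩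
  · simp only [Set.mem_iUnion, Set.mem_Iio]
    rintro y ⟨z, hz, hy⟩
    exact (hF z hz).2.1 y hy
  · intro z hz
    refine (h z).1 (fun y hy => ?_) (hF z hz).2.2
    simp only [Set.mem_iUnion, Set.mem_Iio]
    exact ⟨z, hz, hy⟩

theorem sat_iff (g ψ a b : ℕ) : Sat g ψ a b ↔ SatStep g (Gen (SatStep g)) (pr ψ (pr a b)) := by
  refine Gen.iff (fun x => ?_) _
  unfold SatStep
  repeat' first
    | exact Finitary.const _
    | exact Finitary.app _
    | refine Finitary.and ?_ ?_
    | refine Finitary.or ?_ ?_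
    | refine Finitary.ex fun _ => ?_
    | refine Finitary.all_lt (fun _ => ?_) _

theorem sat_neg {g p a b : ℕ} : Sat g (pr 8 p) a b ↔
    (Sat g p a 0 ∧ b = 1) ∨ (Sat g p a 1 ∧ b = 0) := by
  rw [sat_iff]
  simp [SatStep, Sat, exists_or]

theorem sat_or {g p q a b : ℕ} : Sat g (pr 9 (pr p q)) a b ↔
    ((Sat g p a 1 ∨ Sat g q a 1) ∧ b = 1) ∨ ((Sat g p a 0 ∧ Sat g q a 0) ∧ b = 0) := by
  rw [sat_iff]
  simp [SatStep, Sat, exists_or]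

theorem sat_bex {g p a b s : ℕ} :
    Sat g (pr 10 (pr 8 (pr 9 (pr (pr 8 (pr 7 (pr (pr 0 0) (pr 1 s)))) (pr 8 p))))) a b ↔
      ∃ x, Entry g s x ∧ (((∃ z, z < x ∧ Sat g p (pr z a + 1) 1) ∧ b = 1) ∨
        ((∀ z, z < x → Sat g p (pr z a + 1) 0) ∧ b = 0)) := by
  have h : ∃ m k : ℕ, IsTermIn 1 m k (pr 1 s) := ⟨0, s + 1, isTermIn_z.2 (Nat.lt_succ_self s)⟩
  have hz : ∀ x, Val (pr 0 a + 1) g (pr 1 s) x ↔ Entry g s x := fun x => val_z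
  rw [sat_iff]
  simp [SatStep, Sat, exists_or, and_or_left, h, hz]

open Classical in
/-- Bounding the quantifiers by sufficiently sparse elements preserves truth. -/
theorem PForm.sat_star {I : Set ℕ} {F : ℕ → ℕ}
    (hF : ∀ (h : ℕ) (φ : PForm), φ.code < h → ∀ e : ℕ → ℕ, (∀ k, e k < h) →
      (∃ y, φ.Holds (consEnv y e)) → ∃ y < F h, φ.Holds (consEnv y e))
    (hI : ∀ i ∈ I, ∀ j ∈ I, i < j → F i ≤ j) {g : List ℕ} (hg : g.Pairwise (· < ·))
    (hgI : ∀ x ∈ g, x ∈ I) (P : PForm) : ∀ {s h b : ℕ} {l : List ℕ}, h ∈ I → P.code < h →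
      (∀ x ∈ l, x < h) → P.VarsLt l.length → s + P.depth ≤ g.length →
      (∀ i x, s ≤ i → g[i]? = some x → h < x) →
      (Sat (codeL g) (P.star s) (codeL l) b ↔ b = if P.Holds (envL l) then 1 else 0) := by
  induction P with
  | eq t u =>
    intro s h b l hh hc hl hv hs hlt
    rw [PForm.star, sat_iff]
    simp [SatStep, and_or_left, exists_or, PTerm.val_code hv.1, PTerm.val_code hv.2, PForm.Holds]
    by_cases h' : t.eval (envL l) = u.eval (envL l) <;> simp [h']
  | lt t u =>
    intro s h b l hh hc hl hv hs hlt
    rw [PForm.star, sat_iff]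
    simp [SatStep, and_or_left, exists_or, PTerm.val_code hv.1, PTerm.val_code hv.2, PForm.Holds]
    by_cases h' : t.eval (envL l) < u.eval (envL l) <;> simp [h', not_le.2, not_lt.1]
  | neg P ih =>
    intro s h b l hh hc hl hv hs hlt
    have hc' : P.code < h := (lt_pr_of_pos (by norm_num)).trans hc
    rw [PForm.star, sat_neg, ih hh hc' hl hv hs hlt, ih hh hc' hl hv hs hlt]
    by_cases hP : P.Holds (envL l) <;> simp [PForm.Holds, hP]
  | or P Q ih ih' =>
    intro s h b l hh hc hl hv hs hlt
    have hc' : P.code < h := ((le_pr_left _ _).trans_lt (lt_pr_of_pos (by norm_num))).trans hc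
    have hc'' : Q.code < h := ((le_pr_right _ _).trans_lt (lt_pr_of_pos (by norm_num))).trans hc
    have hs' : s + P.depth ≤ g.length ∧ s + Q.depth ≤ g.length := by
      rw [PForm.depth] at hs
      omega
    rw [PForm.star, sat_or, ih hh hc' hl hv.1 hs'.1 hlt, ih hh hc' hl hv.1 hs'.1 hlt,
      ih' hh hc'' hl hv.2 hs'.2 hlt, ih' hh hc'' hl hv.2 hs'.2 hlt]
    by_cases hP : P.Holds (envL l) <;> by_cases hQ : Q.Holds (envL l) <;>
      simp [PForm.Holds, hP, hQ]
  | ex P ih =>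
    intro s h b l hh hc hl hv hs hlt
    have hc' : P.code < h := (lt_pr_of_pos (by norm_num)).trans hc
    rw [PForm.depth] at hs
    have hsl : s < g.length := by omega
    have hw := hlt s g[s] le_rfl (List.getElem?_eq_getElem hsl)
    have hwI := hgI _ (List.getElem_mem hsl)
    have key : ∀ z < g[s], ∀ b, Sat (codeL g) (P.star (s + 1)) (pr z (codeL l) + 1) b ↔
        b = if P.Holds (consEnv z (envL l)) then 1 else 0 := by
      intro z hz b
      rw [← envL_cons]
      refine ih (l := z :: l) hwI (hc'.trans hw) ?_ hv (by omega) ?_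
      · rintro x (_ | ⟨_, hx⟩)
        · exact hz
        · exact (hl x hx).trans hw
      · intro i x hi hx
        obtain ⟨hi', rfl⟩ := List.getElem?_eq_some_iff.1 hx
        exact List.pairwise_iff_getElem.1 hg s i hsl hi' hi
    have hex : (∃ y, P.Holds (consEnv y (envL l))) ↔ ∃ y < g[s], P.Holds (consEnv y (envL l)) := by
      refine ⟨fun hy => ?_, fun ⟨y, _, hy⟩ => ⟨y, hy⟩⟩
      obtain ⟨y, hyF, hy⟩ := hF h P hc' _ (envL_lt (Nat.zero_lt_of_lt hc) hl) hy
      exact ⟨y, hyF.trans_le (hI h hh _ hwI hw), hy⟩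
    rw [PForm.star, sat_bex]
    simp only [entry_codeL, List.getElem?_eq_getElem hsl, Option.some.injEq, exists_eq_left',
      PForm.Holds, hex]
    by_cases hP : ∃ y < g[s], P.Holds (consEnv y (envL l))
    · have h1 : ∃ z < g[s], Sat (codeL g) (P.star (s + 1)) (pr z (codeL l) + 1) 1 := by
        obtain ⟨y, hy, hP⟩ := hP
        exact ⟨y, hy, (key y hy 1).2 (by simp [hP])⟩
      have h2 : ¬ ∀ z < g[s], Sat (codeL g) (P.star (s + 1)) (pr z (codeL l) + 1) 0 := by
        intro h2
        obtain ⟨y, hy, hP⟩ := hP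
        simpa [hP] using (key y hy 0).1 (h2 y hy)
      simp [h1, h2, hP]
    · have h1 : ¬ ∃ z < g[s], Sat (codeL g) (P.star (s + 1)) (pr z (codeL l) + 1) 1 := by
        rintro ⟨y, hy, h1⟩
        have := (key y hy 1).1 h1
        rw [if_neg fun h' => hP ⟨y, hy, h'⟩] at this
        omega
      have h2 : ∀ z < g[s], Sat (codeL g) (P.star (s + 1)) (pr z (codeL l) + 1) 0 := by
        intro y hy
        exact (key y hy 0).2 (if_neg fun h' => hP ⟨y, hy, h'⟩).symm
      simp only [h1, false_and, false_or, if_neg hP, and_iff_right_iff_imp]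
      exact fun _ => h2

section FirstElements

variable {I : Set ℕ}

theorem exists_start (hI : ∀ m, ∃ x ∈ I, m < x) (φ : ℕ) (l : List ℕ) :
    ∃ j, Start I φ (codeL l) j := by
  have h : ∃ j, j ∈ I ∧ Below φ (codeL l) j := by
    obtain ⟨x, hx, hlt⟩ := hI (φ + l.sum)
    refine ⟨x, hx, by omega, fun i y hy => ?_⟩
    rw [entry_codeL] at hy
    have := List.single_le_sum (fun _ _ => Nat.zero_le _) y (List.mem_of_getElem? hy)
    omega
  classical
  exact ⟨Nat.find h, Nat.find_spec h, fun w hw => Nat.find_min' h hw⟩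

theorem First.pairwise {j : ℕ} {g : List ℕ} (h : First I j (codeL g)) : g.Pairwise (· < ·) :=
  List.pairwise_iff_getElem.2 fun i i' hi hi' hlt =>
    (h i' g[i'] (entry_codeL.2 (List.getElem?_eq_getElem hi'))).1.2.2 i g[i]
      ⟨hlt, entry_codeL.2 (List.getElem?_eq_getElem hi)⟩

theorem exists_first (hI : ∀ m, ∃ x ∈ I, m < x) (j k : ℕ) :
    ∃ g : List ℕ, g.length = k ∧ First I j (codeL g) := by
  classical
  induction k with
  | zero => exact ⟨[], rfl, fun i x h => by simp [entry_codeL] at h⟩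
  | succ k ih =>
    obtain ⟨g, rfl, hg⟩ := ih
    have h : ∃ x, x ∈ I ∧ Above j (codeL g) g.length x := by
      obtain ⟨x, hx, hlt⟩ := hI (j + g.sum)
      refine ⟨x, hx, by omega, fun i y hy => ?_⟩
      have := List.single_le_sum (fun _ _ => Nat.zero_le _) y
        (List.mem_of_getElem? (entry_codeL.1 hy.2))
      omega
    have happ : ∀ i ≤ g.length, ∀ w, Above j (codeL (g ++ [Nat.find h])) i w ↔
        Above j (codeL g) i w := by
      intro i hi w
      refine and_congr_right fun _ => forall₂_congr fun i' x => imp_congr_left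
        (and_congr_right fun hi' => ?_)
      rw [entry_codeL, entry_codeL, List.getElem?_append_left (hi'.trans_le hi)]
    refine ⟨g ++ [Nat.find h], by simp, fun i x hx => ?_⟩
    rw [entry_codeL] at hx
    rcases lt_trichotomy i g.length with hi | rfl | hi
    · simp only [happ i hi.le]
      rw [List.getElem?_append_left hi] at hx
      exact hg i x (entry_codeL.2 hx)
    · simp only [happ g.length le_rfl]
      obtain rfl : Nat.find h = x := by simpa using hx
      exact ⟨Nat.find_spec h, fun w hw => Nat.find_min' h hw⟩
    · rw [List.getElem?_eq_none (by simp; omega)] at hx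
      cases hx

end FirstElements

/-! ### The standard model with a sparse set of indiscernibles -/

section Sparse

variable {I : Set ℕ} {F : ℕ → ℕ}

theorem sigma_code (hF : ∀ (h : ℕ) (φ : PForm), φ.code < h → ∀ e : ℕ → ℕ, (∀ k, e k < h) →
      (∃ y, φ.Holds (consEnv y e)) → ∃ y < F h, φ.Holds (consEnv y e))
    (hI : ∀ i ∈ I, ∀ j ∈ I, i < j → F i ≤ j) (hub : ∀ m, ∃ x ∈ I, m < x) {P : PForm}
    {l : List ℕ} (hP : P.VarsLt l.length) :
    Sigma' I P.code (codeL l) ↔ P.Holds (envL l) := by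
  classical
  have key : ∀ (j : ℕ) (g : List ℕ), Start I P.code (codeL l) j → P.depth = g.length →
      First I j (codeL g) → (Sat (codeL g) (P.star 0) (codeL l) 1 ↔ P.Holds (envL l)) := by
    intro j g hj hg hfirst
    rw [PForm.sat_star hF hI hfirst.pairwise ?_ P hj.1.1 hj.1.2.1 ?_ hP (by omega) ?_]
    · by_cases h : P.Holds (envL l) <;> simp [h]
    · intro x hx
      obtain ⟨i, hi⟩ := List.mem_iff_getElem?.1 hx
      exact (hfirst i x (entry_codeL.2 hi)).1.1
    · intro x hx
      obtain ⟨i, hi⟩ := List.mem_iff_getElem?.1 hx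
      exact hj.1.2.2 i x (entry_codeL.2 hi)
    · exact fun i x _ hx => (hfirst i x (entry_codeL.2 hx)).1.2.1
  constructor
  · rintro ⟨m, ψ, k, j, g, ⟨⟨⟨⟨⟨-, hψ⟩, hk⟩, hj⟩, htup⟩, hfirst⟩, hsat⟩
    obtain rfl := P.isStar_code.1 hψ
    obtain rfl := P.isDepth_code.1 hk
    obtain ⟨g, hg, rfl⟩ := isTup_nat.1 htup
    exact (key j g hj hg.symm hfirst).1 hsat
  · intro h
    obtain ⟨j, hj⟩ := exists_start hub P.code l
    obtain ⟨g, hg, hfirst⟩ := exists_first hub j P.depth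
    have h1 : IsForm l.length P.code ∧ IsTup l.length (codeL l) :=
      ⟨P.isForm_code.2 hP, isTup_codeL.2 rfl⟩
    have h2 : IsStar 0 P.code (P.star 0) ∧ IsDepth P.code P.depth :=
      ⟨P.isStar_code.2 rfl, P.isDepth_code.2 rfl⟩
    have h3 : IsTup P.depth (codeL g) := isTup_codeL.2 hg
    exact ⟨l.length, P.star 0, P.depth, j, codeL g,
      ⟨⟨⟨⟨⟨h1, h2.1⟩, h2.2⟩, hj⟩, h3⟩, hfirst⟩, (key j g hj hg.symm hfirst).2 h⟩

theorem tarski_sigma (hF : ∀ (h : ℕ) (φ : PForm), φ.code < h → ∀ e : ℕ → ℕ, (∀ k, e k < h) →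
      (∃ y, φ.Holds (consEnv y e)) → ∃ y < F h, φ.Holds (consEnv y e))
    (hI : ∀ i ∈ I, ∀ j ∈ I, i < j → F i ≤ j) (hub : ∀ m, ∃ x ∈ I, m < x) :
    Tarski (Sigma' I) := by
  intro m a ha
  obtain ⟨l, rfl, rfl⟩ := isTup_nat.1 ha
  have key : ∀ {P : PForm} {l : List ℕ}, P.VarsLt l.length →
      (Sigma' I P.code (codeL l) ↔ P.Holds (envL l)) := sigma_code hF hI hub
  refine ⟨⟨⟨?_, ?_⟩, ?_⟩, ?_⟩
  · rintro t s ⟨ht, hs⟩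
    obtain ⟨T, rfl⟩ := exists_pterm t ht
    obtain ⟨S, rfl⟩ := exists_pterm s hs
    rw [PTerm.isTermIn_code] at ht hs
    simp only [PTerm.val_code ht, PTerm.val_code hs]
    constructor
    · rw [show pr 6 (pr T.code S.code) = (PForm.eq T S).code from rfl, key (P := .eq T S) ⟨ht, hs⟩]
      simp [PForm.Holds]
    · rw [show pr 7 (pr T.code S.code) = (PForm.lt T S).code from rfl, key (P := .lt T S) ⟨ht, hs⟩]
      simp [PForm.Holds]
  · intro φ hφ
    obtain ⟨P, rfl⟩ := exists_pform φ hφ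
    rw [PForm.isForm_code] at hφ
    rw [show pr 8 P.code = (PForm.neg P).code from rfl, key (P := .neg P) hφ, key hφ, PForm.Holds]
  · rintro φ ψ ⟨hφ, hψ⟩
    obtain ⟨P, rfl⟩ := exists_pform φ hφ
    obtain ⟨R, rfl⟩ := exists_pform ψ hψ
    rw [PForm.isForm_code] at hφ hψ
    rw [show pr 9 (pr P.code R.code) = (PForm.or P R).code from rfl, key (P := .or P R) ⟨hφ, hψ⟩,
      key hφ, key hψ, PForm.Holds]
  · intro φ hφ
    obtain ⟨P, rfl⟩ := exists_pform φ hφ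
    rw [PForm.isForm_code] at hφ
    rw [show pr 10 P.code = (PForm.ex P).code from rfl, key (P := .ex P) hφ, PForm.Holds]
    refine exists_congr fun y => ?_
    rw [← envL_cons]
    exact (key (l := y :: l) hφ).symm

end Sparse

theorem nat_model_Q : ℕ ⊨ Q := by
  simp only [Q, Theory.model_iff, Set.mem_insert_iff, Set.mem_singleton_iff, forall_eq_or_imp,
    forall_eq, realize_closure]
  refine ⟨?_, ?_, ?_, ?_, ?_, ?_, ?_, ?_⟩ <;> intro e <;> simp
  · exact fun h => ⟨e 0 - 1, (Nat.succ_pred_eq_of_ne_zero h).symm⟩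
  · rfl
  · rfl
  · change e 0 < e 1 ↔ ∃ x, x + 1 + e 0 = e 1
    exact ⟨fun h => ⟨e 1 - e 0 - 1, by omega⟩, fun ⟨x, hx⟩ => by omega⟩

theorem nat_model_PAofI (I : Set ℕ) : Expansion ℕ I ⊨ PAofI := by
  refine model_PAofI_iff.2 ⟨nat_model_Q, fun n φ p h0 hs x => ?_⟩
  rw [zeroM_eq] at h0
  simp only [succM_eq] at hs
  exact Nat.rec h0 hs x

theorem isSatisfiable_PAIalpha : PAIalpha.IsSatisfiable := by
  rw [Theory.isSatisfiable_iff_isFinitelySatisfiable]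
  intro T hT
  obtain ⟨F, hF⟩ := PForm.exists_witness_function
  have h1 : ∀ s : T, ∃ q : Σ n, LA.Formula (Fin n),
      (∃ q' : Σ n, LA.Formula (Fin n), s.1 = Indis q'.2) → s.1 = Indis q.2 := by
    intro s
    by_cases h : ∃ q' : Σ n, LA.Formula (Fin n), s.1 = Indis q'.2
    · exact h.imp fun q hq _ => hq
    · exact ⟨⟨0, ⊥⟩, fun h' => absurd h' h⟩
  choose q hq using h1
  obtain ⟨I, hub, hI, hhom⟩ := exists_sparse_homogeneous (fun s => (q s).1)
    (fun s l => (q s).2.Realize fun i => l.getD i 0) F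
  have h2 : ∀ s : T, Expansion ℕ I ⊨ Indis (q s).2 := by
    intro s
    refine (model_Indis _).2 fun x y hx hx' hy hy' => ?_
    have h3 := hhom s (List.ofFn x) (List.ofFn y) (List.pairwise_ofFn.2 fun i j h => hx' h)
      (by simpa [List.mem_ofFn] using hx) (by simp) (List.pairwise_ofFn.2 fun i j h => hy' h)
      (by simpa [List.mem_ofFn] using hy) (by simp)
    simpa using h3
  have h3 : Expansion ℕ I ⊨ (T : LAI.Theory) := by
    refine (Theory.model_iff _).2 fun s hs => ?_
    rcases hT hs with ((h | h) | ⟨n, φ, h⟩) | h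
    · exact (Theory.model_iff _).1 (nat_model_PAofI I) s h
    · rw [Set.mem_singleton_iff.1 h]
      exact model_Ubd.2 hub
    · have h4 : s = _ := hq ⟨s, hs⟩ ⟨⟨n, φ⟩, h⟩
      rw [h4]
      exact h2 ⟨s, hs⟩
    · rw [Set.mem_singleton_iff.1 h]
      exact model_alpha.2 (tarski_sigma hF hI hub)
  have : Nonempty (Expansion ℕ I) := ⟨(0 : ℕ)⟩
  exact ⟨Theory.ModelType.of _ (Expansion ℕ I)⟩

theorem nonempty_modelType {U : LAI.Theory}
    (hU : U ∈ ({PAICirc, PAI, PAIalpha} : Set LAI.Theory)) :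
    Nonempty (Theory.ModelType.{0, 0, u} U) := by
  obtain ⟨N⟩ := isSatisfiable_PAIalpha
  obtain @⟨M, S, hM, hne⟩ := Theory.ModelType.ulift.{0, 0, 0, u} N
  obtain ⟨_, I, rfl⟩ := exists_expansion_eq S
  have hM' : Expansion M I ⊨ PAIalpha := hM
  have h1 : Expansion M I ⊨ PAI := hM'.mono Set.subset_union_left
  have hPA : Expansion M I ⊨ PAofI :=
    h1.mono (Set.subset_union_left.trans Set.subset_union_left)
  obtain ⟨_, _, _, _, _⟩ := PAofI.isPeano hPA
  have : Nonempty (Expansion M I) := hne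
  rcases hU with rfl | rfl | rfl
  · have := model_PAICirc_of_PAI h1
    exact ⟨Theory.ModelType.of _ (Expansion M I)⟩
  · exact ⟨Theory.ModelType.of _ (Expansion M I)⟩
  · exact ⟨Theory.ModelType.of _ (Expansion M I)⟩

end ArithInd

theorem theorem5p5 :
    (∀ U ∈ ({PAICirc, PAI, PAIalpha} : Set LAI.Theory),
      NowhereSolid.{u} U ∧ ¬ Solid.{u} U) ∧
    (∀ (M : Type u) [LA.Structure M] (I : Set M), Expansion M I ⊨ PAI →
      Expansion M (double I) ⊨ PAI ∧
      IsInterpretation LAI (Expansion M (double I)) (Expansion M I) (id : M → M) ∧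
      IsInterpretation LAI (Expansion M I) (Expansion M (double I)) (id : M → M) ∧
      ¬ ∃ f : Expansion M I ≃[LAI] Expansion M (double I),
        DefinableMap LAI (Expansion M I) (f : M → M)) ∧
    (∀ (M : Type u) [LA.Structure M] (I : Set M), Expansion M I ⊨ PAofI →
      ∀ f : M ≃[LA] M, DefinableMap LAI (Expansion M I) (f : M → M) → ∀ x, f x = x) := by
  refine ⟨fun U hU => ⟨nowhereSolid hU, fun h => ?_⟩,
    fun M _ I h => double_isInterpreted h, fun M _ I h f hf x => definably_rigid h f hf x⟩
  obtain ⟨M⟩ := nonempty_modelType.{u} hU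
  exact nowhereSolid hU M (h M)
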